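/- **Setting.** Manifolds are smooth Hausdorff manifolds modelled on Hausdorff locally convex spaces, and smooth means $C^\infty$ in the sense of Michal–Bastiani. A submersion is a smooth map that is locally, up to diffeomorphism, the projection of a product. For a surjective submersion $\pi:Y\to M$ let $Y^{[p]}$ be the $p$-fold fibre product, $\pi_i:Y^{[p]}\to Y^{[p-1]}$ the map omitting the $i$-th factor, and $\delta=\sum_{i}(-1)^{i-1}\pi_i^*$; the same notation is used for circle bundles (with $\otimes$ for $+$). A bundle gerbe $\mathcal G=(Y,P,s)$ over $M$ consists of such a $\pi$, a principal $\mathbb T$-bundle $P\to Y^{[2]}$ and a section $s$ of $\delta P=\pi_1^*P\otimes\pi_2^*P^{-1}\otimes\pi_3^*P\to Y^{[3]}$ with $\delta s=1$. A connection on it is a connection $\nabla\in\sqrt{-1}A^1(P)$ on $P$ with $s^*(\delta\nabla)=0$; a curving is $f\in\sqrt{-1}A^2(Y)$ with $\delta f=F(\nabla)$. If a Lie group $G$ acts on $M$ (from the left), $\mathcal G$ is strongly $G$-equivariant if the action is lifted to $Y$ and the induced action on $Y^{[2]}$ to $P$ by bundle isomorphisms so that $s$ is invariant; $\nabla$ and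 $f$ are then required to be $G$-invariant. A stable isomorphism from $(\mathcal G,\nabla,f)$ to $(\mathcal G',\nabla',f')$, as strongly $G$-equivariant bundle gerbes with connection and curving over $M$, consists of a $G$-equivariant principal $\mathbb T$-bundle $R\to Y\times_MY'$, a $G$-invariant section $v$ of $\delta R^{-1}\otimes P^{-1}\otimes P'$ with $\delta v=s^{-1}\otimes s'$, and a $G$-invariant connection $\eta$ on $R$ with $v^*(\delta\eta^{-1}\otimes\nabla^{-1}\otimes\nabla')=0$ and $F(\eta)=f'-f$. **Hypotheses.** Let $G$ be a Lie group with Lie algebra $\mathfrak g$ acting on $M$, and let $(\mathcal G,\nabla,f)$, $\mathcal G=(Y,P,s)$, be a strongly $G$-equivariant bundle gerbe with ($G$-invariant) connection and curving over $M$. Suppose that $G$ acts freely and locally trivially on $M$ and on $Y$, with smooth quotient manifolds $q:M\to M/G$ and $q_Y:Y\to Y/G$, i.e. both are smooth principal $G$-bundles. Let $\tilde\lambda:Y^{[2]}\to\mathrm{Hom}(\mathfrak g,\sqrt{-1}\mathbb R)$ be the moment of $(P,\nabla)$, $\langle X|\tilde\lambda\rangle=\nabla(X^*)$, where $X^*$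 is the vector generated by $X\in\mathfrak g$. Let $\lambda:Y\to\mathrm{Hom}(\mathfrak g,\sqrt{-1}\mathbb R)$ be a smooth map with $\delta\lambda=\tilde\lambda$ and $(E,\zeta)=0$, where $$\langle X|\pi^*E\rangle=\tfrac1{2\pi\sqrt{-1}}\bigl(\langle X|d\lambda\rangle+\iota_{X^*}f\bigr),\qquad \langle X|\pi^*\zeta(g)\rangle=\tfrac1{2\pi\sqrt{-1}}\langle X|g^*\lambda-\mathrm{Ad}_g\lambda\rangle ,\qquad \langle X|\mathrm{Ad}_g\lambda\rangle=\langle \mathrm{Ad}_{g^{-1}}X|\lambda\rangle .$$ Let $\Xi\in A^1(M,\mathfrak g)$ be a connection on the principal $G$-bundle $q$ (so $\Xi(X^*)=X$ and $g^*\Xi=\mathrm{Ad}_g\Xi$), and put $\kappa=\langle\pi^*\Xi|\lambda\rangle\in\sqrt{-1}A^1(Y)$. **Theorem.** (1) The quotient bundle gerbe $\bar{\mathcal G}=(Y/G,P/G,\bar s)$ over $M/G$ exists: there is a bundle gerbe with these data such that the quotient map $\rho:P\to P/G$ is a surjective submersion whose fibres are the $G$-orbits, is $\mathbb T$-equivariant,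 covers $q_Y\times q_Y$ and takes $s$ to $\bar s$. (2) For every such quotient gerbe, $\nabla-\delta\kappa$ and $f-d\kappa$ descend: there are a unique $\bar\nabla$ with $\rho^*\bar\nabla=\nabla-\delta\kappa$ and a unique $\bar f$ with $q_Y^*\bar f=f-d\kappa$, and they are a connection on $\bar{\mathcal G}$ and a curving for $\bar\nabla$. (3) The pull-back $q^*(\bar{\mathcal G},\bar\nabla,\bar f)$, with $G$ acting through its action on $M$, exists, is a strongly $G$-equivariant bundle gerbe with connection and curving over $M$, and is stably isomorphic to $(\mathcal G,\nabla,f)$ as such. -/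

import Mathlib

open Set Filter Topology

universe u v w

noncomputable section

/-! ### Smooth maps between Hausdorff locally convex spaces (Michal-Bastiani calculus) -/

section Calculus

variable {E : Type u} [AddCommGroup E] [Module ℝ E] [TopologicalSpace E]
variable {F : Type v} [AddCommGroup F] [Module ℝ F] [TopologicalSpace F]

/-- `w` is the derivative of `f` at `x` in the direction `v`. -/
def HasDirDeriv (f : E → F) (x v : E) (w : F) : Prop :=
  Tendsto (fun t : ℝ => t⁻¹ • (f (x + t • v) - f x)) (𝓝[≠] (0 : ℝ)) (𝓝 w)

/-- The derivative of `f` at `x` in the direction `v`. -/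
def dirDeriv (f : E → F) (x v : E) : F :=
  limUnder (𝓝[≠] (0 : ℝ)) (fun t : ℝ => t⁻¹ • (f (x + t • v) - f x))

/-- `f` is of class `C^n` on the open set `U`: it is continuous and, for `n ≥ 1`, all its directional
derivatives exist on `U` and `(x, v) ↦ df(x; v)` is of class `C^(n-1)` on `U × E`. -/
def MBDiffOn {F : Type v} [AddCommGroup F] [Module ℝ F] [TopologicalSpace F] :
    ℕ → ∀ {E : Type u} [AddCommGroup E] [Module ℝ E] [TopologicalSpace E], (E → F) → Set E → Prop
  | 0, _, _, _, _, f, U => ContinuousOn f U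
  | n + 1, E, _, _, _, f, U => ContinuousOn f U ∧ ∃ df : E × E → F,
      (∀ x ∈ U, ∀ v, HasDirDeriv f x v (df (x, v))) ∧ MBDiffOn n df (U ×ˢ univ)

/-- `f` is smooth (of class `C^∞`) on the open set `U`. -/
def MBSmoothOn (f : E → F) (U : Set E) : Prop := ∀ n, MBDiffOn n f U

theorem MBDiffOn.continuousOn {n : ℕ} {f : E → F} {U : Set E} (h : MBDiffOn n f U) :
    ContinuousOn f U := by
  cases n with
  | zero => exact h
  | succ n => exact h.1

theorem MBDiffOn.mono {n : ℕ} {f : E → F} {U V : Set E} (h : MBDiffOn n f U) (hVU : V ⊆ U) :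
    MBDiffOn n f V := by
  induction n generalizing E with
  | zero => exact ContinuousOn.mono h hVU
  | succ n ih =>
    obtain ⟨hc, df, hd, hdf⟩ := h
    exact ⟨hc.mono hVU, df, fun x hx v => hd x (hVU hx) v, ih hdf (prod_mono hVU subset_rfl)⟩

theorem MBDiffOn.congr {n : ℕ} {f g : E → F} {U : Set E} (h : MBDiffOn n f U) (hfg : f = g) :
    MBDiffOn n g U := hfg ▸ h

theorem MBDiffOn.comp_clm {n : ℕ} {f : E → F} {U : Set E} (h : MBDiffOn n f U)
    {E' : Type w} [AddCommGroup E'] [Module ℝ E'] [TopologicalSpace E'] (L : E' →L[ℝ] E) :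
    MBDiffOn n (f ∘ L) (L ⁻¹' U) := by
  induction n generalizing E E' with
  | zero => exact ContinuousOn.comp h L.continuous.continuousOn (fun _ hx => hx)
  | succ n ih =>
    obtain ⟨hc, df, hd, hdf⟩ := h
    refine ⟨hc.comp L.continuous.continuousOn (fun _ hx => hx), df ∘ (L.prodMap L), ?_, ?_⟩
    · intro x hx v
      have := hd (L x) hx (L v)
      simpa [HasDirDeriv] using this
    · refine (ih hdf (L.prodMap L)).mono ?_
      rintro ⟨x, v⟩ ⟨hx, -⟩
      exact ⟨hx, mem_univ _⟩

theorem MBDiffOn.prodMk {F' : Type w} [AddCommGroup F'] [Module ℝ F'] [TopologicalSpace F']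
    {n : ℕ} {f : E → F} {g : E → F'} {U : Set E} (hf : MBDiffOn n f U) (hg : MBDiffOn n g U) :
    MBDiffOn n (fun x => (f x, g x)) U := by
  induction n generalizing E with
  | zero => exact ContinuousOn.prodMk hf hg
  | succ n ih =>
    obtain ⟨hc, df, hd, hdf⟩ := hf
    obtain ⟨hc', dg, hd', hdg⟩ := hg
    exact ⟨hc.prodMk hc', fun x => (df x, dg x),
      fun x hx v => (hd x hx v).prodMk_nhds (hd' x hx v), ih hdf hdg⟩

theorem MBDiffOn.clm {n : ℕ} (L : E →L[ℝ] F) (U : Set E) : MBDiffOn n L U := by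
  induction n generalizing E with
  | zero => exact L.continuous.continuousOn
  | succ n ih =>
    refine ⟨L.continuous.continuousOn, L.comp (ContinuousLinearMap.snd ℝ E E), ?_, ih _ _⟩
    intro x _ v
    refine (tendsto_const_nhds (x := L v)).congr' ?_
    filter_upwards [self_mem_nhdsWithin] with t ht
    have ht' : t ≠ 0 := ht
    simp [smul_smul, inv_mul_cancel₀ ht']

end Calculus

/-! ### Smooth manifolds modelled on Hausdorff locally convex spaces -/

/-- A smooth structure on the space `M`: for every point `x` a chart around `x` with values in a
Hausdorff locally convex space `Tan x`, the changes of charts being smooth. As the chart at `x` is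
distinguished, its model space `Tan x` also serves as the tangent space at `x`. -/
class SmoothManifold (M : Type u) [TopologicalSpace M] where
  Tan : M → Type u
  [instAddCommGroup : ∀ x, AddCommGroup (Tan x)]
  [instModule : ∀ x, Module ℝ (Tan x)]
  [instTop : ∀ x, TopologicalSpace (Tan x)]
  [instTopAddGroup : ∀ x, IsTopologicalAddGroup (Tan x)]
  [instContSMul : ∀ x, ContinuousSMul ℝ (Tan x)]
  [instLocConvex : ∀ x, LocallyConvexSpace ℝ (Tan x)]
  [instTanT2 : ∀ x, T2Space (Tan x)]
  [instT2 : T2Space M]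
  chart : ∀ x, OpenPartialHomeomorph M (Tan x)
  mem_chart_source : ∀ x, x ∈ (chart x).source
  smooth_transition : ∀ x y, MBSmoothOn (chart y ∘ (chart x).symm)
    ((chart x).target ∩ (chart x).symm ⁻¹' (chart y).source)

open SmoothManifold (Tan chart)

attribute [reducible] SmoothManifold.instAddCommGroup SmoothManifold.instModule
  SmoothManifold.instTop

attribute [instance] SmoothManifold.instAddCommGroup SmoothManifold.instModule
  SmoothManifold.instTop SmoothManifold.instTopAddGroup SmoothManifold.instContSMul
  SmoothManifold.instLocConvex SmoothManifold.instTanT2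

/-- A Hausdorff locally convex space as a smooth manifold, with the identity as chart. -/
instance (priority := 50) instSmoothManifoldSpace (E : Type u) [AddCommGroup E] [Module ℝ E]
    [TopologicalSpace E] [IsTopologicalAddGroup E] [ContinuousSMul ℝ E] [LocallyConvexSpace ℝ E]
    [T2Space E] : SmoothManifold E where
  Tan _ := E
  chart _ := OpenPartialHomeomorph.refl E
  mem_chart_source _ := mem_univ _
  smooth_transition _ _ _ := MBDiffOn.clm (ContinuousLinearMap.id ℝ E) _

/-- The product of two manifolds. -/
instance instSmoothManifoldProd (M : Type u) [TopologicalSpace M] [SmoothManifold M]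
    (N : Type v) [TopologicalSpace N] [SmoothManifold N] : SmoothManifold (M × N) where
  Tan x := Tan x.1 × Tan x.2
  instT2 := by
    have := SmoothManifold.instT2 (M := M)
    have := SmoothManifold.instT2 (M := N)
    infer_instance
  chart x := (chart x.1).prod (chart x.2)
  mem_chart_source x := ⟨SmoothManifold.mem_chart_source x.1, SmoothManifold.mem_chart_source x.2⟩
  smooth_transition x y n := by
    have h1 := (SmoothManifold.smooth_transition x.1 y.1 n).comp_clm
      (ContinuousLinearMap.fst ℝ (Tan x.1) (Tan x.2))
    have h2 := (SmoothManifold.smooth_transition x.2 y.2 n).comp_clm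
      (ContinuousLinearMap.snd ℝ (Tan x.1) (Tan x.2))
    refine ((h1.mono ?_).prodMk (h2.mono ?_)).congr ?_
    · rintro z ⟨hz, hz'⟩
      exact ⟨hz.1, hz'.1⟩
    · rintro z ⟨hz, hz'⟩
      exact ⟨hz.2, hz'.2⟩
    · rfl

section SmoothMaps

variable {M : Type u} [TopologicalSpace M] [SmoothManifold M]
variable {N : Type v} [TopologicalSpace N] [SmoothManifold N]

/-- `U` is open and `f` is smooth on `U`. -/
def SmoothOnOpen (f : M → N) (U : Set M) : Prop :=
  IsOpen U ∧ ContinuousOn f U ∧ ∀ (a : M) (b : N), MBSmoothOn (chart b ∘ f ∘ (chart a).symm)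
    ((chart a).target ∩ (chart a).symm ⁻¹' (U ∩ f ⁻¹' (chart b).source))

/-- `f : M → N` is smooth. -/
def SmoothMap (f : M → N) : Prop := SmoothOnOpen f univ

/-- `f` restricts to a smooth map on the subset `S`, i.e. locally on `S` it coincides with a smooth map
defined on an open subset of `M`. It is used for submanifolds `S` that are locally given by a
product decomposition (fibre products of submersions), where this is smoothness on `S`. -/
def SmoothOnSubset (f : M → N) (S : Set M) : Prop :=
  ∀ x ∈ S, ∃ (U : Set M) (g : M → N), x ∈ U ∧ SmoothOnOpen g U ∧ ∀ x' ∈ U ∩ S, f x' = g x'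

/-- The differential at `x` of a map `f` with `f x = y`. -/
def mdiff (f : M → N) (x : M) (y : N) (v : Tan x) : Tan y :=
  dirDeriv (fun z => chart y (f ((chart x).symm z))) (chart x x) v

/-- The velocity at time `t` of a curve. -/
def velocity (c : ℝ → M) (t : ℝ) : Tan (c t) :=
  dirDeriv (fun s => chart (c t) (c s)) t 1

/-- `f` is a submersion: smooth and, near every point, the projection of a product `N × F` up to a
diffeomorphism `(f, h)`, where `F` is a Hausdorff locally convex space. -/
def IsSubmersion (f : M → N) : Prop :=
  SmoothMap f ∧ ∀ x : M, ∃ (F : Type u) (_ : AddCommGroup F) (_ : Module ℝ F)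
    (_ : TopologicalSpace F) (_ : IsTopologicalAddGroup F) (_ : ContinuousSMul ℝ F)
    (_ : LocallyConvexSpace ℝ F) (_ : T2Space F) (V : Set M) (W : Set (N × F)) (h : M → F)
    (g : N × F → M), x ∈ V ∧ SmoothOnOpen h V ∧ SmoothOnOpen g W ∧
      (∀ x' ∈ V, (f x', h x') ∈ W ∧ g (f x', h x') = x') ∧
      (∀ z ∈ W, g z ∈ V ∧ (f (g z), h (g z)) = z)

/-! ### Differential forms -/

/-- The tangent vector at the point with coordinate `z` in the chart at `a` whose coordinate expression
is `v`. -/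
def chartVec (a : M) (z v : Tan a) : Tan ((chart a).symm z) :=
  dirDeriv (fun z' => chart ((chart a).symm z) ((chart a).symm z')) z v

/-- `α` is a (smooth) 1-form on `M` with values in `F`. -/
def IsForm1 {F : Type w} [AddCommGroup F] [Module ℝ F] [TopologicalSpace F]
    (α : ∀ x : M, Tan x → F) : Prop :=
  (∀ x, IsLinearMap ℝ (α x)) ∧
  ∀ a : M, MBSmoothOn (fun z : Tan a × Tan a => α ((chart a).symm z.1) (chartVec a z.1 z.2))
    ((chart a).target ×ˢ univ)

/-- `β` is a (smooth, real valued) 2-form on `M`. -/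
def IsForm2 (β : ∀ x : M, Tan x → Tan x → ℝ) : Prop :=
  (∀ x v, IsLinearMap ℝ (β x v)) ∧ (∀ x w, IsLinearMap ℝ fun v => β x v w) ∧
  (∀ x v, β x v v = 0) ∧
  ∀ a : M, MBSmoothOn (fun z : Tan a × (Tan a × Tan a) =>
    β ((chart a).symm z.1) (chartVec a z.1 z.2.1) (chartVec a z.1 z.2.2))
    ((chart a).target ×ˢ univ)

/-- The differential of a function. -/
def dFun (h : M → ℝ) (x : M) (v : Tan x) : ℝ :=
  dirDeriv (fun z => h ((chart x).symm z)) (chart x x) v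

/-- The exterior derivative of a 1-form, computed in the chart at the point in question:
`(dα)(v, w) = ∂_v (α(w)) - ∂_w (α(v))`, where `v`, `w` are extended by constants in the chart. -/
def dForm (α : ∀ x : M, Tan x → ℝ) (x : M) (v w : Tan x) : ℝ :=
  dirDeriv (fun z => α ((chart x).symm z) (chartVec x z w)) (chart x x) v
    - dirDeriv (fun z => α ((chart x).symm z) (chartVec x z v)) (chart x x) w

/-- The pull-back of a 1-form. -/
def pull1 {F : Type w} (f : M → N) (α : ∀ y : N, Tan y → F) (x : M) (v : Tan x) : F :=
  α (f x) (mdiff f x (f x) v)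

/-- The pull-back of a 2-form. -/
def pull2 (f : M → N) (β : ∀ y : N, Tan y → Tan y → ℝ) (x : M) (v w : Tan x) : ℝ :=
  β (f x) (mdiff f x (f x) v) (mdiff f x (f x) w)

end SmoothMaps

/-! ### Lie groups, actions, principal bundles -/

section LieGroups

/-- `G` is a Lie group; its Lie algebra is `Tan (1 : G)`. -/
class IsLieGroup (G : Type u) [Group G] [TopologicalSpace G] [SmoothManifold G] : Prop where
  smooth_mul : SmoothMap (fun x : G × G => x.1 * x.2)
  smooth_inv : SmoothMap (fun x : G => x⁻¹)

/-- The (left) action of `G` on `M` is smooth. -/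
class IsSmoothAction (G : Type u) [Group G] [TopologicalSpace G] [SmoothManifold G]
    (M : Type v) [TopologicalSpace M] [SmoothManifold M] [MulAction G M] : Prop where
  smooth_smul : SmoothMap (fun x : G × M => x.1 • x.2)

variable {G : Type u} [Group G] [TopologicalSpace G] [SmoothManifold G]
variable {M : Type v} [TopologicalSpace M] [SmoothManifold M] [MulAction G M]
variable {B : Type w} [TopologicalSpace B] [SmoothManifold B]

/-- The adjoint action of `g` on the Lie algebra. -/
def lieAd (g : G) (X : Tan (1 : G)) : Tan (1 : G) := mdiff (fun h : G => g * h * g⁻¹) 1 1 X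

/-- The tangent vector `X^*` at `x` generated by the infinitesimal action of `X`. -/
def infAct (X : Tan (1 : G)) (x : M) : Tan x := mdiff (fun h : G => h • x) 1 x X

/-- The 1-form `α` is invariant under the action of `G`. -/
def IsInvariant1 (G : Type u) [Group G] {M : Type v} [TopologicalSpace M] [SmoothManifold M]
    [MulAction G M] (α : ∀ x : M, Tan x → ℝ) : Prop :=
  ∀ (g : G) (x : M) (v : Tan x), pull1 (fun x : M => g • x) α x v = α x v

/-- The 2-form `β` is invariant under the action of `G`. -/
def IsInvariant2 (G : Type u) [Group G] {M : Type v} [TopologicalSpace M] [SmoothManifold M]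
    [MulAction G M] (β : ∀ x : M, Tan x → Tan x → ℝ) : Prop :=
  ∀ (g : G) (x : M) (v w : Tan x), pull2 (fun x : M => g • x) β x v w = β x v w

/-- The action of `G` on `M` is free and locally trivial, and `q : M → B` exhibits the manifold `B` as
the quotient `M / G`. In other words `q` is a (smooth) principal `G`-bundle. -/
structure IsPrincipalQuotient (G : Type u) [Group G] [TopologicalSpace G] [SmoothManifold G]
    {M : Type v} [TopologicalSpace M] [SmoothManifold M] [MulAction G M]
    {B : Type w} [TopologicalSpace B] [SmoothManifold B] (q : M → B) : Prop where
  smooth : SmoothMap q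
  surjective : Function.Surjective q
  fiber : ∀ x x' : M, q x = q x' ↔ ∃ g : G, g • x = x'
  free : ∀ (g : G) (x : M), g • x = x → g = 1
  locally_trivial : ∀ b : B, ∃ (U : Set B) (σ : B → M) (τ : M → G), b ∈ U ∧ SmoothOnOpen σ U ∧
    SmoothOnOpen τ (q ⁻¹' U) ∧ (∀ b' ∈ U, q (σ b') = b') ∧ ∀ x ∈ q ⁻¹' U, x = τ x • σ (q x)

/-- `Ξ` is a connection on the principal bundle given by the free action of `G` on `M`. -/
def IsPrincipalConnection (Ξ : ∀ x : M, Tan x → Tan (1 : G)) : Prop :=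
  IsForm1 Ξ ∧ (∀ (X : Tan (1 : G)) (x : M), Ξ x (infAct X x) = X) ∧
  ∀ (g : G) (x : M) (v : Tan x), pull1 (fun x : M => g • x) Ξ x v = lieAd g (Ξ x v)

end LieGroups

/-! ### Principal circle bundles with connection -/

/-- A principal `Circle`-bundle over the submanifold `S` of the manifold `B`. As the circle is commutative
the action is written on the left; it is smooth when it is so in the angular coordinate. -/
structure CircleBundle (B : Type u) [TopologicalSpace B] [SmoothManifold B] (S : Set B) where
  Total : Type u
  [top : TopologicalSpace Total]
  [mfd : SmoothManifold Total]
  [act : MulAction Circle Total]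
  proj : Total → B
  proj_mem : ∀ p, proj p ∈ S
  smooth_proj : SmoothMap proj
  smooth_act : SmoothMap (fun x : Total × ℝ => Circle.exp x.2 • x.1)
  proj_smul : ∀ (z : Circle) (p : Total), proj (z • p) = proj p
  free : ∀ (z : Circle) (p : Total), z • p = p → z = 1
  locally_trivial : ∀ b ∈ S, ∃ (U : Set B) (σ : B → Total) (τ : Total → Circle), IsOpen U ∧ b ∈ U ∧
    SmoothOnSubset σ (U ∩ S) ∧ SmoothOnOpen (fun p => (τ p : ℂ)) (proj ⁻¹' U) ∧
    (∀ b' ∈ U ∩ S, proj (σ b') = b') ∧ ∀ p ∈ proj ⁻¹' U, p = τ p • σ (proj p)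

attribute [instance] CircleBundle.top CircleBundle.mfd CircleBundle.act

/-- `i θ` is a connection on the principal circle bundle `P`; imaginary valued forms are throughout
represented by real valued ones, the factor `i` being omitted. -/
def IsCircleConnection {B : Type u} [TopologicalSpace B] [SmoothManifold B] {S : Set B}
    (P : CircleBundle B S) (θ : ∀ p : P.Total, Tan p → ℝ) : Prop :=
  IsForm1 θ ∧ IsInvariant1 Circle θ ∧
  ∀ p : P.Total, θ p (mdiff (fun t : ℝ => Circle.exp t • p) 0 p (1 : ℝ)) = 1

/-! ### Bundle gerbes -/

/-- The fibre product of `f` and `g`. -/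
def fibreProd {Y : Type u} {Y' : Type v} {M : Type w} (f : Y → M) (g : Y' → M) : Set (Y × Y') :=
  {x | f x.1 = g x.2}

/-- `p`, `q`, `r` lie over `(y₂, y₃)`, `(y₁, y₃)`, `(y₁, y₂)` for one and the same `(y₁, y₂, y₃)`. -/
def IsTriangle {Y : Type u} {P : Type v} (proj : P → Y × Y) (p q r : P) : Prop :=
  (proj r).2 = (proj p).1 ∧ (proj r).1 = (proj q).1 ∧ (proj p).2 = (proj q).2

/-- A bundle gerbe `(Y, P, s)` over `M`. With `δP = π₁^*P ⊗ π₂^*P^{-1} ⊗ π₃^*P`, where `πᵢ` omits the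
`i`-th factor, the fibre of `δP` at `(y₁, y₂, y₃)` consists of the elements
`z · p ⊗ q^{-1} ⊗ r` with `z` in the circle and `p`, `q`, `r` over `(y₂, y₃)`, `(y₁, y₃)`, `(y₁, y₂)`.
The section `s` is recorded by its coordinates: `s(y₁, y₂, y₃) = s(p, q, r) · p ⊗ q^{-1} ⊗ r`. -/
structure BundleGerbe (M : Type u) [TopologicalSpace M] [SmoothManifold M]
    (Y : Type u) [TopologicalSpace Y] [SmoothManifold Y] where
  π : Y → M
  surjective : Function.Surjective π
  submersion : IsSubmersion π
  P : CircleBundle (Y × Y) (fibreProd π π)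
  s : P.Total → P.Total → P.Total → Circle
  s_smooth : SmoothOnSubset
    (fun x : P.Total × P.Total × P.Total => (s x.1 x.2.1 x.2.2 : ℂ))
    {x | IsTriangle P.proj x.1 x.2.1 x.2.2}
  s_smul : ∀ (a b c : Circle) (p q r : P.Total), IsTriangle P.proj p q r →
    s (a • p) (b • q) (c • r) = a⁻¹ * b * c⁻¹ * s p q r
  /-- `δs = 1` -/
  delta_s : ∀ p₁₂ p₁₃ p₁₄ p₂₃ p₂₄ p₃₄ : P.Total,
    IsTriangle P.proj p₃₄ p₂₄ p₂₃ → IsTriangle P.proj p₃₄ p₁₄ p₁₃ →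
    IsTriangle P.proj p₂₄ p₁₄ p₁₂ → IsTriangle P.proj p₂₃ p₁₃ p₁₂ →
    s p₃₄ p₂₄ p₂₃ * (s p₃₄ p₁₄ p₁₃)⁻¹ * s p₂₄ p₁₄ p₁₂ * (s p₂₃ p₁₃ p₁₂)⁻¹ = 1

section Gerbes

variable {M : Type u} [TopologicalSpace M] [SmoothManifold M]
variable {Y : Type u} [TopologicalSpace Y] [SmoothManifold Y]

/-- The map `P → Y^{[2]} → Y` given by the first coordinate of the base point. -/
def BundleGerbe.y₁ (𝒢 : BundleGerbe M Y) (p : 𝒢.P.Total) : Y := (𝒢.P.proj p).1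

/-- The map `P → Y^{[2]} → Y` given by the second coordinate of the base point. -/
def BundleGerbe.y₂ (𝒢 : BundleGerbe M Y) (p : 𝒢.P.Total) : Y := (𝒢.P.proj p).2

/-- The pull-back to `P` of the form `δκ = π₁^*κ - π₂^*κ` on `Y^{[2]}`, for a 1-form `κ` on `Y`. -/
def BundleGerbe.delta1 (𝒢 : BundleGerbe M Y) (κ : ∀ y : Y, Tan y → ℝ)
    (p : 𝒢.P.Total) (v : Tan p) : ℝ :=
  pull1 𝒢.y₂ κ p v - pull1 𝒢.y₁ κ p v

/-- The pull-back to `P` of the form `δf = π₁^*f - π₂^*f` on `Y^{[2]}`, for a 2-form `f` on `Y`. -/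
def BundleGerbe.delta2 (𝒢 : BundleGerbe M Y) (f : ∀ y : Y, Tan y → Tan y → ℝ)
    (p : 𝒢.P.Total) (v w : Tan p) : ℝ :=
  pull2 𝒢.y₂ f p v w - pull2 𝒢.y₁ f p v w

/-- `i ∇` is a connection on the bundle gerbe: a connection on `P` with `s^*(δ∇) = 0`. The latter is
expressed along smooth curves `(p, q, r)` in the fibre product:
`d log s(p, q, r) + i (∇(p') - ∇(q') + ∇(r')) = 0`. -/
def BundleGerbe.IsConnection (𝒢 : BundleGerbe M Y) (nab : ∀ p : 𝒢.P.Total, Tan p → ℝ) : Prop :=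
  IsCircleConnection 𝒢.P nab ∧
  ∀ p q r : ℝ → 𝒢.P.Total, SmoothMap p → SmoothMap q → SmoothMap r →
    (∀ t, IsTriangle 𝒢.P.proj (p t) (q t) (r t)) → ∀ t,
    HasDerivAt (fun t => (𝒢.s (p t) (q t) (r t) : ℂ))
      (-Complex.I * ((nab (p t) (velocity p t) - nab (q t) (velocity q t)
        + nab (r t) (velocity r t) : ℝ) : ℂ) * (𝒢.s (p t) (q t) (r t) : ℂ)) t

/-- `i f` is a curving for the connection `i ∇`: a 2-form on `Y` with `δf = F(∇)`, where the
curvature `F(∇)` is the form on `Y^{[2]}` that pulls back to `d∇`. -/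
def BundleGerbe.IsCurving (𝒢 : BundleGerbe M Y) (nab : ∀ p : 𝒢.P.Total, Tan p → ℝ)
    (f : ∀ y : Y, Tan y → Tan y → ℝ) : Prop :=
  IsForm2 f ∧ ∀ (p : 𝒢.P.Total) (v w : Tan p), 𝒢.delta2 f p v w = dForm nab p v w

end Gerbes

/-- A strongly `G`-equivariant bundle gerbe over the `G`-manifold `M`, where `Y` is a `G`-manifold. -/
structure EquivariantGerbe (G : Type u) [Group G] [TopologicalSpace G] [SmoothManifold G]
    (M : Type u) [TopologicalSpace M] [SmoothManifold M] [MulAction G M]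
    (Y : Type u) [TopologicalSpace Y] [SmoothManifold Y] [MulAction G Y]
    extends BundleGerbe M Y where
  smooth_smul_Y : IsSmoothAction G Y
  π_smul : ∀ (g : G) (y : Y), π (g • y) = g • π y
  actP : MulAction G P.Total
  smooth_smul_P : IsSmoothAction G P.Total
  proj_smul : ∀ (g : G) (p : P.Total), P.proj (g • p) = (g • (P.proj p).1, g • (P.proj p).2)
  smul_circle_smul : ∀ (g : G) (z : Circle) (p : P.Total), g • (z • p) = z • (g • p)
  s_invariant : ∀ (g : G) (p q r : P.Total), IsTriangle P.proj p q r →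
    s (g • p) (g • q) (g • r) = s p q r

attribute [instance] EquivariantGerbe.actP

section EquivariantGerbes

variable {G : Type u} [Group G] [TopologicalSpace G] [SmoothManifold G]
variable {M : Type u} [TopologicalSpace M] [SmoothManifold M] [MulAction G M]
variable {Y : Type u} [TopologicalSpace Y] [SmoothManifold Y] [MulAction G Y]
variable {Y' : Type u} [TopologicalSpace Y'] [SmoothManifold Y'] [MulAction G Y']
variable {Mbar : Type u} [TopologicalSpace Mbar] [SmoothManifold Mbar]
variable {Ybar : Type u} [TopologicalSpace Ybar] [SmoothManifold Ybar]

/-- `∇` and `f` are a `G`-invariant connection and a `G`-invariant curving for it. -/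
structure EquivariantGerbe.IsConnectionCurving (𝒢 : EquivariantGerbe G M Y)
    (nab : ∀ p : 𝒢.P.Total, Tan p → ℝ) (f : ∀ y : Y, Tan y → Tan y → ℝ) : Prop where
  connection : 𝒢.IsConnection nab
  connection_invariant : IsInvariant1 G nab
  curving : 𝒢.IsCurving nab f
  curving_invariant : IsInvariant2 G f

/-- `p` and `p'` lie over `(y₁, y₂)` and `(y₁', y₂')`, while `r₁`, `r₂` lie over `(y₁, y₁')` and
`(y₂, y₂')`. -/
def LiesOverSquare {P P' R : Type*} (proj : P → Y × Y) (proj' : P' → Y' × Y') (projR : R → Y × Y')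
    (r₂ r₁ : R) (p : P) (p' : P') : Prop :=
  projR r₂ = ((proj p).2, (proj' p').2) ∧ projR r₁ = ((proj p).1, (proj' p').1)

/-- A stable isomorphism from `(𝒢, ∇, f)` to `(𝒢', ∇', f')`: a `G`-equivariant pseudo circle bundle with
invariant connection `((R, v), η)` for `(𝒢, ∇, f)^{-1} ⊗ (𝒢', ∇', f')` such that `F(η) = f' - f`.
So `R` is an equivariant principal circle bundle over `Y ×_M Y'`, and `v` is an invariant section of
`δR^{-1} ⊗ P^{-1} ⊗ P'` over `(Y ×_M Y')^{[2]}` with `δv = s^{-1} ⊗ s'`, recorded by its coordinates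
`v = v(r₂, r₁, p, p') · r₂^{-1} ⊗ r₁ ⊗ p^{-1} ⊗ p'`. -/
structure StableIso (𝒢 : EquivariantGerbe G M Y) (nab : ∀ p : 𝒢.P.Total, Tan p → ℝ)
    (f : ∀ y : Y, Tan y → Tan y → ℝ)
    (𝒢' : EquivariantGerbe G M Y') (nab' : ∀ p : 𝒢'.P.Total, Tan p → ℝ)
    (f' : ∀ y : Y', Tan y → Tan y → ℝ) where
  R : CircleBundle (Y × Y') (fibreProd 𝒢.π 𝒢'.π)
  actR : MulAction G R.Total
  smooth_smul_R : IsSmoothAction G R.Total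
  proj_smul : ∀ (g : G) (r : R.Total), R.proj (g • r) = (g • (R.proj r).1, g • (R.proj r).2)
  smul_circle_smul : ∀ (g : G) (z : Circle) (r : R.Total), g • (z • r) = z • (g • r)
  v : R.Total → R.Total → 𝒢.P.Total → 𝒢'.P.Total → Circle
  v_smooth : SmoothOnSubset
    (fun x : R.Total × R.Total × 𝒢.P.Total × 𝒢'.P.Total => (v x.1 x.2.1 x.2.2.1 x.2.2.2 : ℂ))
    {x | LiesOverSquare 𝒢.P.proj 𝒢'.P.proj R.proj x.1 x.2.1 x.2.2.1 x.2.2.2}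
  v_smul : ∀ (a b c d : Circle) (r₂ r₁ : R.Total) (p : 𝒢.P.Total) (p' : 𝒢'.P.Total),
    LiesOverSquare 𝒢.P.proj 𝒢'.P.proj R.proj r₂ r₁ p p' →
    v (a • r₂) (b • r₁) (c • p) (d • p') = a * b⁻¹ * c * d⁻¹ * v r₂ r₁ p p'
  v_invariant : ∀ (g : G) (r₂ r₁ : R.Total) (p : 𝒢.P.Total) (p' : 𝒢'.P.Total),
    LiesOverSquare 𝒢.P.proj 𝒢'.P.proj R.proj r₂ r₁ p p' →
    v (g • r₂) (g • r₁) (g • p) (g • p') = v r₂ r₁ p p'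
  /-- `δv = s^{-1} ⊗ s'` -/
  delta_v : ∀ (r₁ r₂ r₃ : R.Total) (p₁₂ p₁₃ p₂₃ : 𝒢.P.Total) (p₁₂' p₁₃' p₂₃' : 𝒢'.P.Total),
    LiesOverSquare 𝒢.P.proj 𝒢'.P.proj R.proj r₂ r₁ p₁₂ p₁₂' →
    LiesOverSquare 𝒢.P.proj 𝒢'.P.proj R.proj r₃ r₁ p₁₃ p₁₃' →
    LiesOverSquare 𝒢.P.proj 𝒢'.P.proj R.proj r₃ r₂ p₂₃ p₂₃' →
    v r₃ r₂ p₂₃ p₂₃' * (v r₃ r₁ p₁₃ p₁₃')⁻¹ * v r₂ r₁ p₁₂ p₁₂'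
      = (𝒢.s p₂₃ p₁₃ p₁₂)⁻¹ * 𝒢'.s p₂₃' p₁₃' p₁₂'
  η : ∀ r : R.Total, Tan r → ℝ
  η_connection : IsCircleConnection R η
  η_invariant : IsInvariant1 G η
  /-- `v^*(δη^{-1} ⊗ ∇^{-1} ⊗ ∇') = 0`, along smooth curves -/
  v_flat : ∀ (r₂ r₁ : ℝ → R.Total) (p : ℝ → 𝒢.P.Total) (p' : ℝ → 𝒢'.P.Total),
    SmoothMap r₂ → SmoothMap r₁ → SmoothMap p → SmoothMap p' →
    (∀ t, LiesOverSquare 𝒢.P.proj 𝒢'.P.proj R.proj (r₂ t) (r₁ t) (p t) (p' t)) → ∀ t,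
    HasDerivAt (fun t => (v (r₂ t) (r₁ t) (p t) (p' t) : ℂ))
      (-Complex.I * ((-η (r₂ t) (velocity r₂ t) + η (r₁ t) (velocity r₁ t)
        - nab (p t) (velocity p t) + nab' (p' t) (velocity p' t) : ℝ) : ℂ)
        * (v (r₂ t) (r₁ t) (p t) (p' t) : ℂ)) t
  /-- `F(η) = f' - f` -/
  curvature : ∀ (r : R.Total) (x w : Tan r), dForm η r x w =
    pull2 (fun r => (R.proj r).2) f' r x w - pull2 (fun r => (R.proj r).1) f r x w

/-- `ρ : P → P̄` exhibits the bundle gerbe `(Ȳ, P̄, s̄)` over `M̄` as the quotient `(Y/G, P/G, s̄)` of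
`(Y, P, s)`, where `q : M → M̄` and `qY : Y → Ȳ` are the quotient maps of `M` and `Y`. -/
structure IsQuotientGerbe (𝒢 : EquivariantGerbe G M Y) (q : M → Mbar) (qY : Y → Ybar)
    (𝒢bar : BundleGerbe Mbar Ybar) (ρ : 𝒢.P.Total → 𝒢bar.P.Total) : Prop where
  π_comm : ∀ y, 𝒢bar.π (qY y) = q (𝒢.π y)
  submersion : IsSubmersion ρ
  surjective : Function.Surjective ρ
  fiber : ∀ p p' : 𝒢.P.Total, ρ p = ρ p' ↔ ∃ g : G, g • p = p'
  circle_smul : ∀ (z : Circle) (p : 𝒢.P.Total), ρ (z • p) = z • ρ p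
  proj_comm : ∀ p, 𝒢bar.P.proj (ρ p) = (qY (𝒢.P.proj p).1, qY (𝒢.P.proj p).2)
  s_comm : ∀ p q r : 𝒢.P.Total, IsTriangle 𝒢.P.proj p q r →
    𝒢bar.s (ρ p) (ρ q) (ρ r) = 𝒢.s p q r

/-- `prY : Y' → Ȳ` and `prP : P' → P̄` exhibit the strongly equivariant bundle gerbe `𝒢' = (Y', P', s')`
over `M` as the pull-back under `q : M → M̄` of the bundle gerbe `𝒢̄ = (Ȳ, P̄, s̄)` over `M̄`: via
`(π', prY)` the manifold `Y'` is the fibre product `M ×_{M̄} Ȳ`, further `P'` and `s'` are pulled back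
along `prY`, and `G` acts through its action on `M`. -/
structure IsPullbackGerbe (q : M → Mbar) (𝒢bar : BundleGerbe Mbar Ybar)
    (𝒢' : EquivariantGerbe G M Y') (prY : Y' → Ybar) (prP : 𝒢'.P.Total → 𝒢bar.P.Total) :
    Prop where
  smooth_prY : SmoothMap prY
  comm : ∀ y, q (𝒢'.π y) = 𝒢bar.π (prY y)
  isFibreProd : ∃ inv : M × Ybar → Y', SmoothOnSubset inv (fibreProd q 𝒢bar.π) ∧
    (∀ y, inv (𝒢'.π y, prY y) = y) ∧
    ∀ x ∈ fibreProd q 𝒢bar.π, (𝒢'.π (inv x), prY (inv x)) = x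
  smooth_prP : SmoothMap prP
  circle_smul : ∀ (z : Circle) (p : 𝒢'.P.Total), prP (z • p) = z • prP p
  proj_comm : ∀ p, 𝒢bar.P.proj (prP p) = (prY (𝒢'.P.proj p).1, prY (𝒢'.P.proj p).2)
  s_comm : ∀ p q r : 𝒢'.P.Total, IsTriangle 𝒢'.P.proj p q r →
    𝒢bar.s (prP p) (prP q) (prP r) = 𝒢'.s p q r
  prY_smul : ∀ (g : G) (y : Y'), prY (g • y) = prY y
  prP_smul : ∀ (g : G) (p : 𝒢'.P.Total), prP (g • p) = prP p

/-- `λ : Y → Hom(𝔤, iℝ)` (the factor `i` being omitted) is smooth, `δλ` is the moment of `(P, ∇)`, and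
`(E, ζ) = 0`, where `E` and `ζ` are given by
`2πi ⟨X | π^*E⟩ = ⟨X | dλ⟩ + ι_{X^*} f` and `2πi ⟨X | π^*ζ(g)⟩ = ⟨X | g^*λ - Ad_g λ⟩`. -/
structure IsReductionMap (𝒢 : EquivariantGerbe G M Y) (nab : ∀ p : 𝒢.P.Total, Tan p → ℝ)
    (f : ∀ y : Y, Tan y → Tan y → ℝ) (lam : Y → Tan (1 : G) →L[ℝ] ℝ) : Prop where
  smooth : SmoothMap (fun x : Y × Tan (1 : G) => lam x.1 x.2)
  delta_lam : ∀ (p : 𝒢.P.Total) (X : Tan (1 : G)),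
    lam (𝒢.y₂ p) X - lam (𝒢.y₁ p) X = nab p (infAct X p)
  E_eq_zero : ∀ (X : Tan (1 : G)) (y : Y) (w : Tan y),
    dFun (fun y => lam y X) y w + f y (infAct X y) w = 0
  zeta_eq_zero : ∀ (g : G) (X : Tan (1 : G)) (y : Y),
    lam (g • y) X - lam y (lieAd g⁻¹ X) = 0

/-- The 1-form `κ = ⟨π^*Ξ | λ⟩` on `Y`. -/
def kappa (𝒢 : EquivariantGerbe G M Y) (Ξ : ∀ x : M, Tan x → Tan (1 : G))
    (lam : Y → Tan (1 : G) →L[ℝ] ℝ) (y : Y) (w : Tan y) : ℝ :=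
  lam y (pull1 𝒢.π Ξ y w)

end EquivariantGerbes

end

noncomputable section

set_option linter.unusedSectionVars false

open SmoothManifold (Tan chart)

/-! ### Differential calculus in locally convex spaces -/

section DirDeriv

variable {E : Type u} [AddCommGroup E] [Module ℝ E] [TopologicalSpace E]
variable {F : Type v} [AddCommGroup F] [Module ℝ F] [TopologicalSpace F]

/-! Everything turns on `κ = ⟨π^*Ξ | λ⟩`. Since `Ξ(X^*) = X`, it satisfies `κ(X^*) = ⟨X | λ⟩`, and
`ζ = 0` makes it `G`-invariant. Hence `∇ - δκ` kills `X^*`, because `δλ` is the moment of `∇`.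
Cartan's formula for the invariant form `κ` (`IsForm1.dForm_infAct`) gives `ι_{X^*} dκ = -d⟨X | λ⟩`,
and this is `ι_{X^*} f` because `E = 0`; so `f - dκ` kills `X^*` as well. Both forms are thus basic
(`isBasic1_sub_kappa`, `isBasic2_sub_kappa`), and basic forms descend along a principal bundle
(`exists_descend1`, `exists_descend2`): two local sections differ by a `G`-valued function, whose
derivative contributes orbit directions only. The terms of `δκ` cancel around triangles and `d(δκ) =
δ(dκ)`, so the conditions on a connection and a curving survive the passage to the quotient.

The quotient gerbe exists because `G` acts freely on `M`. A point of `Y` is determined by its images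
in `M` and `Y/G` (`eq_of_π_eq`), so a pair in `Y/G` over one point of `M/G` lifts to `Y^{[2]}`,
uniquely up to a simultaneous translation. In this way `Y^{[2]}/G` becomes `(Y/G)^{[2]}`, triangles
in `P/G` lift to triangles in `P` (`exists_triangle_lift`), and the invariant `s` descends. Charts
of `P/G` come from slices: an orbit is normalised by placing its first footpoint on a local section
of `qY` (`nonempty_quotientChart`).

For the same reason `Y` is `M ×_{M/G} Y/G`, so `𝒢` is itself a pull-back of its quotient, only with
another connection and curving. Every pull-back is isomorphic to it (`exists_iso`), and the change
by `κ` is absorbed into the stable isomorphism (`nonempty_stableIso`): `R` is `P`, `v` is the gerbe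
product around a square, and `η = ∇ + y₁^*κ` has curvature `y₂^*f - y₁^*(f - dκ)`.

Underneath lies Michal–Bastiani calculus. Hahn–Banach yields a mean value theorem, and with it the
difference quotient of a `C^1` map extends continuously to `t = 0` (`tendsto_differenceQuotient`).
Linearity of the differential, the chain rule and the symmetry of second derivatives follow, and the
last gives the naturality of `d` (`IsForm1.dForm_mdiff`). -/

theorem HasDirDeriv.unique [T2Space F] {f : E → F} {x v : E} {w w' : F} (h : HasDirDeriv f x v w)
    (h' : HasDirDeriv f x v w') : w = w' :=
  tendsto_nhds_unique h h'

theorem HasDirDeriv.dirDeriv_eq [T2Space F] {f : E → F} {x v : E} {w : F}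
    (h : HasDirDeriv f x v w) : dirDeriv f x v = w :=
  h.limUnder_eq

theorem tendsto_add_smul_nhds [IsTopologicalAddGroup E] [ContinuousSMul ℝ E] (x v : E) :
    Tendsto (fun t : ℝ => x + t • v) (𝓝[≠] 0) (𝓝 x) := by
  have : Continuous fun t : ℝ => x + t • v := by fun_prop
  have h := this.tendsto 0
  simp only [zero_smul, add_zero] at h
  exact h.mono_left nhdsWithin_le_nhds

theorem HasDirDeriv.congr_of_eventuallyEq [IsTopologicalAddGroup E] [ContinuousSMul ℝ E]
    {f g : E → F} {x v : E} {w : F} (h : HasDirDeriv f x v w) (hfg : f =ᶠ[𝓝 x] g) :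
    HasDirDeriv g x v w := by
  refine Tendsto.congr' ?_ h
  filter_upwards [(tendsto_add_smul_nhds x v).eventually hfg] with t ht
  rw [ht, hfg.eq_of_nhds]

/-- Both sides are `lim` of one and the same filter of difference quotients, so no differentiability
is needed. -/
theorem dirDeriv_congr [IsTopologicalAddGroup E] [ContinuousSMul ℝ E] {f g : E → F} {x : E} (v : E)
    (hfg : f =ᶠ[𝓝 x] g) : dirDeriv f x v = dirDeriv g x v := by
  unfold dirDeriv limUnder
  congr 1
  refine Filter.map_congr ?_
  filter_upwards [(tendsto_add_smul_nhds x v).eventually hfg] with t ht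
  rw [ht, hfg.eq_of_nhds]

theorem HasDirDeriv.smul_dir [ContinuousSMul ℝ F] {f : E → F} {x v : E} {w : F}
    (h : HasDirDeriv f x v w) (r : ℝ) : HasDirDeriv f x (r • v) (r • w) := by
  by_cases hr : r = 0
  · subst hr
    simp only [HasDirDeriv, smul_zero, add_zero, sub_self, zero_smul]
    exact tendsto_const_nhds
  · have h1 : Tendsto (fun t : ℝ => t * r) (𝓝[≠] 0) (𝓝[≠] 0) := by
      refine tendsto_nhdsWithin_iff.2 ⟨?_, ?_⟩
      · have : Continuous fun t : ℝ => t * r := by fun_prop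
        have h := this.tendsto 0
        simp only [zero_mul] at h
        exact h.mono_left nhdsWithin_le_nhds
      · filter_upwards [self_mem_nhdsWithin] with t ht
        exact mul_ne_zero ht hr
    refine ((h.comp h1).const_smul r).congr' ?_
    filter_upwards [self_mem_nhdsWithin] with t ht
    have ht : t ≠ 0 := ht
    simp only [Function.comp, smul_smul, mul_inv]
    congr 1
    field_simp

theorem HasDirDeriv.line {f : E → F} {x v : E} {w : F} {s : ℝ}
    (h : HasDirDeriv f (x + s • v) v w) : HasDirDeriv (fun t : ℝ => f (x + t • v)) s 1 w := by
  refine Tendsto.congr (fun t => ?_) h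
  simp [add_smul, add_assoc]

theorem hasDirDeriv_line_zero_iff {f : E → F} {x v : E} {w : F} :
    HasDirDeriv (fun t : ℝ => f (x + t • v)) 0 1 w ↔ HasDirDeriv f x v w := by
  simp [HasDirDeriv]

theorem HasDirDeriv.clm_comp {f : E → F} {x v : E} {w : F} (h : HasDirDeriv f x v w)
    {F' : Type w} [AddCommGroup F'] [Module ℝ F'] [TopologicalSpace F'] (L : F →L[ℝ] F') :
    HasDirDeriv (fun x => L (f x)) x v (L w) := by
  refine Tendsto.congr (fun t => ?_) ((L.continuous.tendsto w).comp h)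
  simp

theorem hasDirDeriv_iff_hasDerivAt {F : Type v} [NormedAddCommGroup F] [NormedSpace ℝ F]
    {f : ℝ → F} {t : ℝ} {w : F} : HasDirDeriv f t 1 w ↔ HasDerivAt f w t := by
  rw [hasDerivAt_iff_tendsto_slope_zero]
  simp [HasDirDeriv]

/-- The mean value theorem in a locally convex space. -/
theorem sub_mem_closure_of_hasDirDeriv [IsTopologicalAddGroup F] [ContinuousSMul ℝ F]
    [LocallyConvexSpace ℝ F] {c c' : ℝ → F} {C : Set F} (hC : Convex ℝ C)
    (hc : ∀ s ∈ Icc (0 : ℝ) 1, HasDirDeriv c s 1 (c' s)) (hc' : ∀ s ∈ Icc (0 : ℝ) 1, c' s ∈ C) :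
    c 1 - c 0 ∈ closure C := by
  by_contra hmem
  -- Hahn–Banach: a functional separating `c 1 - c 0` strictly from the closure contradicts the
  -- scalar mean value theorem for `ℓ ∘ c`, as `c'` stays in `C`.
  obtain ⟨ℓ, m, h1, h2⟩ := geometric_hahn_banach_closed_point hC.closure isClosed_closure hmem
  have hd : ∀ s ∈ Icc (0 : ℝ) 1, HasDerivAt (fun s => ℓ (c s)) (ℓ (c' s)) s := fun s hs =>
    hasDirDeriv_iff_hasDerivAt.1 ((hc s hs).clm_comp ℓ)
  obtain ⟨s, hs, hs'⟩ := exists_hasDerivAt_eq_slope (fun s => ℓ (c s)) (fun s => ℓ (c' s)) zero_lt_one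
    (fun s hs => (hd s hs).continuousAt.continuousWithinAt) (fun s hs => hd s (Ioo_subset_Icc_self hs))
  have := h1 _ (subset_closure (hc' s (Ioo_subset_Icc_self hs)))
  simp only [sub_zero, div_one] at hs'
  rw [hs', ← map_sub] at this
  exact lt_irrefl _ (this.trans h2)

/-- The mean value theorem lands only in the closure of a convex set, which must therefore still fit
into `N`; topological groups are regular. -/
theorem exists_convex_closure_subset [IsTopologicalAddGroup F] [LocallyConvexSpace ℝ F] {y : F}
    {N : Set F} (hN : N ∈ 𝓝 y) : ∃ C ∈ 𝓝 y, Convex ℝ C ∧ closure C ⊆ N := by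
  obtain ⟨N', ⟨hN', hcl⟩, hsub⟩ := (closed_nhds_basis y).mem_iff.1 hN
  obtain ⟨C, ⟨hC, hconv⟩, hCs⟩ := (LocallyConvexSpace.convex_basis (𝕜 := ℝ) y).mem_iff.1 hN'
  exact ⟨C, hC, hconv, (closure_minimal hCs hcl).trans hsub⟩

end DirDeriv

/-! ### Difference quotients, linearity of the differential, the chain rule -/

section DifferenceQuotient

variable {E : Type u} [AddCommGroup E] [Module ℝ E] [TopologicalSpace E]
  [IsTopologicalAddGroup E] [ContinuousSMul ℝ E]
variable {F : Type v} [AddCommGroup F] [Module ℝ F] [TopologicalSpace F]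
  [IsTopologicalAddGroup F] [ContinuousSMul ℝ F] [LocallyConvexSpace ℝ F]

/-- The mean value theorem for `s ↦ t⁻¹ • f (y + s t w)` on `[0, 1]`, whose derivative `df (y + s t
w, w)` no longer contains `t⁻¹`. The range `|r| ≤ |t|` covers both signs of `t`. -/
theorem differenceQuotient_mem_closure {f : E → F} {df : E × E → F} {y w : E} {t : ℝ} (ht : t ≠ 0)
    {C : Set F} (hC : Convex ℝ C)
    (hf : ∀ r : ℝ, |r| ≤ |t| → HasDirDeriv f (y + r • w) w (df (y + r • w, w)))
    (hdf : ∀ r : ℝ, |r| ≤ |t| → df (y + r • w, w) ∈ C) :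
    t⁻¹ • (f (y + t • w) - f y) ∈ closure C := by
  have key := sub_mem_closure_of_hasDirDeriv (c := fun s : ℝ => t⁻¹ • f (y + s • t • w))
    (c' := fun s => df (y + (s * t) • w, w)) hC ?_ ?_
  · simpa [smul_sub] using key
  · intro s hs
    have hst : |s * t| ≤ |t| := by
      rw [abs_mul, abs_of_nonneg hs.1]
      exact mul_le_of_le_one_left (abs_nonneg t) hs.2
    have h1 := (hf _ hst).smul_dir t
    rw [mul_smul] at h1
    have h2 := h1.line.clm_comp (t⁻¹ • ContinuousLinearMap.id ℝ F)
    simpa [smul_smul, mul_inv_cancel₀ ht, inv_mul_cancel₀ ht] using h2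
  · intro s hs
    refine hdf _ ?_
    rw [abs_mul, abs_of_nonneg hs.1]
    exact mul_le_of_le_one_left (abs_nonneg t) hs.2

/-- The difference quotient of a `C^1` map extends continuously to `t = 0`. -/
theorem tendsto_differenceQuotient {f : E → F} {df : E × E → F} {U : Set E} (hU : IsOpen U)
    (hf : ∀ x ∈ U, ∀ v, HasDirDeriv f x v (df (x, v))) (hdf : ContinuousOn df (U ×ˢ univ))
    {x : E} (hx : x ∈ U) (v : E) :
    Tendsto (fun p : E × E × ℝ => p.2.2⁻¹ • (f (p.1 + p.2.2 • p.2.1) - f p.1))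
      (𝓝 x ×ˢ 𝓝 v ×ˢ 𝓝[≠] 0) (𝓝 (df (x, v))) := by
  intro N hN
  obtain ⟨C, hC, hconv, hCN⟩ := exists_convex_closure_subset hN
  have hopen : IsOpen (U ×ˢ (univ : Set E)) := hU.prod isOpen_univ
  have hA : {p : E × E | p.1 ∈ U ∧ df p ∈ C} ∈ 𝓝 (x, v) := by
    have h1 := (hdf.continuousAt (hopen.mem_nhds ⟨hx, mem_univ v⟩)) hC
    filter_upwards [h1, hopen.mem_nhds (show (x, v) ∈ U ×ˢ univ from ⟨hx, mem_univ v⟩)] with p hp hp'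
    exact ⟨hp'.1, hp⟩
  -- Continuity of `(y, w, t) ↦ (y + t w, w)` at `t = 0` gives one neighbourhood for all three
  -- variables; its `t`-part is shrunk to a ball so that it contains every `r` with `|r| ≤ |t|`.
  have hcont : Continuous fun p : E × E × ℝ => (p.1 + p.2.2 • p.2.1, p.2.1) := by fun_prop
  have h2 := hcont.tendsto (x, v, 0)
  simp only [zero_smul, add_zero] at h2
  have h3 := h2 hA
  rw [nhds_prod_eq, nhds_prod_eq] at h3
  obtain ⟨A, hA, B, hB, hAB⟩ := Filter.mem_prod_iff.1 (Filter.mem_map.1 h3)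
  obtain ⟨B₁, hB₁, B₂, hB₂, hB'⟩ := Filter.mem_prod_iff.1 hB
  obtain ⟨ε, hε, hεB⟩ := Metric.mem_nhds_iff.1 hB₂
  have hball : Metric.ball (0 : ℝ) ε ∩ {0}ᶜ ∈ 𝓝[≠] (0 : ℝ) :=
    inter_mem (mem_nhdsWithin_of_mem_nhds (Metric.ball_mem_nhds _ hε)) self_mem_nhdsWithin
  rw [Filter.mem_map]
  refine Filter.mem_of_superset (prod_mem_prod hA (prod_mem_prod hB₁ hball)) ?_
  rintro ⟨y, w, t⟩ ⟨hy, hw, ht, ht0⟩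
  have hin : ∀ r : ℝ, |r| ≤ |t| → y + r • w ∈ U ∧ df (y + r • w, w) ∈ C := by
    intro r hr
    refine hAB (show (y, w, r) ∈ A ×ˢ B from ⟨hy, hB' ⟨hw, hεB ?_⟩⟩)
    simp only [Metric.mem_ball, Real.dist_eq, sub_zero] at ht ⊢
    exact hr.trans_lt ht
  exact hCN (differenceQuotient_mem_closure ht0 hconv (fun r hr => hf _ (hin r hr).1 w)
    fun r hr => (hin r hr).2)

/-- Base point and direction may both move with `t`: the first is needed for additivity of the
differential, the second for the chain rule. -/
theorem tendsto_differenceQuotient_comp {f : E → F} {df : E × E → F} {U : Set E} (hU : IsOpen U)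
    (hf : ∀ x ∈ U, ∀ v, HasDirDeriv f x v (df (x, v))) (hdf : ContinuousOn df (U ×ˢ univ))
    {x : E} (hx : x ∈ U) {v : E} {a b : ℝ → E} (ha : Tendsto a (𝓝[≠] 0) (𝓝 x))
    (hb : Tendsto b (𝓝[≠] 0) (𝓝 v)) :
    Tendsto (fun t : ℝ => t⁻¹ • (f (a t + t • b t) - f (a t))) (𝓝[≠] 0) (𝓝 (df (x, v))) :=
  (tendsto_differenceQuotient hU hf hdf hx v).comp (ha.prodMk (hb.prodMk tendsto_id))

/-- For additivity pass from `x` to `x + t v` and on to `x + t v + t w`; the second difference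
quotient has the moving base point `x + t v`, which does not change its limit. -/
theorem isLinearMap_of_hasDirDeriv [T2Space F] {f : E → F} {df : E × E → F} {U : Set E}
    (hU : IsOpen U) (hf : ∀ x ∈ U, ∀ v, HasDirDeriv f x v (df (x, v)))
    (hdf : ContinuousOn df (U ×ˢ univ)) {x : E} (hx : x ∈ U) :
    IsLinearMap ℝ fun v => df (x, v) where
  map_smul r v := (hf x hx (r • v)).unique ((hf x hx v).smul_dir r)
  map_add v w := by
    refine (hf x hx (v + w)).unique ?_
    have h1 := tendsto_differenceQuotient_comp hU hf hdf hx (tendsto_add_smul_nhds x v)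
      (tendsto_const_nhds (x := w))
    refine Tendsto.congr (fun t => ?_) ((hf x hx v).add h1)
    rw [← smul_add, smul_add t, ← add_assoc]
    congr 1
    abel

/-- `g (z + t v)` is the fixed base point `g z` displaced by `t` times the difference quotient of
`g`, which tends to `w`. -/
theorem HasDirDeriv.comp {E' : Type w} [AddCommGroup E'] [Module ℝ E'] [TopologicalSpace E']
    [IsTopologicalAddGroup E'] [ContinuousSMul ℝ E']
    {g : E' → E} {z v : E'} {w : E} (hg : HasDirDeriv g z v w)
    {f : E → F} {df : E × E → F} {U : Set E} (hU : IsOpen U)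
    (hf : ∀ x ∈ U, ∀ v, HasDirDeriv f x v (df (x, v))) (hdf : ContinuousOn df (U ×ˢ univ))
    (hx : g z ∈ U) : HasDirDeriv (f ∘ g) z v (df (g z, w)) := by
  refine (tendsto_differenceQuotient_comp hU hf hdf hx tendsto_const_nhds hg).congr' ?_
  filter_upwards [self_mem_nhdsWithin] with t ht
  have ht : t ≠ 0 := ht
  simp [smul_smul, mul_inv_cancel₀ ht]

end DifferenceQuotient

/-! ### Maps of class `C^n` -/

section MBDiffOn

variable {E : Type u} [AddCommGroup E] [Module ℝ E] [TopologicalSpace E]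
variable {F : Type v} [AddCommGroup F] [Module ℝ F] [TopologicalSpace F]

theorem MBDiffOn.of_succ {n : ℕ} {f : E → F} {U : Set E} (h : MBDiffOn (n + 1) f U) :
    MBDiffOn n f U := by
  induction n generalizing E with
  | zero => exact h.1
  | succ n ih =>
    obtain ⟨hc, df, hd, hdf⟩ := h
    exact ⟨hc, df, hd, ih hdf⟩

variable [IsTopologicalAddGroup E] [ContinuousSMul ℝ E]

theorem MBDiffOn.congrOn {n : ℕ} {f g : E → F} {U : Set E} (h : MBDiffOn n f U) (hU : IsOpen U)
    (hfg : EqOn f g U) : MBDiffOn n g U := by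
  cases n with
  | zero => exact ContinuousOn.congr h fun x hx => (hfg hx).symm
  | succ n =>
    obtain ⟨hc, df, hd, hdf⟩ := h
    refine ⟨hc.congr fun x hx => (hfg hx).symm, df, fun x hx v => ?_, hdf⟩
    exact (hd x hx v).congr_of_eventuallyEq (hfg.eventuallyEq_of_mem (hU.mem_nhds hx))

/-- The definition asks for some derivative. In a Hausdorff target it is unique, so the canonical
`dirDeriv` serves on all open sets at once; this is what permits gluing in `MBDiffOn.of_locally`. -/
theorem MBDiffOn.succ_iff [T2Space F] {n : ℕ} {f : E → F} {U : Set E} (hU : IsOpen U) :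
    MBDiffOn (n + 1) f U ↔ ContinuousOn f U ∧
      (∀ x ∈ U, ∀ v, HasDirDeriv f x v (dirDeriv f x v)) ∧
      MBDiffOn n (fun p : E × E => dirDeriv f p.1 p.2) (U ×ˢ univ) := by
  constructor
  · rintro ⟨hc, df, hd, hdf⟩
    refine ⟨hc, fun x hx v => ?_, hdf.congrOn (hU.prod isOpen_univ) ?_⟩
    · rw [(hd x hx v).dirDeriv_eq]
      exact hd x hx v
    · rintro ⟨x, v⟩ ⟨hx, -⟩
      exact (hd x hx v).dirDeriv_eq.symm
  · rintro ⟨hc, hd, hdf⟩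
    exact ⟨hc, _, hd, hdf⟩

theorem MBDiffOn.of_locally [T2Space F] {n : ℕ} {f : E → F} {U : Set E}
    (h : ∀ x ∈ U, ∃ V, IsOpen V ∧ x ∈ V ∧ MBDiffOn n f (U ∩ V)) (hU : IsOpen U) :
    MBDiffOn n f U := by
  have hcont : ContinuousOn f U := fun x hx => by
    obtain ⟨V, hV, hxV, hf⟩ := h x hx
    exact (hf.continuousOn.continuousAt ((hU.inter hV).mem_nhds ⟨hx, hxV⟩)).continuousWithinAt
  induction n generalizing E with
  | zero => exact hcont
  | succ n ih =>
    refine (MBDiffOn.succ_iff hU).2 ⟨hcont, fun x hx v => ?_, ?_⟩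
    · obtain ⟨V, hV, hxV, hf⟩ := h x hx
      exact ((MBDiffOn.succ_iff (hU.inter hV)).1 hf).2.1 x ⟨hx, hxV⟩ v
    · have h' : ∀ p ∈ U ×ˢ (univ : Set E), ∃ V, IsOpen V ∧ p ∈ V ∧
          MBDiffOn n (fun p : E × E => dirDeriv f p.1 p.2) (U ×ˢ univ ∩ V) := by
        rintro ⟨x, v⟩ ⟨hx, -⟩
        obtain ⟨V, hV, hxV, hf⟩ := h x hx
        refine ⟨V ×ˢ univ, hV.prod isOpen_univ, ⟨hxV, mem_univ _⟩, ?_⟩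
        refine ((MBDiffOn.succ_iff (hU.inter hV)).1 hf).2.2.mono ?_
        rintro ⟨y, w⟩ ⟨⟨h1, -⟩, h2, -⟩
        exact ⟨⟨h1, h2⟩, mem_univ _⟩
      refine ih h' (hU.prod isOpen_univ) fun p hp => ?_
      obtain ⟨V, hV, hxV, hf⟩ := h' p hp
      exact (hf.continuousOn.continuousAt
        (((hU.prod isOpen_univ).inter hV).mem_nhds ⟨hp, hxV⟩)).continuousWithinAt

/-- Induction on `n` with varying source spaces: the derivative of `f ∘ g` is `df` after `(g ∘ fst,
dg)`, again a composite of the lower class. -/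
theorem MBDiffOn.comp {E' : Type w} [AddCommGroup E'] [Module ℝ E'] [TopologicalSpace E']
    [IsTopologicalAddGroup E'] [ContinuousSMul ℝ E']
    [IsTopologicalAddGroup F] [ContinuousSMul ℝ F] [LocallyConvexSpace ℝ F] {n : ℕ} {f : E → F}
    {U : Set E} (hf : MBDiffOn n f U) {g : E' → E} {V : Set E'} (hg : MBDiffOn n g V)
    (hU : IsOpen U) (hVU : MapsTo g V U) : MBDiffOn n (f ∘ g) V := by
  induction n generalizing E E' with
  | zero => exact ContinuousOn.comp hf hg hVU
  | succ n ih =>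
    have hg' := hg.of_succ
    obtain ⟨hc, df, hd, hdf⟩ := hf
    obtain ⟨hc', dg, hd', hdg⟩ := hg
    refine ⟨hc.comp hc' hVU, df ∘ fun p => (g p.1, dg p), fun x hx v => ?_, ?_⟩
    · exact (hd' x hx v).comp hU hd hdf.continuousOn (hVU hx)
    · refine ih hdf (MBDiffOn.prodMk ?_ hdg) (hU.prod isOpen_univ) ?_
      · refine (hg'.comp_clm (ContinuousLinearMap.fst ℝ E' E')).mono ?_
        rintro ⟨x, v⟩ ⟨hx, -⟩
        exact hx
      · rintro ⟨x, v⟩ ⟨hx, -⟩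
        exact ⟨hVU hx, mem_univ _⟩

end MBDiffOn

/-! ### Smooth maps and the symmetry of second derivatives -/

section MBSmoothOn

variable {E : Type u} [AddCommGroup E] [Module ℝ E] [TopologicalSpace E]
variable {F : Type v} [AddCommGroup F] [Module ℝ F] [TopologicalSpace F]

theorem MBSmoothOn.mono {f : E → F} {U V : Set E} (h : MBSmoothOn f U) (hVU : V ⊆ U) :
    MBSmoothOn f V := fun n => (h n).mono hVU

theorem MBSmoothOn.continuousOn {f : E → F} {U : Set E} (h : MBSmoothOn f U) :
    ContinuousOn f U := (h 0).continuousOn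

theorem MBSmoothOn.prodMk {F' : Type w} [AddCommGroup F'] [Module ℝ F'] [TopologicalSpace F']
    {f : E → F} {g : E → F'} {U : Set E} (hf : MBSmoothOn f U) (hg : MBSmoothOn g U) :
    MBSmoothOn (fun x => (f x, g x)) U := fun n => (hf n).prodMk (hg n)

theorem MBSmoothOn.clm (L : E →L[ℝ] F) (U : Set E) : MBSmoothOn L U := fun _ => MBDiffOn.clm L U

theorem MBDiffOn.const [IsTopologicalAddGroup E] [ContinuousSMul ℝ E] (c : F) (U : Set E) (n : ℕ) :
    MBDiffOn n (fun _ : E => c) U := by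
  induction n generalizing E c with
  | zero => exact continuousOn_const
  | succ n ih =>
    refine ⟨continuousOn_const, fun _ => 0, fun x _ v => ?_, ih _ _⟩
    simp only [HasDirDeriv, sub_self, smul_zero]
    exact tendsto_const_nhds

variable [IsTopologicalAddGroup E] [ContinuousSMul ℝ E]

theorem MBSmoothOn.const (c : F) (U : Set E) : MBSmoothOn (fun _ : E => c) U :=
  MBDiffOn.const c U

theorem MBSmoothOn.congrOn {f g : E → F} {U : Set E} (h : MBSmoothOn f U) (hU : IsOpen U)
    (hfg : EqOn f g U) : MBSmoothOn g U := fun n => (h n).congrOn hU hfg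

theorem MBSmoothOn.of_locally [T2Space F] {f : E → F} {U : Set E}
    (h : ∀ x ∈ U, ∃ V, IsOpen V ∧ x ∈ V ∧ MBSmoothOn f (U ∩ V)) (hU : IsOpen U) :
    MBSmoothOn f U := fun n => MBDiffOn.of_locally (fun x hx => by
      obtain ⟨V, hV, hxV, hf⟩ := h x hx
      exact ⟨V, hV, hxV, hf n⟩) hU

theorem MBSmoothOn.comp {E' : Type w} [AddCommGroup E'] [Module ℝ E'] [TopologicalSpace E']
    [IsTopologicalAddGroup E'] [ContinuousSMul ℝ E']
    [IsTopologicalAddGroup F] [ContinuousSMul ℝ F] [LocallyConvexSpace ℝ F] {f : E → F}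
    {U : Set E} (hf : MBSmoothOn f U) {g : E' → E} {V : Set E'} (hg : MBSmoothOn g V)
    (hU : IsOpen U) (hVU : MapsTo g V U) : MBSmoothOn (f ∘ g) V :=
  fun n => (hf n).comp (hg n) hU hVU

variable [T2Space F]

theorem MBSmoothOn.hasDirDeriv {f : E → F} {U : Set E} (hf : MBSmoothOn f U) (hU : IsOpen U) {x : E}
    (hx : x ∈ U) (v : E) : HasDirDeriv f x v (dirDeriv f x v) :=
  ((MBDiffOn.succ_iff hU).1 (hf 1)).2.1 x hx v

theorem MBSmoothOn.dirDeriv {f : E → F} {U : Set E} (hf : MBSmoothOn f U) (hU : IsOpen U) :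
    MBSmoothOn (fun p : E × E => dirDeriv f p.1 p.2) (U ×ˢ univ) :=
  fun n => ((MBDiffOn.succ_iff hU).1 (hf (n + 1))).2.2

variable [IsTopologicalAddGroup F] [ContinuousSMul ℝ F] [LocallyConvexSpace ℝ F]

theorem MBSmoothOn.isLinearMap_dirDeriv {f : E → F} {U : Set E} (hf : MBSmoothOn f U)
    (hU : IsOpen U) {x : E} (hx : x ∈ U) : IsLinearMap ℝ (_root_.dirDeriv f x) :=
  isLinearMap_of_hasDirDeriv (df := fun p => _root_.dirDeriv f p.1 p.2) hU
    (fun _ hx v => hf.hasDirDeriv hU hx v) (hf.dirDeriv hU).continuousOn hx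

theorem MBSmoothOn.hasDirDeriv_comp {f : E → F} {U : Set E} (hf : MBSmoothOn f U) (hU : IsOpen U)
    {E' : Type w} [AddCommGroup E'] [Module ℝ E'] [TopologicalSpace E']
    [IsTopologicalAddGroup E'] [ContinuousSMul ℝ E']
    {g : E' → E} {z v : E'} {w : E} (hg : HasDirDeriv g z v w) (hx : g z ∈ U) :
    HasDirDeriv (f ∘ g) z v (_root_.dirDeriv f (g z) w) :=
  hg.comp (df := fun p => _root_.dirDeriv f p.1 p.2) hU (fun _ hx v => hf.hasDirDeriv hU hx v)
    (hf.dirDeriv hU).continuousOn hx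

/-- Second directional derivatives as limits of symmetric second differences. -/
theorem MBSmoothOn.tendsto_second_difference {f : E → F} {U : Set E} (hf : MBSmoothOn f U)
    (hU : IsOpen U) {x : E} (hx : x ∈ U) (v w : E) :
    Tendsto (fun t : ℝ => t⁻¹ • t⁻¹ •
        (f (x + t • v + t • w) - f (x + t • v) - f (x + t • w) + f x))
      (𝓝[≠] 0) (𝓝 (_root_.dirDeriv (fun y => _root_.dirDeriv f y v) x w)) := by
  have hfv : MBSmoothOn (fun y => _root_.dirDeriv f y v) U :=
    MBSmoothOn.comp (hf.dirDeriv hU) (g := fun y => (y, v))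
      (MBSmoothOn.prodMk (MBSmoothOn.clm (ContinuousLinearMap.id ℝ E) U) (MBSmoothOn.const v U))
      (hU.prod isOpen_univ) fun y hy => ⟨hy, mem_univ _⟩
  intro N hN
  obtain ⟨C, hC, hconv, hCN⟩ := exists_convex_closure_subset hN
  obtain ⟨C', hC', hconv', hCC'⟩ := exists_convex_closure_subset hC
  have hdq := tendsto_differenceQuotient (df := fun p => _root_.dirDeriv
    (fun y => _root_.dirDeriv f y v) p.1 p.2) hU (fun _ hx v => hfv.hasDirDeriv hU hx v)
    (hfv.dirDeriv hU).continuousOn hx w hC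
  have hcont : Continuous fun p : ℝ × ℝ => x + p.1 • v + p.2 • w := by fun_prop
  have hUnhds : ∀ᶠ p : ℝ × ℝ in 𝓝 0 ×ˢ 𝓝 0, x + p.1 • v + p.2 • w ∈ U := by
    rw [← nhds_prod_eq]
    refine hcont.continuousAt.eventually (hU.mem_nhds ?_)
    simpa using hx
  have hdq' : ∀ᶠ p : ℝ × ℝ in 𝓝 0 ×ˢ 𝓝[≠] 0, p.2⁻¹ • (_root_.dirDeriv f (x + p.1 • v + p.2 • w) v
      - _root_.dirDeriv f (x + p.1 • v) v) ∈ C := by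
    have h1 : Tendsto (fun p : ℝ × ℝ => (x + p.1 • v, w, p.2)) (𝓝 0 ×ˢ 𝓝[≠] 0)
        (𝓝 x ×ˢ 𝓝 w ×ˢ 𝓝[≠] 0) := by
      refine Tendsto.prodMk ?_ (tendsto_const_nhds.prodMk tendsto_snd)
      have : Continuous fun s : ℝ => x + s • v := by fun_prop
      have h := this.tendsto 0
      simp only [zero_smul, add_zero] at h
      exact h.comp tendsto_fst
    exact h1 hdq
  obtain ⟨A, hA, B, hB, hAB⟩ := Filter.mem_prod_iff.1 hdq'
  obtain ⟨A', hA', B', hB', hAB'⟩ := Filter.mem_prod_iff.1 hUnhds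
  obtain ⟨ε, hε, hεA⟩ := Metric.mem_nhds_iff.1 (inter_mem hA hA')
  rw [Filter.mem_map]
  filter_upwards [hB, mem_nhdsWithin_of_mem_nhds hB', self_mem_nhdsWithin,
    mem_nhdsWithin_of_mem_nhds (Metric.ball_mem_nhds (0 : ℝ) hε)] with t htB htB' ht0 htε
  have ht0 : t ≠ 0 := ht0
  have hin : ∀ r : ℝ, |r| ≤ |t| → r ∈ A ∩ A' := fun r hr => hεA (by
    simp only [Metric.mem_ball, Real.dist_eq, sub_zero] at htε ⊢
    exact hr.trans_lt htε)
  -- The second difference is a difference quotient along `v` of `y ↦ t⁻¹ • (f (y + t w) - f y)`.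
  -- The derivative of that map along `v` is a difference quotient of `∂_v f` along `w`, which lies
  -- in `C` by `hdq'`.
  have key := differenceQuotient_mem_closure (f := fun y => t⁻¹ • (f (y + t • w) - f y))
    (df := fun p => t⁻¹ • (_root_.dirDeriv f (p.1 + t • w) p.2 - _root_.dirDeriv f p.1 p.2))
    (y := x) (w := v) ht0 hconv ?_ ?_
  · refine hCN ?_
    convert key using 1
    simp only [← smul_sub]
    congr 2
    abel
  · intro r hr
    have h1 := hf.hasDirDeriv hU (hAB' (show (r, t) ∈ A' ×ˢ B' from ⟨(hin r hr).2, htB'⟩)) v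
    have h2 := hf.hasDirDeriv hU (x := x + r • v) (by
      simpa using hAB' (show (r, 0) ∈ A' ×ˢ B' from ⟨(hin r hr).2, mem_of_mem_nhds hB'⟩)) v
    have h3 : HasDirDeriv (fun y => f (y + t • w)) (x + r • v) v
        (_root_.dirDeriv f (x + r • v + t • w) v) := by
      refine Tendsto.congr (fun s => ?_) h1
      rw [add_right_comm (x + r • v) (t • w)]
    refine Tendsto.congr (fun s => ?_) ((Tendsto.sub h3 h2).const_smul t⁻¹)
    simp only [smul_sub, smul_smul, mul_comm]
    abel
  · intro r hr
    exact hAB (show (r, t) ∈ A ×ˢ B from ⟨(hin r hr).1, htB⟩)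

/-- The symmetry of second derivatives. -/
theorem MBSmoothOn.dirDeriv_comm {f : E → F} {U : Set E} (hf : MBSmoothOn f U) (hU : IsOpen U)
    {x : E} (hx : x ∈ U) (v w : E) :
    _root_.dirDeriv (fun y => _root_.dirDeriv f y v) x w
      = _root_.dirDeriv (fun y => _root_.dirDeriv f y w) x v := by
  refine tendsto_nhds_unique (hf.tendsto_second_difference hU hx v w) ?_
  refine (hf.tendsto_second_difference hU hx w v).congr fun t => ?_
  rw [add_right_comm, sub_right_comm]

end MBSmoothOn

/-! ### Comparison with smoothness in normed spaces -/

section ContDiff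

theorem ContDiffOn.mbDiffOn {E : Type u} [NormedAddCommGroup E] [NormedSpace ℝ E]
    {F : Type v} [NormedAddCommGroup F] [NormedSpace ℝ F] {n : ℕ} {f : E → F} {U : Set E}
    (hf : ContDiffOn ℝ n f U) (hU : IsOpen U) : MBDiffOn n f U := by
  induction n generalizing E with
  | zero => exact hf.continuousOn
  | succ n ih =>
    refine ⟨hf.continuousOn, fun p => fderiv ℝ f p.1 p.2, fun x hx v => ?_,
      ih ?_ (hU.prod isOpen_univ)⟩
    · have h1 : HasFDerivAt f (fderiv ℝ f x) (x + (0 : ℝ) • v) := by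
        simpa using ((hf.differentiableOn (by simp)).differentiableAt (hU.mem_nhds hx)).hasFDerivAt
      have h2 : HasDerivAt (fun t : ℝ => x + t • v) v 0 := by
        simpa using ((hasDerivAt_id (0 : ℝ)).smul_const v).const_add x
      exact hasDirDeriv_line_zero_iff.1 (hasDirDeriv_iff_hasDerivAt.2 (h1.comp_hasDerivAt 0 h2))
    · have h1 : ContDiffOn ℝ n (fderiv ℝ f) U :=
        hf.fderiv_of_isOpen hU (by norm_cast)
      exact (h1.comp contDiffOn_fst fun p hp => hp.1).clm_apply contDiffOn_snd

theorem ContDiffOn.mbSmoothOn {E : Type u} [NormedAddCommGroup E] [NormedSpace ℝ E]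
    {F : Type v} [NormedAddCommGroup F] [NormedSpace ℝ F] {f : E → F} {U : Set E}
    (hf : ContDiffOn ℝ ((⊤ : ℕ∞) : WithTop ℕ∞) f U) (hU : IsOpen U) : MBSmoothOn f U :=
  fun _ => (hf.of_le (by exact_mod_cast le_top)).mbDiffOn hU

end ContDiff

/-! ### Smooth maps between manifolds -/

section SmoothOnOpen

variable {L : Type*} [TopologicalSpace L] [SmoothManifold L]
variable {M : Type*} [TopologicalSpace M] [SmoothManifold M]
variable {N : Type*} [TopologicalSpace N] [SmoothManifold N]

/-- `f` is smooth near `x`. -/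
def SmoothAt (f : M → N) (x : M) : Prop := ∃ U, x ∈ U ∧ SmoothOnOpen f U

/-- `f` coincides on `S` near `x` with a map that is smooth near `x`. -/
def SmoothAtW (f : M → N) (S : Set M) (x : M) : Prop :=
  ∃ (U : Set M) (g : M → N), x ∈ U ∧ SmoothOnOpen g U ∧ ∀ x' ∈ U ∩ S, f x' = g x'

theorem isOpen_chart_domain {f : M → N} {U : Set M} (hU : IsOpen U) (hf : ContinuousOn f U) (a : M)
    {V : Set N} (hV : IsOpen V) :
    IsOpen ((chart a).target ∩ (chart a).symm ⁻¹' (U ∩ f ⁻¹' V)) :=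
  (chart a).isOpen_inter_preimage_symm (hf.isOpen_inter_preimage hU hV)

theorem SmoothOnOpen.mono {f : M → N} {U V : Set M} (h : SmoothOnOpen f U) (hV : IsOpen V)
    (hVU : V ⊆ U) : SmoothOnOpen f V :=
  ⟨hV, h.2.1.mono hVU, fun a b => (h.2.2 a b).mono fun _ hz => ⟨hz.1, hVU hz.2.1, hz.2.2⟩⟩

theorem SmoothOnOpen.congr {f g : M → N} {U : Set M} (h : SmoothOnOpen f U) (hfg : EqOn f g U) :
    SmoothOnOpen g U := by
  refine ⟨h.1, h.2.1.congr fun x hx => (hfg hx).symm, fun a b => ?_⟩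
  have hset : (chart a).target ∩ (chart a).symm ⁻¹' (U ∩ g ⁻¹' (chart b).source)
      = (chart a).target ∩ (chart a).symm ⁻¹' (U ∩ f ⁻¹' (chart b).source) := by
    ext z
    simp only [mem_inter_iff, mem_preimage]
    constructor
    · rintro ⟨h1, h2, h3⟩
      exact ⟨h1, h2, by rwa [hfg h2]⟩
    · rintro ⟨h1, h2, h3⟩
      exact ⟨h1, h2, by rwa [← hfg h2]⟩
  rw [hset]
  refine (h.2.2 a b).congrOn (isOpen_chart_domain h.1 h.2.1 a (chart b).open_source) ?_
  intro z hz
  simp only [Function.comp]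
  rw [hfg hz.2.1]

theorem SmoothOnOpen.comp {g : M → N} {V : Set M} (hg : SmoothOnOpen g V) {f : L → M} {U : Set L}
    (hf : SmoothOnOpen f U) (hUV : MapsTo f U V) : SmoothOnOpen (g ∘ f) U := by
  have hc : ContinuousOn (g ∘ f) U := hg.2.1.comp hf.2.1 hUV
  refine ⟨hf.1, hc, fun a c => ?_⟩
  refine MBSmoothOn.of_locally ?_ (isOpen_chart_domain hf.1 hc a (chart c).open_source)
  intro z hz
  -- Near `z` the coordinate expression of `g ∘ f` factors through the chart at the intermediate
  -- point `b`.
  set b := f ((chart a).symm z)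
  have ho := isOpen_chart_domain hf.1 hf.2.1 a (chart b).open_source
  refine ⟨_, ho, ⟨hz.1, hz.2.1, SmoothManifold.mem_chart_source b⟩, ?_⟩
  have h1 := (hf.2.2 a b).mono (inter_subset_right (s := (chart a).target ∩
    (chart a).symm ⁻¹' (U ∩ (g ∘ f) ⁻¹' (chart c).source)))
  refine ((hg.2.2 b c).comp h1 (isOpen_chart_domain hg.1 hg.2.1 b (chart c).open_source)
    ?_).congrOn ((isOpen_chart_domain hf.1 hc a (chart c).open_source).inter ho) ?_
  · rintro y ⟨hy, hy'⟩
    simp only [mem_inter_iff, mem_preimage, Function.comp] at hy hy' ⊢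
    refine ⟨(chart b).map_source hy'.2.2, ?_⟩
    rw [(chart b).left_inv hy'.2.2]
    exact ⟨hUV hy.2.1, hy.2.2⟩
  · rintro y ⟨hy, hy'⟩
    simp only [Function.comp]
    rw [(chart b).left_inv hy'.2.2]

theorem SmoothOnOpen.prodMk {f : L → M} {g : L → N} {U : Set L} (hf : SmoothOnOpen f U)
    (hg : SmoothOnOpen g U) : SmoothOnOpen (fun x => (f x, g x)) U := by
  refine ⟨hf.1, hf.2.1.prodMk hg.2.1, fun a b => ?_⟩
  refine MBSmoothOn.prodMk ((hf.2.2 a b.1).mono ?_) ((hg.2.2 a b.2).mono ?_)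
  · rintro z ⟨h1, h2, h3⟩
    exact ⟨h1, h2, h3.1⟩
  · rintro z ⟨h1, h2, h3⟩
    exact ⟨h1, h2, h3.2⟩

theorem smoothMap_id : SmoothMap (id : M → M) := by
  refine ⟨isOpen_univ, continuousOn_id, fun a b => (SmoothManifold.smooth_transition a b).mono ?_⟩
  rintro z ⟨h1, h2, h3⟩
  exact ⟨h1, h3⟩

theorem smoothMap_const (y : N) : SmoothMap (fun _ : M => y) :=
  ⟨isOpen_univ, continuousOn_const, fun _ b => MBSmoothOn.const (chart b y) _⟩

theorem smoothMap_fst : SmoothMap (Prod.fst : M × N → M) := by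
  refine ⟨isOpen_univ, continuousOn_fst, fun a b n => ?_⟩
  refine ((SmoothManifold.smooth_transition a.1 b n).comp_clm
    (ContinuousLinearMap.fst ℝ (Tan a.1) (Tan a.2))).mono ?_
  rintro z ⟨h1, h2, h3⟩
  exact ⟨h1.1, h3⟩

theorem smoothMap_snd : SmoothMap (Prod.snd : M × N → N) := by
  refine ⟨isOpen_univ, continuousOn_snd, fun a b n => ?_⟩
  refine ((SmoothManifold.smooth_transition a.2 b n).comp_clm
    (ContinuousLinearMap.snd ℝ (Tan a.1) (Tan a.2))).mono ?_
  rintro z ⟨h1, h2, h3⟩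
  exact ⟨h1.2, h3⟩

theorem smoothOnOpen_chart (a : M) : SmoothOnOpen (chart a : M → Tan a) (chart a).source := by
  refine ⟨(chart a).open_source, (chart a).continuousOn, fun c b =>
    (SmoothManifold.smooth_transition c a).mono ?_⟩
  rintro z ⟨h1, h2, h3⟩
  exact ⟨h1, h2⟩

theorem smoothOnOpen_chart_symm (a : M) :
    SmoothOnOpen ((chart a).symm : Tan a → M) (chart a).target := by
  refine ⟨(chart a).open_target, (chart a).continuousOn_symm, fun c b =>
    (SmoothManifold.smooth_transition a b).mono ?_⟩
  rintro z ⟨h1, h2, h3⟩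
  exact ⟨h2, h3⟩

theorem smoothMap_iff {f : M → N} : SmoothMap f ↔ ∀ x, SmoothAt f x := by
  constructor
  · exact fun h x => ⟨univ, mem_univ _, h⟩
  · intro h
    have hc : ContinuousOn f univ := fun x _ => by
      obtain ⟨U, hx, hU⟩ := h x
      exact (hU.2.1.continuousAt (hU.1.mem_nhds hx)).continuousWithinAt
    refine ⟨isOpen_univ, hc, fun a b => ?_⟩
    refine MBSmoothOn.of_locally ?_ (isOpen_chart_domain isOpen_univ hc a (chart b).open_source)
    intro z hz
    obtain ⟨U, hx, hU⟩ := h ((chart a).symm z)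
    refine ⟨_, (chart a).isOpen_inter_preimage_symm hU.1, ⟨hz.1, hx⟩, (hU.2.2 a b).mono ?_⟩
    rintro y ⟨h1, h2⟩
    exact ⟨h1.1, h2.2, h1.2.2⟩

theorem SmoothOnOpen.smoothAt {f : M → N} {U : Set M} (h : SmoothOnOpen f U) {x : M} (hx : x ∈ U) :
    SmoothAt f x := ⟨U, hx, h⟩

theorem smoothOnOpen_iff {f : M → N} {U : Set M} :
    SmoothOnOpen f U ↔ IsOpen U ∧ ∀ x ∈ U, SmoothAt f x := by
  constructor
  · exact fun h => ⟨h.1, fun x hx => h.smoothAt hx⟩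
  · rintro ⟨hU, h⟩
    have hc : ContinuousOn f U := fun x hx => by
      obtain ⟨V, hx, hV⟩ := h x hx
      exact (hV.2.1.continuousAt (hV.1.mem_nhds hx)).continuousWithinAt
    refine ⟨hU, hc, fun a b => ?_⟩
    refine MBSmoothOn.of_locally ?_ (isOpen_chart_domain hU hc a (chart b).open_source)
    intro z hz
    obtain ⟨V, hx, hV⟩ := h ((chart a).symm z) hz.2.1
    refine ⟨_, (chart a).isOpen_inter_preimage_symm hV.1, ⟨hz.1, hx⟩, (hV.2.2 a b).mono ?_⟩
    rintro y ⟨h1, h2⟩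
    exact ⟨h1.1, h2.2, h1.2.2⟩

theorem SmoothMap.smoothAt {f : M → N} (h : SmoothMap f) (x : M) : SmoothAt f x :=
  smoothMap_iff.1 h x

theorem SmoothMap.continuous {f : M → N} (h : SmoothMap f) : Continuous f :=
  continuousOn_univ.1 h.2.1

theorem SmoothMap.comp {g : M → N} (hg : SmoothMap g) {f : L → M} (hf : SmoothMap f) :
    SmoothMap (g ∘ f) :=
  SmoothOnOpen.comp hg hf (mapsTo_univ _ _)

theorem SmoothMap.prodMk {f : L → M} {g : L → N} (hf : SmoothMap f) (hg : SmoothMap g) :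
    SmoothMap (fun x => (f x, g x)) :=
  SmoothOnOpen.prodMk hf hg

theorem SmoothAt.eventually {f : M → N} {x : M} (h : SmoothAt f x) :
    ∀ᶠ y in 𝓝 x, SmoothAt f y := by
  obtain ⟨U, hx, hU⟩ := h
  filter_upwards [hU.1.mem_nhds hx] with y hy using ⟨U, hy, hU⟩

theorem SmoothAt.continuousAt {f : M → N} {x : M} (h : SmoothAt f x) : ContinuousAt f x := by
  obtain ⟨U, hx, hU⟩ := h
  exact hU.2.1.continuousAt (hU.1.mem_nhds hx)

theorem SmoothAt.congr {f g : M → N} {x : M} (h : SmoothAt f x) (hfg : f =ᶠ[𝓝 x] g) :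
    SmoothAt g x := by
  obtain ⟨U, hx, hU⟩ := h
  obtain ⟨V, hV, hVo, hxV⟩ := mem_nhds_iff.1 hfg
  exact ⟨U ∩ V, ⟨hx, hxV⟩, (hU.mono (hU.1.inter hVo) inter_subset_left).congr fun y hy => hV hy.2⟩

theorem SmoothAt.comp {g : M → N} {f : L → M} {x : L} (hg : SmoothAt g (f x)) (hf : SmoothAt f x) :
    SmoothAt (fun x => g (f x)) x := by
  obtain ⟨U, hx, hU⟩ := hf
  obtain ⟨V, hy, hV⟩ := hg
  refine ⟨U ∩ f ⁻¹' V, ⟨hx, hy⟩, ?_⟩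
  have ho := hU.2.1.isOpen_inter_preimage hU.1 hV.1
  exact hV.comp (hU.mono ho inter_subset_left) fun z hz => hz.2

theorem SmoothAt.comp_of_eq {g : M → N} {f : L → M} {x : L} {y : M} (hg : SmoothAt g y)
    (hf : SmoothAt f x) (h : f x = y) : SmoothAt (fun x => g (f x)) x := by
  subst h
  exact hg.comp hf

theorem SmoothAt.prodMk {f : L → M} {g : L → N} {x : L} (hf : SmoothAt f x) (hg : SmoothAt g x) :
    SmoothAt (fun x => (f x, g x)) x := by
  obtain ⟨U, hx, hU⟩ := hf
  obtain ⟨V, hy, hV⟩ := hg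
  exact ⟨U ∩ V, ⟨hx, hy⟩, (hU.mono (hU.1.inter hV.1) inter_subset_left).prodMk
    (hV.mono (hU.1.inter hV.1) inter_subset_right)⟩

theorem smoothAt_id (x : M) : SmoothAt (fun x : M => x) x := smoothMap_id.smoothAt x

theorem smoothAt_const (y : N) (x : M) : SmoothAt (fun _ : M => y) x := (smoothMap_const y).smoothAt x

theorem SmoothAt.fst {f : L → M × N} {x : L} (h : SmoothAt f x) : SmoothAt (fun x => (f x).1) x :=
  (smoothMap_fst.smoothAt _).comp h

theorem SmoothAt.snd {f : L → M × N} {x : L} (h : SmoothAt f x) : SmoothAt (fun x => (f x).2) x :=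
  (smoothMap_snd.smoothAt _).comp h

theorem SmoothMap.comp_smoothAt {g : M → N} (hg : SmoothMap g) {f : L → M} {x : L}
    (hf : SmoothAt f x) : SmoothAt (fun x => g (f x)) x := (hg.smoothAt _).comp hf

theorem smoothAt_chart {a x : M} (hx : x ∈ (chart a).source) : SmoothAt (chart a : M → Tan a) x :=
  (smoothOnOpen_chart a).smoothAt hx

theorem smoothAt_chart_symm {a : M} {z : Tan a} (hz : z ∈ (chart a).target) :
    SmoothAt ((chart a).symm : Tan a → M) z :=
  (smoothOnOpen_chart_symm a).smoothAt hz

theorem chart_mem_target (a : M) : chart a a ∈ (chart a).target :=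
  (chart a).map_source (SmoothManifold.mem_chart_source a)

theorem chart_symm_chart (a : M) : (chart a).symm (chart a a) = a :=
  (chart a).left_inv (SmoothManifold.mem_chart_source a)

/-! ### Smoothness on subsets -/

theorem SmoothAt.smoothAtW {f : M → N} {x : M} (h : SmoothAt f x) (S : Set M) : SmoothAtW f S x := by
  obtain ⟨U, hx, hU⟩ := h
  exact ⟨U, f, hx, hU, fun _ _ => rfl⟩

theorem SmoothAtW.smoothAt {f : M → N} {S : Set M} {x : M} (h : SmoothAtW f S x) (hS : S ∈ 𝓝 x) :
    SmoothAt f x := by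
  obtain ⟨U, g, hx, hU, hfg⟩ := h
  refine (hU.smoothAt hx).congr ?_
  filter_upwards [hS, hU.1.mem_nhds hx] with y hy hy' using (hfg y ⟨hy', hy⟩).symm

theorem SmoothAtW.exists_smoothAt {f : M → N} {S : Set M} {x : M} (h : SmoothAtW f S x) :
    ∃ g : M → N, SmoothAt g x ∧ ∀ᶠ y in 𝓝 x, y ∈ S → f y = g y := by
  obtain ⟨U, g, hx, hU, hfg⟩ := h
  refine ⟨g, hU.smoothAt hx, ?_⟩
  filter_upwards [hU.1.mem_nhds hx] with y hy hyS using hfg y ⟨hy, hyS⟩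

theorem SmoothAt.smoothAtW_of_eq {f g : M → N} {S : Set M} {x : M} (hg : SmoothAt g x)
    (h : ∀ᶠ y in 𝓝 x, y ∈ S → f y = g y) : SmoothAtW f S x := by
  obtain ⟨U, hx, hU⟩ := hg
  obtain ⟨V, hV, hVo, hxV⟩ := mem_nhds_iff.1 h
  exact ⟨U ∩ V, g, ⟨hx, hxV⟩, hU.mono (hU.1.inter hVo) inter_subset_left,
    fun y hy => hV hy.1.2 hy.2⟩

theorem SmoothAtW.comp {g : M → N} {f : L → M} {x : L} {S : Set L} {T : Set M}
    (hg : SmoothAtW g T (f x)) (hf : SmoothAtW f S x) (hx : x ∈ S)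
    (h : ∀ᶠ y in 𝓝 x, y ∈ S → f y ∈ T) : SmoothAtW (fun x => g (f x)) S x := by
  obtain ⟨f', hf', hff'⟩ := hf.exists_smoothAt
  obtain ⟨g', hg', hgg'⟩ := hg.exists_smoothAt
  have hfx : f x = f' x := hff'.self_of_nhds hx
  rw [hfx] at hg' hgg'
  refine (hg'.comp hf').smoothAtW_of_eq ?_
  filter_upwards [hff', hf'.continuousAt.eventually hgg', h] with y h1 h2 h3 hy
  rw [← h2 (h1 hy ▸ h3 hy), h1 hy]

theorem SmoothAtW.prodMk {f : L → M} {g : L → N} {x : L} {S : Set L} (hf : SmoothAtW f S x)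
    (hg : SmoothAtW g S x) : SmoothAtW (fun x => (f x, g x)) S x := by
  obtain ⟨f', hf', hff'⟩ := hf.exists_smoothAt
  obtain ⟨g', hg', hgg'⟩ := hg.exists_smoothAt
  refine (hf'.prodMk hg').smoothAtW_of_eq ?_
  filter_upwards [hff', hgg'] with y h1 h2 hy
  rw [h1 hy, h2 hy]

theorem SmoothMap.comp_smoothAtW {g : M → N} {f : L → M} {x : L} {S : Set L}
    (hg : SmoothMap g) (hf : SmoothAtW f S x) : SmoothAtW (fun x => g (f x)) S x := by
  obtain ⟨f', hf', hff'⟩ := hf.exists_smoothAt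
  refine (hg.comp_smoothAt hf').smoothAtW_of_eq ?_
  filter_upwards [hff'] with y h1 hy
  rw [h1 hy]

theorem SmoothAtW.mono {f : M → N} {S T : Set M} {x : M} (h : SmoothAtW f S x) (hT : T ⊆ S) :
    SmoothAtW f T x := by
  obtain ⟨U, g, hx, hU, hfg⟩ := h
  exact ⟨U, g, hx, hU, fun y hy => hfg y ⟨hy.1, hT hy.2⟩⟩

theorem SmoothAtW.congr {f f' : M → N} {S : Set M} {x : M} (h : SmoothAtW f S x)
    (hf : ∀ᶠ y in 𝓝 x, y ∈ S → f' y = f y) : SmoothAtW f' S x := by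
  obtain ⟨g, hg, hfg⟩ := h.exists_smoothAt
  refine hg.smoothAtW_of_eq ?_
  filter_upwards [hf, hfg] with y h1 h2 hy
  rw [h1 hy, h2 hy]

/-- Composition of a map that is smooth on a subset with a smooth map into this subset. -/
theorem SmoothAtW.comp_smoothAt {g : M → N} {f : L → M} {x : L} {T : Set M}
    (hg : SmoothAtW g T (f x)) (hf : SmoothAt f x) (h : ∀ᶠ y in 𝓝 x, f y ∈ T) :
    SmoothAt (fun x => g (f x)) x :=
  (hg.comp (hf.smoothAtW univ) (mem_univ _) (h.mono fun _ hy _ => hy)).smoothAt univ_mem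

end SmoothOnOpen

/-! ### Locally convex spaces as manifolds -/

section Flat

variable {E : Type*} [AddCommGroup E] [Module ℝ E] [TopologicalSpace E] [IsTopologicalAddGroup E]
  [ContinuousSMul ℝ E] [LocallyConvexSpace ℝ E] [T2Space E]
variable {E' : Type*} [AddCommGroup E'] [Module ℝ E'] [TopologicalSpace E'] [IsTopologicalAddGroup E']
  [ContinuousSMul ℝ E'] [LocallyConvexSpace ℝ E'] [T2Space E']
variable {E'' : Type*} [AddCommGroup E''] [Module ℝ E''] [TopologicalSpace E'']
  [IsTopologicalAddGroup E''] [ContinuousSMul ℝ E''] [LocallyConvexSpace ℝ E''] [T2Space E'']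
variable {F : Type*} [AddCommGroup F] [Module ℝ F] [TopologicalSpace F] [IsTopologicalAddGroup F]
  [ContinuousSMul ℝ F] [LocallyConvexSpace ℝ F] [T2Space F]
variable {M : Type*} [TopologicalSpace M] [SmoothManifold M]

theorem smoothOnOpen_iff_mbSmoothOn {f : E → F} {U : Set E} :
    SmoothOnOpen f U ↔ IsOpen U ∧ MBSmoothOn f U := by
  constructor
  · rintro ⟨h1, h2, h3⟩
    exact ⟨h1, (h3 (0 : E) (0 : F)).mono fun z hz => ⟨mem_univ _, hz, mem_univ _⟩⟩
  · rintro ⟨h1, h2⟩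
    exact ⟨h1, h2.continuousOn, fun _ _ => h2.mono fun z hz => hz.2.1⟩

/-- `E × E'` carries the product manifold structure here, not that of a locally convex space. The
charts of both are the identity, but the structures are not the same instance, so products need
their own versions. -/
theorem smoothOnOpen_prod_iff_mbSmoothOn {f : E × E' → F} {U : Set (E × E')} :
    SmoothOnOpen f U ↔ IsOpen U ∧ MBSmoothOn f U := by
  constructor
  · rintro ⟨h1, h2, h3⟩
    exact ⟨h1, (h3 (0 : E × E') (0 : F)).mono
      fun z hz => ⟨⟨mem_univ _, mem_univ _⟩, hz, mem_univ _⟩⟩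
  · rintro ⟨h1, h2⟩
    exact ⟨h1, h2.continuousOn, fun _ _ => h2.mono fun z hz => hz.2.1⟩

theorem smoothOnOpen_prod₃_iff_mbSmoothOn {f : E × E' × E'' → F} {U : Set (E × E' × E'')} :
    SmoothOnOpen f U ↔ IsOpen U ∧ MBSmoothOn f U := by
  constructor
  · rintro ⟨h1, h2, h3⟩
    exact ⟨h1, (h3 (0 : E × E' × E'') (0 : F)).mono
      fun z hz => ⟨⟨mem_univ _, mem_univ _, mem_univ _⟩, hz, mem_univ _⟩⟩
  · rintro ⟨h1, h2⟩
    exact ⟨h1, h2.continuousOn, fun _ _ => h2.mono fun z hz => hz.2.1⟩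

theorem smoothMap_add : SmoothMap (fun p : E × E => p.1 + p.2) :=
  smoothOnOpen_prod_iff_mbSmoothOn.2 ⟨isOpen_univ,
    MBSmoothOn.clm (ContinuousLinearMap.fst ℝ E E + ContinuousLinearMap.snd ℝ E E) _⟩

theorem smoothMap_clm (L : E →L[ℝ] F) : SmoothMap (fun x => L x) :=
  smoothOnOpen_iff_mbSmoothOn.2 ⟨isOpen_univ, MBSmoothOn.clm L _⟩

theorem mbDiffOn_smul (n : ℕ) : MBDiffOn n (fun p : ℝ × E => p.1 • p.2) univ := by
  induction n with
  | zero => exact continuous_smul.continuousOn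
  | succ n ih =>
    -- The derivative `r v + s x` is a sum of two scalar multiplications composed with projections,
    -- so the induction closes.
    refine ⟨continuous_smul.continuousOn, fun q => q.1.1 • q.2.2 + q.2.1 • q.1.2, ?_, ?_⟩
    · rintro ⟨r, x⟩ - ⟨s, v⟩
      have hc : Continuous fun t : ℝ => r • v + s • x + t • s • v := by fun_prop
      have h := (hc.tendsto 0).mono_left (nhdsWithin_le_nhds (s := {0}ᶜ))
      simp only [zero_smul, add_zero] at h
      refine h.congr' ?_
      filter_upwards [self_mem_nhdsWithin] with t ht
      have ht : t ≠ 0 := ht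
      simp only [Prod.fst_add, Prod.snd_add, Prod.smul_fst, Prod.smul_snd, smul_eq_mul, add_smul,
        smul_add]
      have e : r • x + (t * s) • x + (r • t • v + (t * s) • t • v) - r • x
          = t • (r • v + s • x + t • s • v) := by
        simp only [smul_add, smul_smul]
        rw [mul_comm r t, show t * (t * s) = t * s * t by ring]
        abel
      rw [e, inv_smul_smul₀ ht]
    · have h1 := ih.comp_clm (((ContinuousLinearMap.fst ℝ ℝ E).comp
        (ContinuousLinearMap.fst ℝ (ℝ × E) (ℝ × E))).prod
        ((ContinuousLinearMap.snd ℝ ℝ E).comp (ContinuousLinearMap.snd ℝ (ℝ × E) (ℝ × E))))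
      have h2 := ih.comp_clm (((ContinuousLinearMap.fst ℝ ℝ E).comp
        (ContinuousLinearMap.snd ℝ (ℝ × E) (ℝ × E))).prod
        ((ContinuousLinearMap.snd ℝ ℝ E).comp (ContinuousLinearMap.fst ℝ (ℝ × E) (ℝ × E))))
      have h3 := (h1.prodMk h2)
      have hadd : MBDiffOn n (fun p : E × E => p.1 + p.2) univ :=
        MBDiffOn.clm (ContinuousLinearMap.fst ℝ E E + ContinuousLinearMap.snd ℝ E E) _
      exact (hadd.comp h3 isOpen_univ (mapsTo_univ _ _)).mono fun _ _ => trivial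

theorem smoothMap_smul : SmoothMap (fun p : ℝ × E => p.1 • p.2) :=
  smoothOnOpen_prod_iff_mbSmoothOn.2 ⟨isOpen_univ, fun n => mbDiffOn_smul n⟩

theorem SmoothAt.add {f g : M → E} {x : M} (hf : SmoothAt f x) (hg : SmoothAt g x) :
    SmoothAt (fun x => f x + g x) x :=
  smoothMap_add.comp_smoothAt (hf.prodMk hg)

theorem SmoothAt.smul {f : M → ℝ} {g : M → E} {x : M} (hf : SmoothAt f x) (hg : SmoothAt g x) :
    SmoothAt (fun x => f x • g x) x :=
  smoothMap_smul.comp_smoothAt (hf.prodMk hg)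

theorem ContDiffOn.smoothOnOpen {E : Type*} [NormedAddCommGroup E] [NormedSpace ℝ E]
    {F : Type*} [NormedAddCommGroup F] [NormedSpace ℝ F] {f : E → F} {U : Set E}
    (hf : ContDiffOn ℝ ((⊤ : ℕ∞) : WithTop ℕ∞) f U) (hU : IsOpen U) : SmoothOnOpen f U :=
  smoothOnOpen_iff_mbSmoothOn.2 ⟨hU, hf.mbSmoothOn hU⟩

theorem ContDiff.smoothMap {E : Type*} [NormedAddCommGroup E] [NormedSpace ℝ E]
    {F : Type*} [NormedAddCommGroup F] [NormedSpace ℝ F] {f : E → F}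
    (hf : ContDiff ℝ ((⊤ : ℕ∞) : WithTop ℕ∞) f) : SmoothMap f :=
  hf.contDiffOn.smoothOnOpen isOpen_univ

theorem smoothMap_complex_mul : SmoothMap (fun p : ℂ × ℂ => p.1 * p.2) := by
  refine smoothOnOpen_prod_iff_mbSmoothOn.2 ⟨isOpen_univ, ?_⟩
  exact ContDiffOn.mbSmoothOn (contDiff_fst.mul contDiff_snd).contDiffOn isOpen_univ

end Flat

/-! ### Differentials -/

section Mdiff

variable {L : Type*} [TopologicalSpace L] [SmoothManifold L]
variable {M : Type*} [TopologicalSpace M] [SmoothManifold M]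
variable {N : Type*} [TopologicalSpace N] [SmoothManifold N]

theorem tendsto_chart_symm (x : M) : Tendsto (chart x).symm (𝓝 (chart x x)) (𝓝 x) := by
  have h := ((chart x).continuousAt_symm (chart_mem_target x)).tendsto
  rwa [chart_symm_chart] at h

theorem SmoothAt.exists_mbSmoothOn {f : M → N} {x : M} (h : SmoothAt f x) :
    ∃ A, IsOpen A ∧ chart x x ∈ A ∧
      MBSmoothOn (fun z => chart (f x) (f ((chart x).symm z))) A := by
  obtain ⟨U, hx, hU⟩ := h
  refine ⟨_, isOpen_chart_domain hU.1 hU.2.1 x (chart (f x)).open_source, ?_, hU.2.2 x (f x)⟩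
  refine ⟨chart_mem_target x, ?_, ?_⟩
  · simpa only [chart_symm_chart] using hx
  · simp only [mem_preimage, chart_symm_chart]
    exact SmoothManifold.mem_chart_source _

theorem SmoothAt.hasDirDeriv {f : M → N} {x : M} (h : SmoothAt f x) (v : Tan x) :
    HasDirDeriv (fun z => chart (f x) (f ((chart x).symm z))) (chart x x) v
      (mdiff f x (f x) v) := by
  obtain ⟨A, hA, hx, hs⟩ := h.exists_mbSmoothOn
  exact hs.hasDirDeriv hA hx v

theorem mdiff_isLinearMap {f : M → N} {x : M} {y : N} (h : SmoothAt f x) (hy : f x = y) :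
    IsLinearMap ℝ (mdiff f x y) := by
  subst hy
  obtain ⟨A, hA, hx, hs⟩ := h.exists_mbSmoothOn
  exact hs.isLinearMap_dirDeriv hA hx

theorem mdiff_congr {f g : M → N} {x : M} (h : f =ᶠ[𝓝 x] g) (y : N) (v : Tan x) :
    mdiff f x y v = mdiff g x y v := by
  refine dirDeriv_congr v ?_
  filter_upwards [(tendsto_chart_symm x).eventually h] with z hz
  rw [hz]

/-- The chain rule. -/
theorem mdiff_comp {f : L → M} {g : M → N} {x : L} {y : M} {z : N} (hg : SmoothAt g y)
    (hf : SmoothAt f x) (hy : f x = y) (hz : g y = z) (v : Tan x) :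
    mdiff (fun x => g (f x)) x z v = mdiff g y z (mdiff f x y v) := by
  subst hy hz
  obtain ⟨A, hA, hx, hs⟩ := hg.exists_mbSmoothOn
  have h1 := hf.hasDirDeriv v
  have h2 := hs.hasDirDeriv_comp hA h1 (by simpa only [chart_symm_chart] using hx)
  simp only [chart_symm_chart] at h2
  refine (h2.congr_of_eventuallyEq ?_).dirDeriv_eq
  have h3 : ∀ᶠ z in 𝓝 (chart x x), f ((chart x).symm z) ∈ (chart (f x)).source := by
    refine (hf.continuousAt.tendsto.comp (tendsto_chart_symm x)).eventually ?_
    exact (chart (f x)).open_source.mem_nhds (SmoothManifold.mem_chart_source _)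
  filter_upwards [h3] with z hz
  simp only [Function.comp]
  rw [(chart (f x)).left_inv hz]

theorem mdiff_id (x : M) (v : Tan x) : mdiff (fun x => x) x x v = v := by
  refine HasDirDeriv.dirDeriv_eq ?_
  have h : HasDirDeriv (fun z : Tan x => z) (chart x x) v v := by
    refine tendsto_const_nhds.congr' ?_
    filter_upwards [self_mem_nhdsWithin] with t ht
    have ht : t ≠ 0 := ht
    simp [smul_smul, inv_mul_cancel₀ ht]
  refine h.congr_of_eventuallyEq ?_
  filter_upwards [(chart x).open_target.mem_nhds (chart_mem_target x)] with z hz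
  exact ((chart x).right_inv hz).symm

theorem mdiff_const (x : M) (y : N) (v : Tan x) : mdiff (fun _ : M => y) x y v = 0 := by
  refine HasDirDeriv.dirDeriv_eq ?_
  simp only [HasDirDeriv, sub_self, smul_zero]
  exact tendsto_const_nhds

theorem mdiff_prodMk {f : L → M} {g : L → N} {x : L} {y : M × N} (hf : SmoothAt f x)
    (hg : SmoothAt g x) (h₁ : f x = y.1) (h₂ : g x = y.2) (v : Tan x) :
    mdiff (fun x => (f x, g x)) x y v = (mdiff f x y.1 v, mdiff g x y.2 v) := by
  obtain ⟨y₁, y₂⟩ := y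
  simp only at h₁ h₂
  subst h₁ h₂
  exact ((hf.hasDirDeriv v).prodMk_nhds (hg.hasDirDeriv v)).limUnder_eq

theorem smoothAt_prodMk_left (x : M) (y : N) : SmoothAt (fun x => (x, y)) x :=
  (smoothAt_id x).prodMk (smoothAt_const y x)

theorem smoothAt_prodMk_right (x : M) (y : N) : SmoothAt (fun y => (x, y)) y :=
  (smoothAt_const x y).prodMk (smoothAt_id y)

/-- The differential of a map on a product is the sum of the partial differentials. -/
theorem mdiff_prod {f : M × N → L} {x : M} {y : N} {z : L} (hf : SmoothAt f (x, y))
    (hz : f (x, y) = z) (v : Tan x) (w : Tan y) :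
    mdiff f (x, y) z (v, w) = mdiff (fun x => f (x, y)) x z v + mdiff (fun y => f (x, y)) y z w := by
  have h1 : mdiff (fun x => f (x, y)) x z v = mdiff f (x, y) z (v, 0) := by
    rw [mdiff_comp (f := fun x => (x, y)) (y := (x, y)) hf (smoothAt_prodMk_left x y) rfl hz,
      mdiff_prodMk (smoothAt_id x) (smoothAt_const y x) rfl rfl, mdiff_id, mdiff_const]
  have h2 : mdiff (fun y => f (x, y)) y z w = mdiff f (x, y) z (0, w) := by
    rw [mdiff_comp (f := fun y => (x, y)) (y := (x, y)) hf (smoothAt_prodMk_right x y) rfl hz,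
      mdiff_prodMk (smoothAt_const x y) (smoothAt_id y) rfl rfl, mdiff_id, mdiff_const]
  rw [h1, h2, ← (mdiff_isLinearMap hf hz).map_add]
  congr 1
  exact Prod.ext (add_zero v).symm (zero_add w).symm

theorem chartVec_eq (a : M) (z v : Tan a) :
    chartVec a z v = mdiff (chart a).symm z ((chart a).symm z) v := rfl

/-- Every tangent vector near `a` has a coordinate expression in the chart at `a`. -/
theorem chartVec_mdiff_chart {a x : M} (hx : x ∈ (chart a).source) (v : Tan x) :
    mdiff (chart a).symm (chart a x) x (mdiff (chart a : M → Tan a) x (chart a x) v) = v := by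
  rw [← mdiff_comp (smoothAt_chart_symm ((chart a).map_source hx)) (smoothAt_chart hx)
    rfl ((chart a).left_inv hx)]
  rw [mdiff_congr (g := fun z => z), mdiff_id]
  filter_upwards [(chart a).open_source.mem_nhds hx] with y hy using (chart a).left_inv hy

/-- The tangent space at `x` is the model space of the chart at `x`, in which a vector is its own
coordinate expression. -/
theorem chartVec_self (x : M) (v : Tan x) :
    mdiff (chart x).symm (chart x x) x v = v := by
  have h := chartVec_mdiff_chart (SmoothManifold.mem_chart_source x) v
  have h2 : mdiff (chart x : M → Tan x) x (chart x x) v = v := by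
    refine HasDirDeriv.dirDeriv_eq ?_
    have h : HasDirDeriv (fun z : Tan x => z) (chart x x) v v := by
      refine tendsto_const_nhds.congr' ?_
      filter_upwards [self_mem_nhdsWithin] with t ht
      have ht : t ≠ 0 := ht
      simp [smul_smul, inv_mul_cancel₀ ht]
    refine h.congr_of_eventuallyEq ?_
    filter_upwards [(chart x).open_target.mem_nhds (chart_mem_target x)] with z hz
    exact ((chart x).right_inv hz).symm
  rwa [h2] at h

theorem mdiff_line {E : Type*} [AddCommGroup E] [Module ℝ E] [TopologicalSpace E]
    [IsTopologicalAddGroup E] [ContinuousSMul ℝ E] [LocallyConvexSpace ℝ E] [T2Space E]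
    (x v : E) (y : E) : mdiff (fun t : ℝ => x + t • v) 0 y (1 : ℝ) = v := by
  refine HasDirDeriv.dirDeriv_eq (f := fun t : ℝ => x + t • v) (x := (0 : ℝ)) (v := (1 : ℝ)) ?_
  refine tendsto_const_nhds.congr' ?_
  filter_upwards [self_mem_nhdsWithin] with t ht
  have ht : t ≠ 0 := ht
  simp [smul_smul, inv_mul_cancel₀ ht]

theorem smoothAt_line {E : Type*} [AddCommGroup E] [Module ℝ E] [TopologicalSpace E]
    [IsTopologicalAddGroup E] [ContinuousSMul ℝ E] [LocallyConvexSpace ℝ E] [T2Space E]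
    (x v : E) (t : ℝ) : SmoothAt (fun t : ℝ => x + t • v) t :=
  (smoothAt_const x t).add ((smoothAt_id t).smul (smoothAt_const v t))

/-- Every tangent vector is the velocity of a curve. -/
theorem exists_curve (x : M) (v : Tan x) :
    ∃ c : ℝ → M, SmoothAt c 0 ∧ c 0 = x ∧ mdiff c 0 x (1 : ℝ) = v := by
  refine ⟨fun t => (chart x).symm (chart x x + t • v), ?_, by simp [chart_symm_chart], ?_⟩
  · exact (smoothAt_chart_symm (chart_mem_target x)).comp_of_eq (smoothAt_line _ _ _) (by simp)
  · rw [mdiff_comp (y := chart x x) (smoothAt_chart_symm (chart_mem_target x)) (smoothAt_line _ _ _)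
      (by simp) (chart_symm_chart x), mdiff_line, chartVec_self]

end Mdiff

/-! ### Differential forms -/

section Forms

variable {L : Type*} [TopologicalSpace L] [SmoothManifold L]
variable {M : Type*} [TopologicalSpace M] [SmoothManifold M]
variable {N : Type*} [TopologicalSpace N] [SmoothManifold N]
variable {E : Type*} [AddCommGroup E] [Module ℝ E] [TopologicalSpace E] [IsTopologicalAddGroup E]
  [ContinuousSMul ℝ E] [LocallyConvexSpace ℝ E] [T2Space E]
variable {F : Type*} [AddCommGroup F] [Module ℝ F] [TopologicalSpace F] [IsTopologicalAddGroup F]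
  [ContinuousSMul ℝ F] [LocallyConvexSpace ℝ F] [T2Space F]

theorem isOpen_chart_target_prod (a : M) (E : Type*) [TopologicalSpace E] :
    IsOpen ((chart a).target ×ˢ (univ : Set E)) :=
  (chart a).open_target.prod isOpen_univ

/-- The derivative at time `0` of a smooth family of curves is smooth in the parameter. -/
theorem SmoothAt.velocity_family {h : L × ℝ → E} {l : L} (hh : SmoothAt h (l, 0)) :
    SmoothAt (fun l => mdiff (fun t : ℝ => h (l, t)) 0 (h (l, 0)) (1 : ℝ) : L → E) l := by
  obtain ⟨A, hA, hl, hs⟩ := hh.exists_mbSmoothOn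
  have hs : MBSmoothOn (fun z : Tan l × ℝ => h ((chart l).symm z.1, z.2)) A := hs
  set H : Tan l × ℝ → E := fun z => h ((chart l).symm z.1, z.2)
  -- The velocity at time `0` is the joint derivative of `H` at `(z, 0)` in the constant direction
  -- `(0, 1)`, hence smooth in `z`.
  let ι : Tan l → (Tan l × ℝ) × (Tan l × ℝ) := fun z => ((z, (0 : ℝ)), ((0 : Tan l), (1 : ℝ)))
  have hι : MBSmoothOn ι univ :=
    MBSmoothOn.prodMk (MBSmoothOn.clm (ContinuousLinearMap.inl ℝ (Tan l) ℝ) _) (MBSmoothOn.const _ _)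
  have hB : IsOpen {z : Tan l | (z, (0 : ℝ)) ∈ A} :=
    hA.preimage (continuous_id.prodMk continuous_const)
  have h1 : MBSmoothOn ((fun p : (Tan l × ℝ) × (Tan l × ℝ) => dirDeriv H p.1 p.2) ∘ ι)
      {z : Tan l | (z, (0 : ℝ)) ∈ A} :=
    (hs.dirDeriv hA).comp (hι.mono (subset_univ _)) (hA.prod isOpen_univ)
      fun z hz => ⟨hz, mem_univ _⟩
  have h2 : SmoothAt ((fun p : (Tan l × ℝ) × (Tan l × ℝ) => dirDeriv H p.1 p.2) ∘ ι) (chart l l) :=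
    (smoothOnOpen_iff_mbSmoothOn.2 ⟨hB, h1⟩).smoothAt hl
  have h3 := h2.comp (smoothAt_chart (SmoothManifold.mem_chart_source l))
  refine h3.congr ?_
  have h4 := ((chart l).continuousAt (SmoothManifold.mem_chart_source l)).eventually
    (hB.mem_nhds hl)
  filter_upwards [(chart l).open_source.mem_nhds (SmoothManifold.mem_chart_source l), h4] with l' hl' hA'
  have h5 := hs.hasDirDeriv hA hA' ((0 : Tan l), (1 : ℝ))
  have h6 : HasDirDeriv (fun t : ℝ => h (l', t)) 0 1 (dirDeriv H (chart l l', 0) (0, 1)) := by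
    refine Tendsto.congr (fun t => ?_) h5
    simp [H, (chart l).left_inv hl']
  exact h6.dirDeriv_eq.symm

/-- Tangent spaces depend on the point, and `(chart a).symm (chart a y) = y` does not hold by
definition; hence the generalisation to `y'` in the proof. -/
theorem IsForm1.apply_chart {α : ∀ y : N, Tan y → F} {a y : N}
    (hy : y ∈ (chart a).source) (v : Tan y) :
    α ((chart a).symm (chart a y)) (chartVec a (chart a y)
      (mdiff (chart a : N → Tan a) y (chart a y) v)) = α y v := by
  have key : ∀ y', y' = y → α y' (mdiff (chart a).symm (chart a y) y'
      (mdiff (chart a : N → Tan a) y (chart a y) v)) = α y v := by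
    rintro _ rfl
    rw [chartVec_mdiff_chart hy]
  exact key _ ((chart a).left_inv hy)

theorem IsForm2.apply_chart {β : ∀ y : N, Tan y → Tan y → ℝ} {a y : N}
    (hy : y ∈ (chart a).source) (v w : Tan y) :
    β ((chart a).symm (chart a y))
      (chartVec a (chart a y) (mdiff (chart a : N → Tan a) y (chart a y) v))
      (chartVec a (chart a y) (mdiff (chart a : N → Tan a) y (chart a y) w)) = β y v w := by
  have key : ∀ y', y' = y → β y'
      (mdiff (chart a).symm (chart a y) y' (mdiff (chart a : N → Tan a) y (chart a y) v))
      (mdiff (chart a).symm (chart a y) y' (mdiff (chart a : N → Tan a) y (chart a y) w))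
      = β y v w := by
    rintro _ rfl
    rw [chartVec_mdiff_chart hy, chartVec_mdiff_chart hy]
  exact key _ ((chart a).left_inv hy)

theorem SmoothAt.chart_velocity {c : L × ℝ → N} {l : L} (hc : SmoothAt c (l, 0)) {a : N}
    (ha : c (l, 0) ∈ (chart a).source) :
    SmoothAt (N := Tan a) (fun l' => mdiff (N := Tan a) (fun t : ℝ => chart a (c (l', t))) 0
      (chart a (c (l', 0))) (1 : ℝ)) l :=
  SmoothAt.velocity_family (E := Tan a) (h := fun p => chart a (c p)) ((smoothAt_chart ha).comp hc)

theorem form1_velocity_congr (α : ∀ y : N, Tan y → F) {c : ℝ → N} {y : N} (h : c 0 = y) :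
    α (c 0) (mdiff c 0 (c 0) (1 : ℝ)) = α y (mdiff c 0 y (1 : ℝ)) := by
  subst h
  rfl

theorem form2_velocity_congr (β : ∀ y : N, Tan y → Tan y → ℝ) {c d : ℝ → N} {y : N} (h : c 0 = y) :
    β (c 0) (mdiff c 0 (c 0) (1 : ℝ)) (mdiff d 0 (c 0) (1 : ℝ))
      = β y (mdiff c 0 y (1 : ℝ)) (mdiff d 0 y (1 : ℝ)) := by
  subst h
  rfl

theorem SmoothAt.eventually_curve {c : L × ℝ → N} {l : L} (hc : SmoothAt c (l, 0)) :
    ∀ᶠ l' in 𝓝 l, SmoothAt (fun t : ℝ => c (l', t)) 0 := by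
  have h : Tendsto (fun l' => (l', (0 : ℝ))) (𝓝 l) (𝓝 (l, 0)) :=
    (Continuous.prodMk_left (0 : ℝ)).tendsto l
  filter_upwards [h.eventually hc.eventually] with l' hl'
  exact SmoothAt.comp (f := fun t : ℝ => (l', t)) hl' (smoothAt_prodMk_right _ _)

theorem SmoothAt.curve_start {c : L × ℝ → N} {l : L} (hc : SmoothAt c (l, 0)) :
    SmoothAt (fun l => c (l, 0)) l :=
  SmoothAt.comp (f := fun l => (l, (0 : ℝ))) hc (smoothAt_prodMk_left _ _)

/-- The evaluation of a 1-form on the velocities of a smooth family of curves is smooth. -/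
theorem IsForm1.smoothAt_velocity {α : ∀ y : N, Tan y → F} (hα : IsForm1 α) {c : L × ℝ → N} {l : L}
    (hc : SmoothAt c (l, 0)) :
    SmoothAt (fun l => α (c (l, 0)) (mdiff (fun t : ℝ => c (l, t)) 0 (c (l, 0)) (1 : ℝ)) : L → F)
      l := by
  set a := c (l, 0)
  have h0 : SmoothAt (fun l => c (l, 0)) l := hc.curve_start
  have ha : a ∈ (chart a).source := SmoothManifold.mem_chart_source a
  have h1 : SmoothAt (fun l => chart a (c (l, 0))) l :=
    SmoothAt.comp (f := fun l => c (l, 0)) (smoothAt_chart ha) h0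
  have h2 := (smoothOnOpen_prod_iff_mbSmoothOn.2
    ⟨isOpen_chart_target_prod a (Tan a), hα.2 a⟩).smoothAt
    (show ((chart a a, mdiff (fun t : ℝ => chart a (c (l, t))) 0 (chart a a) (1 : ℝ)) : Tan a × Tan a)
      ∈ (chart a).target ×ˢ univ from ⟨chart_mem_target a, mem_univ _⟩)
  refine (SmoothAt.comp (f := fun l' => ((chart a (c (l', 0)), mdiff (fun t : ℝ => chart a (c (l', t))) 0
    (chart a (c (l', 0))) (1 : ℝ)) : Tan a × Tan a)) h2 (h1.prodMk (hc.chart_velocity ha))).congr ?_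
  filter_upwards [h0.continuousAt.eventually ((chart a).open_source.mem_nhds ha),
    hc.eventually_curve] with l' hl' hl''
  rw [← IsForm1.apply_chart (α := α) hl', ← mdiff_comp (smoothAt_chart hl') hl'' rfl rfl]

/-- The evaluation of a 2-form on the velocities of smooth families of curves is smooth. -/
theorem IsForm2.smoothAt_velocity {β : ∀ y : N, Tan y → Tan y → ℝ} (hβ : IsForm2 β)
    {c d : L × ℝ → N} {l : L} (hc : SmoothAt c (l, 0)) (hd : SmoothAt d (l, 0))
    (hcd : ∀ l, d (l, 0) = c (l, 0)) :
    SmoothAt (fun l => β (c (l, 0)) (mdiff (fun t : ℝ => c (l, t)) 0 (c (l, 0)) (1 : ℝ))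
      (mdiff (fun t : ℝ => d (l, t)) 0 (c (l, 0)) (1 : ℝ))) l := by
  set a := c (l, 0)
  have h0 : SmoothAt (fun l => c (l, 0)) l := hc.curve_start
  have ha : a ∈ (chart a).source := SmoothManifold.mem_chart_source a
  have h1 : SmoothAt (fun l => chart a (c (l, 0))) l :=
    SmoothAt.comp (f := fun l => c (l, 0)) (smoothAt_chart ha) h0
  have h2 := (smoothOnOpen_prod₃_iff_mbSmoothOn.2
    ⟨isOpen_chart_target_prod a (Tan a × Tan a), hβ.2.2.2 a⟩).smoothAt
    (show ((chart a a, mdiff (fun t : ℝ => chart a (c (l, t))) 0 (chart a a) (1 : ℝ),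
      mdiff (fun t : ℝ => chart a (d (l, t))) 0 (chart a (d (l, 0))) (1 : ℝ)) : Tan a × Tan a × Tan a)
      ∈ (chart a).target ×ˢ univ from ⟨chart_mem_target a, mem_univ _⟩)
  refine (SmoothAt.comp (f := fun l' => ((chart a (c (l', 0)), mdiff (fun t : ℝ => chart a (c (l', t))) 0
    (chart a (c (l', 0))) (1 : ℝ), mdiff (fun t : ℝ => chart a (d (l', t))) 0
    (chart a (d (l', 0))) (1 : ℝ)) : Tan a × Tan a × Tan a)) h2 (h1.prodMk
    ((hc.chart_velocity ha).prodMk (hd.chart_velocity (by rw [hcd l]; exact ha))))).congr ?_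
  filter_upwards [h0.continuousAt.eventually ((chart a).open_source.mem_nhds ha),
    hc.eventually_curve, hd.eventually_curve] with l' hl' hl'' hld
  rw [← IsForm2.apply_chart (β := β) hl', ← mdiff_comp (smoothAt_chart hl') hl'' rfl rfl,
    ← mdiff_comp (smoothAt_chart hl') hld (hcd l') rfl]
  rfl

theorem smoothAt_add_smul (z v : E) : SmoothAt (fun p : (E × E) × ℝ => p.1.1 + p.2 • p.1.2)
    ((z, v), (0 : ℝ)) :=
  (smoothAt_id _).fst.fst.add ((smoothAt_id _).snd.smul (smoothAt_id _).fst.snd)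

/-- A vector given in coordinates is the velocity of a straight line in the chart. This brings the
smoothness conditions of `IsForm1` and `IsForm2` within reach of the `smoothAt_velocity` lemmas. -/
theorem mdiff_chart_symm_line {f : M → N} {a : M} {z v : Tan a} (hz : z ∈ (chart a).target)
    (hf : SmoothAt f ((chart a).symm z)) (y : N) (hy : f ((chart a).symm z) = y) :
    mdiff (fun t : ℝ => f ((chart a).symm (z + t • v))) 0 y (1 : ℝ)
      = mdiff f ((chart a).symm z) y (chartVec a z v) := by
  have h1 : SmoothAt (fun z => f ((chart a).symm z)) z := hf.comp (smoothAt_chart_symm hz)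
  rw [mdiff_comp (g := fun z => f ((chart a).symm z)) (y := z) h1 (smoothAt_line z v 0) (by simp) hy,
    mdiff_line, mdiff_comp hf (smoothAt_chart_symm hz) rfl hy, chartVec_eq]

/-- A 1-form that is locally the pull-back of a smooth form along a smooth map is smooth. -/
theorem isForm1_of_eventually_eq_pull1 {α : ∀ y : N, Tan y → F} (hα : IsForm1 α)
    {α' : ∀ x : M, Tan x → F}
    (h : ∀ x, ∃ f : M → N, SmoothAt f x ∧ ∀ᶠ x' in 𝓝 x, ∀ v, α' x' v = pull1 f α x' v) :
    IsForm1 α' := by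
  constructor
  · intro x
    obtain ⟨f, hf, hα'⟩ := h x
    rw [show α' x = pull1 f α x from funext hα'.self_of_nhds]
    exact ((hα.1 (f x)).mk'.comp (mdiff_isLinearMap hf rfl).mk').isLinear
  · intro a
    refine (smoothOnOpen_prod_iff_mbSmoothOn.1 (smoothOnOpen_iff.2
      ⟨isOpen_chart_target_prod a (Tan a), ?_⟩)).2
    rintro ⟨z, v⟩ ⟨hz, -⟩
    obtain ⟨f, hf, hα'⟩ := h ((chart a).symm z)
    have hc : SmoothAt (fun p : (Tan a × Tan a) × ℝ => f ((chart a).symm (p.1.1 + p.2 • p.1.2)))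
        ((z, v), (0 : ℝ)) := by
      refine SmoothAt.comp_of_eq (y := z) (g := fun z => f ((chart a).symm z))
        (hf.comp (smoothAt_chart_symm hz)) (smoothAt_add_smul z v) (by simp)
    refine (hα.smoothAt_velocity hc).congr ?_
    have h1 : Tendsto (fun p : Tan a × Tan a => (chart a).symm p.1) (𝓝 (z, v))
        (𝓝 ((chart a).symm z)) :=
      ((chart a).continuousAt_symm hz).tendsto.comp (continuous_fst.tendsto (z, v))
    filter_upwards [h1.eventually hα', h1.eventually hf.eventually,
      (isOpen_chart_target_prod a (Tan a)).mem_nhds (show (z, v) ∈ _ from ⟨hz, mem_univ _⟩)]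
      with p hp hp' hpt
    refine (form1_velocity_congr α (c := fun t => f ((chart a).symm (p.1 + t • p.2)))
      (y := f ((chart a).symm p.1)) (by simp)).trans ?_
    rw [hp, pull1, mdiff_chart_symm_line hpt.1 hp' _ rfl]

theorem IsForm1.pull1 {α : ∀ y : N, Tan y → F} (hα : IsForm1 α) {f : M → N} (hf : SmoothMap f) :
    IsForm1 (pull1 f α) :=
  isForm1_of_eventually_eq_pull1 hα fun x =>
    ⟨f, hf.smoothAt x, Eventually.of_forall fun _ _ => rfl⟩

/-- A 2-form that is locally the pull-back of a smooth form along a smooth map is smooth. -/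
theorem isForm2_of_eventually_eq_pull2 {β : ∀ y : N, Tan y → Tan y → ℝ} (hβ : IsForm2 β)
    {β' : ∀ x : M, Tan x → Tan x → ℝ}
    (h : ∀ x, ∃ f : M → N, SmoothAt f x ∧ ∀ᶠ x' in 𝓝 x, ∀ v w, β' x' v w = pull2 f β x' v w) :
    IsForm2 β' := by
  refine ⟨fun x v => ?_, fun x w => ?_, fun x v => ?_, fun a => ?_⟩
  · obtain ⟨f, hf, hβ'⟩ := h x
    rw [show β' x v = pull2 f β x v from funext (hβ'.self_of_nhds v)]
    exact ((hβ.1 (f x) _).mk'.comp (mdiff_isLinearMap hf rfl).mk').isLinear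
  · obtain ⟨f, hf, hβ'⟩ := h x
    rw [show (fun v => β' x v w) = fun v => pull2 f β x v w from
      funext fun v => hβ'.self_of_nhds v w]
    exact ((hβ.2.1 (f x) _).mk'.comp (mdiff_isLinearMap hf rfl).mk').isLinear
  · obtain ⟨f, hf, hβ'⟩ := h x
    rw [hβ'.self_of_nhds]
    exact hβ.2.2.1 _ _
  · refine (smoothOnOpen_prod₃_iff_mbSmoothOn.1 (smoothOnOpen_iff.2
      ⟨isOpen_chart_target_prod a (Tan a × Tan a), ?_⟩)).2
    rintro ⟨z, v, w⟩ ⟨hz, -⟩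
    obtain ⟨f, hf, hβ'⟩ := h ((chart a).symm z)
    have hφ : SmoothAt (fun z => f ((chart a).symm z)) z := hf.comp (smoothAt_chart_symm hz)
    have hc : SmoothAt (fun p : (Tan a × Tan a × Tan a) × ℝ =>
        f ((chart a).symm (p.1.1 + p.2 • p.1.2.1))) ((z, v, w), (0 : ℝ)) :=
      SmoothAt.comp_of_eq (y := z) (g := fun z => f ((chart a).symm z)) hφ
        ((smoothAt_id _).fst.fst.add ((smoothAt_id _).snd.smul (smoothAt_id _).fst.snd.fst)) (by simp)
    have hd : SmoothAt (fun p : (Tan a × Tan a × Tan a) × ℝ =>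
        f ((chart a).symm (p.1.1 + p.2 • p.1.2.2))) ((z, v, w), (0 : ℝ)) :=
      SmoothAt.comp_of_eq (y := z) (g := fun z => f ((chart a).symm z)) hφ
        ((smoothAt_id _).fst.fst.add ((smoothAt_id _).snd.smul (smoothAt_id _).fst.snd.snd)) (by simp)
    refine (hβ.smoothAt_velocity hc hd (fun _ => by simp)).congr ?_
    have h1 : Tendsto (fun p : Tan a × Tan a × Tan a => (chart a).symm p.1) (𝓝 (z, v, w))
        (𝓝 ((chart a).symm z)) :=
      ((chart a).continuousAt_symm hz).tendsto.comp (continuous_fst.tendsto (z, v, w))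
    filter_upwards [h1.eventually hβ', h1.eventually hf.eventually,
      (isOpen_chart_target_prod a (Tan a × Tan a)).mem_nhds
        (show (z, v, w) ∈ _ from ⟨hz, mem_univ _⟩)] with p hp hp' hpt
    refine (form2_velocity_congr β (c := fun t => f ((chart a).symm (p.1 + t • p.2.1)))
      (d := fun t => f ((chart a).symm (p.1 + t • p.2.2)))
      (y := f ((chart a).symm p.1)) (by simp)).trans ?_
    rw [hp, pull2, mdiff_chart_symm_line hpt.1 hp' _ rfl, mdiff_chart_symm_line hpt.1 hp' _ rfl]

theorem IsForm2.pull2 {β : ∀ y : N, Tan y → Tan y → ℝ} (hβ : IsForm2 β) {f : M → N}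
    (hf : SmoothMap f) : IsForm2 (pull2 f β) :=
  isForm2_of_eventually_eq_pull2 hβ fun x =>
    ⟨f, hf.smoothAt x, Eventually.of_forall fun _ _ _ => rfl⟩

theorem MBSmoothOn.add {f g : E → F} {U : Set E} (hf : MBSmoothOn f U) (hg : MBSmoothOn g U) :
    MBSmoothOn (fun x => f x + g x) U :=
  MBSmoothOn.comp (MBSmoothOn.clm (ContinuousLinearMap.fst ℝ F F + ContinuousLinearMap.snd ℝ F F)
    univ) (hf.prodMk hg) isOpen_univ (mapsTo_univ _ _)

theorem MBSmoothOn.sub {f g : E → F} {U : Set E} (hf : MBSmoothOn f U) (hg : MBSmoothOn g U) :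
    MBSmoothOn (fun x => f x - g x) U :=
  MBSmoothOn.comp (MBSmoothOn.clm (ContinuousLinearMap.fst ℝ F F - ContinuousLinearMap.snd ℝ F F)
    univ) (hf.prodMk hg) isOpen_univ (mapsTo_univ _ _)

theorem IsForm1.add {α β : ∀ x : M, Tan x → F} (hα : IsForm1 α) (hβ : IsForm1 β) :
    IsForm1 (fun x v => α x v + β x v) :=
  ⟨fun x => ((hα.1 x).mk' + (hβ.1 x).mk').isLinear, fun a => (hα.2 a).add (hβ.2 a)⟩

theorem IsForm1.sub {α β : ∀ x : M, Tan x → F} (hα : IsForm1 α) (hβ : IsForm1 β) :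
    IsForm1 (fun x v => α x v - β x v) :=
  ⟨fun x => ((hα.1 x).mk' - (hβ.1 x).mk').isLinear, fun a => (hα.2 a).sub (hβ.2 a)⟩

theorem IsForm2.sub {α β : ∀ x : M, Tan x → Tan x → ℝ} (hα : IsForm2 α) (hβ : IsForm2 β) :
    IsForm2 (fun x v w => α x v w - β x v w) :=
  ⟨fun x v => ((hα.1 x v).mk' - (hβ.1 x v).mk').isLinear,
    fun x w => ((hα.2.1 x w).mk' - (hβ.2.1 x w).mk').isLinear,
    fun x v => by simp [hα.2.2.1, hβ.2.2.1], fun a => (hα.2.2.2 a).sub (hβ.2.2.2 a)⟩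

/-! ### The exterior derivative -/

/-- A 1-form in the coordinates of the chart at `a`. -/
def coordForm (α : ∀ x : M, Tan x → ℝ) (a : M) (p : Tan a × Tan a) : ℝ :=
  α ((chart a).symm p.1) (chartVec a p.1 p.2)

theorem IsForm1.coordForm_smooth {α : ∀ x : M, Tan x → ℝ} (hα : IsForm1 α) (a : M) :
    MBSmoothOn (coordForm α a) ((chart a).target ×ˢ univ) := hα.2 a

theorem IsForm1.coordForm_linear {α : ∀ x : M, Tan x → ℝ} (hα : IsForm1 α) {a : M} {z : Tan a}
    (hz : z ∈ (chart a).target) : IsLinearMap ℝ fun v => coordForm α a (z, v) :=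
  ((hα.1 _).mk'.comp (mdiff_isLinearMap (smoothAt_chart_symm hz) rfl).mk').isLinear

theorem IsForm1.coordForm_hasDirDeriv {α : ∀ x : M, Tan x → ℝ} (hα : IsForm1 α) {a : M} {z : Tan a}
    (hz : z ∈ (chart a).target) (v w : Tan a) :
    HasDirDeriv (fun z => coordForm α a (z, w)) z v (dirDeriv (coordForm α a) (z, w) (v, 0)) := by
  have h := (hα.coordForm_smooth a).hasDirDeriv (isOpen_chart_target_prod a (Tan a))
    (show (z, w) ∈ (chart a).target ×ˢ univ from ⟨hz, mem_univ _⟩) (v, 0)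
  refine Tendsto.congr (fun t => ?_) h
  simp

/-- A coordinate form is linear in its second argument and hence is its own derivative there. -/
theorem IsForm1.dirDeriv_coordForm {α : ∀ x : M, Tan x → ℝ} (hα : IsForm1 α) {a : M} {z : Tan a}
    (hz : z ∈ (chart a).target) (w v s : Tan a) :
    dirDeriv (coordForm α a) (z, w) (v, s)
      = dirDeriv (fun z => coordForm α a (z, w)) z v + coordForm α a (z, s) := by
  have hlin := (hα.coordForm_smooth a).isLinearMap_dirDeriv (isOpen_chart_target_prod a (Tan a))
    (show (z, w) ∈ (chart a).target ×ˢ univ from ⟨hz, mem_univ _⟩)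
  have h1 : ((v, s) : Tan a × Tan a) = (v, 0) + (0, s) := by simp
  rw [h1, hlin.map_add, (hα.coordForm_hasDirDeriv hz v w).dirDeriv_eq]
  congr 1
  refine HasDirDeriv.dirDeriv_eq (tendsto_const_nhds.congr' ?_)
  filter_upwards [self_mem_nhdsWithin] with t ht
  have ht : t ≠ 0 := ht
  have h2 := (hα.coordForm_linear hz).map_add w (t • s)
  have h3 := (hα.coordForm_linear hz).map_smul t s
  simp only [Prod.mk_add_mk, Prod.smul_mk, smul_zero, add_zero]
  rw [h2, h3, add_sub_cancel_left, inv_smul_smul₀ ht]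

theorem dForm_eq (α : ∀ x : M, Tan x → ℝ) (x : M) (v w : Tan x) :
    dForm α x v w = dirDeriv (fun z => coordForm α x (z, w)) (chart x x) v
      - dirDeriv (fun z => coordForm α x (z, v)) (chart x x) w := rfl

/-- The exterior derivative in terms of an arbitrary smooth map `φ` from a locally convex space. -/
theorem IsForm1.dForm_mdiff {α : ∀ x : M, Tan x → ℝ} (hα : IsForm1 α) {φ : E → M} {z : E} {x : M}
    (hφ : SmoothAt φ z) (hx : φ z = x) (v w : E) :
    dForm α x (mdiff φ z x v) (mdiff φ z x w)
      = dirDeriv (fun z => α (φ z) (mdiff φ z (φ z) w)) z v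
        - dirDeriv (fun z => α (φ z) (mdiff φ z (φ z) v)) z w := by
  subst hx
  obtain ⟨A, hA, hz, hs⟩ := hφ.exists_mbSmoothOn
  set a := φ z
  have hs : MBSmoothOn (fun z => chart a (φ z)) A := hs
  have hz : z ∈ A := hz
  -- Product rule: the second term involves the second derivative of `φ`, is symmetric in `v` and
  -- `w` by `dirDeriv_comm`, and cancels in the alternating difference.
  have key : ∀ v w : E, dirDeriv (fun z => α (φ z) (mdiff φ z (φ z) w)) z v
      = dirDeriv (fun ζ => coordForm α a (ζ, mdiff φ z a w)) (chart a a) (mdiff φ z a v)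
        + coordForm α a (chart a a,
          dirDeriv (fun z => dirDeriv (fun z => chart a (φ z)) z w) z v) := by
    intro v w
    have hsw : MBSmoothOn (fun y => dirDeriv (fun z => chart a (φ z)) y w) A :=
      MBSmoothOn.comp (hs.dirDeriv hA) (g := fun y => (y, w))
        (MBSmoothOn.prodMk (MBSmoothOn.clm (ContinuousLinearMap.id ℝ E) A) (MBSmoothOn.const w A))
        (hA.prod isOpen_univ) fun y hy => ⟨hy, mem_univ _⟩
    have h1 : HasDirDeriv (fun z => (chart a (φ z), dirDeriv (fun z => chart a (φ z)) z w)) z v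
        (mdiff φ z a v, dirDeriv (fun z => dirDeriv (fun z => chart a (φ z)) z w) z v) :=
      Tendsto.prodMk_nhds (hs.hasDirDeriv hA hz v) (hsw.hasDirDeriv hA hz v)
    have h2 := (hα.coordForm_smooth a).hasDirDeriv_comp (isOpen_chart_target_prod a (Tan a)) h1
      ⟨chart_mem_target a, mem_univ _⟩
    rw [hα.dirDeriv_coordForm (chart_mem_target a)] at h2
    refine (h2.congr_of_eventuallyEq ?_).dirDeriv_eq
    filter_upwards [hφ.eventually, hφ.continuousAt.eventually ((chart a).open_source.mem_nhds
      (SmoothManifold.mem_chart_source a))] with y hy hy'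
    rw [← IsForm1.apply_chart (α := α) hy', ← mdiff_comp (smoothAt_chart hy') hy rfl rfl]
    rfl
  rw [dForm_eq, key v w, key w v, hs.dirDeriv_comm hA hz v w]
  ring

/-- The exterior derivative commutes with pull-backs. -/
theorem IsForm1.dForm_of_eventually_eq_pull1 {α : ∀ y : N, Tan y → ℝ} (hα : IsForm1 α) {f : M → N}
    {x : M} {y : N} (hf : SmoothAt f x) (hy : f x = y) {α' : ∀ x : M, Tan x → ℝ}
    (hα' : ∀ᶠ x' in 𝓝 x, ∀ v, α' x' v = _root_.pull1 f α x' v) (v w : Tan x) :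
    dForm α' x v w = dForm α y (mdiff f x y v) (mdiff f x y w) := by
  have hs := smoothAt_chart_symm (chart_mem_target x)
  have hφ : SmoothAt (fun z => f ((chart x).symm z)) (chart x x) :=
    SmoothAt.comp_of_eq hf hs (chart_symm_chart x)
  have h1 : ∀ v, mdiff f x y v = mdiff (fun z => f ((chart x).symm z)) (chart x x) y v := by
    intro v
    rw [mdiff_comp hf hs (chart_symm_chart x) hy, chartVec_self]
  have h2 : ∀ w : Tan x, (fun z => coordForm α' x (z, w)) =ᶠ[𝓝 (chart x x)] fun z =>
      α (f ((chart x).symm z)) (mdiff (fun z => f ((chart x).symm z)) z (f ((chart x).symm z)) w) := by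
    intro w
    filter_upwards [(tendsto_chart_symm x).eventually hα', (tendsto_chart_symm x).eventually
      hf.eventually, (chart x).open_target.mem_nhds (chart_mem_target x)] with z hz hz' hzt
    rw [coordForm, hz, _root_.pull1, mdiff_comp hz' (smoothAt_chart_symm hzt) rfl rfl]
    rfl
  rw [h1, h1, hα.dForm_mdiff hφ (by rw [chart_symm_chart, hy]), dForm_eq, dirDeriv_congr _ (h2 w),
    dirDeriv_congr _ (h2 v)]

theorem IsForm1.dForm_pull1 {α : ∀ y : N, Tan y → ℝ} (hα : IsForm1 α) {f : M → N}
    (hf : SmoothMap f) (x : M) (v w : Tan x) :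
    dForm (_root_.pull1 f α) x v w = pull2 f (dForm α) x v w :=
  hα.dForm_of_eventually_eq_pull1 (hf.smoothAt x) rfl (Eventually.of_forall fun _ _ => rfl) v w

theorem IsForm1.dForm_sub {α β : ∀ x : M, Tan x → ℝ} (hα : IsForm1 α) (hβ : IsForm1 β) (x : M)
    (v w : Tan x) : dForm (fun x v => α x v - β x v) x v w = dForm α x v w - dForm β x v w := by
  have key : ∀ v w : Tan x, dirDeriv (fun z => coordForm (fun x v => α x v - β x v) x (z, w))
      (chart x x) v = dirDeriv (fun z => coordForm α x (z, w)) (chart x x) v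
        - dirDeriv (fun z => coordForm β x (z, w)) (chart x x) v := by
    intro v w
    have h1 := hα.coordForm_hasDirDeriv (chart_mem_target x) v w
    have h2 := hβ.coordForm_hasDirDeriv (chart_mem_target x) v w
    rw [h1.dirDeriv_eq, h2.dirDeriv_eq]
    refine HasDirDeriv.dirDeriv_eq (Tendsto.congr (fun t => ?_) (Tendsto.sub h1 h2))
    simp only [coordForm, smul_eq_mul]
    ring
  rw [dForm_eq, dForm_eq, dForm_eq, key, key]
  ring

theorem IsForm1.dForm_add {α β : ∀ x : M, Tan x → ℝ} (hα : IsForm1 α) (hβ : IsForm1 β) (x : M)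
    (v w : Tan x) : dForm (fun x v => α x v + β x v) x v w = dForm α x v w + dForm β x v w := by
  have h := (hα.add hβ).dForm_sub hβ x v w
  simp only [add_sub_cancel_right] at h
  linarith

/-- The definition of `dForm` uses a different chart at every point. Smoothness becomes visible
after `dForm_mdiff` with `φ = (chart a).symm`, which expresses `dα` on a whole chart domain in the
one chart at `a`. -/
theorem IsForm1.isForm2_dForm {α : ∀ x : M, Tan x → ℝ} (hα : IsForm1 α) : IsForm2 (dForm α) := by
  have hl1 : ∀ (x : M) (w : Tan x),
      IsLinearMap ℝ (dirDeriv (fun z => coordForm α x (z, w)) (chart x x)) := by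
    intro x w
    have h : MBSmoothOn (fun z => coordForm α x (z, w)) (chart x).target :=
      MBSmoothOn.comp (hα.coordForm_smooth x) (g := fun z => (z, w))
        (MBSmoothOn.prodMk (MBSmoothOn.clm (ContinuousLinearMap.id ℝ (Tan x)) _)
          (MBSmoothOn.const w _)) (isOpen_chart_target_prod x (Tan x)) fun y hy => ⟨hy, mem_univ _⟩
    exact h.isLinearMap_dirDeriv (chart x).open_target (chart_mem_target x)
  have hl2 : ∀ (x : M) (v : Tan x),
      IsLinearMap ℝ (fun w => dirDeriv (fun z => coordForm α x (z, w)) (chart x x) v) := by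
    intro x v
    have hnear : ∀ᶠ z in 𝓝 (chart x x), z ∈ (chart x).target :=
      (chart x).open_target.mem_nhds (chart_mem_target x)
    constructor
    · intro w w'
      have h1 := hα.coordForm_hasDirDeriv (chart_mem_target x) v w
      have h2 := hα.coordForm_hasDirDeriv (chart_mem_target x) v w'
      rw [h1.dirDeriv_eq, h2.dirDeriv_eq]
      have h3 : HasDirDeriv (fun z => coordForm α x (z, w) + coordForm α x (z, w')) (chart x x) v _ :=
        Tendsto.congr (fun t => by simp only [smul_eq_mul]; ring) (Tendsto.add h1 h2)
      refine (h3.congr_of_eventuallyEq ?_).dirDeriv_eq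
      filter_upwards [hnear] with z hz using ((hα.coordForm_linear hz).map_add w w').symm
    · intro r w
      have h1 := hα.coordForm_hasDirDeriv (chart_mem_target x) v w
      rw [h1.dirDeriv_eq]
      refine ((h1.clm_comp (r • ContinuousLinearMap.id ℝ ℝ)).congr_of_eventuallyEq ?_).dirDeriv_eq
      filter_upwards [hnear] with z hz using ((hα.coordForm_linear hz).map_smul r w).symm
  refine ⟨fun x v => ((hl2 x v).mk' - (hl1 x v).mk').isLinear,
    fun x w => ((hl1 x w).mk' - (hl2 x w).mk').isLinear, fun x v => sub_self _, fun a => ?_⟩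
  have hsm : ∀ P : (Tan a × Tan a × Tan a) →L[ℝ] (Tan a × Tan a) × (Tan a × Tan a),
      (∀ p, (P p).1.1 = p.1) → MBSmoothOn (fun p => dirDeriv (coordForm α a) (P p).1 (P p).2)
      ((chart a).target ×ˢ univ) := fun P hP =>
    MBSmoothOn.comp ((hα.coordForm_smooth a).dirDeriv (isOpen_chart_target_prod a (Tan a)))
      (MBSmoothOn.clm P _) ((isOpen_chart_target_prod a (Tan a)).prod isOpen_univ)
      fun p hp => ⟨⟨by rw [hP]; exact hp.1, mem_univ _⟩, mem_univ _⟩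
  let p1 := ContinuousLinearMap.fst ℝ (Tan a) (Tan a × Tan a)
  let p2 := (ContinuousLinearMap.fst ℝ (Tan a) (Tan a)).comp
    (ContinuousLinearMap.snd ℝ (Tan a) (Tan a × Tan a))
  let p3 := (ContinuousLinearMap.snd ℝ (Tan a) (Tan a)).comp
    (ContinuousLinearMap.snd ℝ (Tan a) (Tan a × Tan a))
  have h1 := hsm ((p1.prod p3).prod (p2.prod 0)) fun _ => rfl
  have h2 := hsm ((p1.prod p2).prod (p3.prod 0)) fun _ => rfl
  refine (h1.sub h2).congrOn (isOpen_chart_target_prod a (Tan a × Tan a)) ?_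
  rintro ⟨z, v, w⟩ ⟨hz, -⟩
  have hd := hα.dForm_mdiff (smoothAt_chart_symm hz) rfl v w
  refine Eq.trans ?_ hd.symm
  change dirDeriv (coordForm α a) (z, w) (v, 0) - dirDeriv (coordForm α a) (z, v) (w, 0) = _
  congr 1
  · exact (hα.coordForm_hasDirDeriv hz v w).dirDeriv_eq.symm
  · exact (hα.coordForm_hasDirDeriv hz w v).dirDeriv_eq.symm

end Forms

/-! ### Pull-backs along local maps -/

section PullBack

variable {L : Type*} [TopologicalSpace L] [SmoothManifold L]
variable {M : Type*} [TopologicalSpace M] [SmoothManifold M]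
variable {N : Type*} [TopologicalSpace N] [SmoothManifold N]
variable {F : Type*} [AddCommGroup F] [Module ℝ F] [TopologicalSpace F]

theorem pull1_congr {f g : M → N} {x : M} (h : f =ᶠ[𝓝 x] g) (α : ∀ y : N, Tan y → F) (v : Tan x) :
    pull1 f α x v = pull1 g α x v := by
  have hx := h.eq_of_nhds
  unfold pull1
  simp only [mdiff_congr h]
  generalize f x = y at hx
  subst hx
  rfl

theorem pull2_congr {f g : M → N} {x : M} (h : f =ᶠ[𝓝 x] g) (β : ∀ y : N, Tan y → Tan y → ℝ)
    (v w : Tan x) : pull2 f β x v w = pull2 g β x v w := by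
  have hx := h.eq_of_nhds
  unfold pull2
  simp only [mdiff_congr h]
  generalize f x = y at hx
  subst hx
  rfl

theorem pull1_comp {f : L → M} {g : M → N} {x : L} (hf : SmoothAt f x) (hg : SmoothAt g (f x))
    (α : ∀ y : N, Tan y → F) (v : Tan x) :
    pull1 (fun x => g (f x)) α x v = pull1 f (pull1 g α) x v := by
  simp only [pull1]
  rw [mdiff_comp hg hf rfl rfl]

theorem pull2_comp {f : L → M} {g : M → N} {x : L} (hf : SmoothAt f x) (hg : SmoothAt g (f x))
    (β : ∀ y : N, Tan y → Tan y → ℝ) (v w : Tan x) :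
    pull2 (fun x => g (f x)) β x v w = pull2 f (pull2 g β) x v w := by
  simp only [pull2]
  rw [mdiff_comp hg hf rfl rfl, mdiff_comp hg hf rfl rfl]

theorem pull1_id (α : ∀ y : N, Tan y → F) (x : N) (v : Tan x) :
    pull1 (fun x => x) α x v = α x v := by
  rw [pull1, mdiff_id]

theorem pull2_id (β : ∀ y : N, Tan y → Tan y → ℝ) (x : N) (v w : Tan x) :
    pull2 (fun x => x) β x v w = β x v w := by
  rw [pull2, mdiff_id, mdiff_id]

theorem pull1_const {α : ∀ y : N, Tan y → F} (hα : ∀ y, IsLinearMap ℝ (α y)) (y : N) (x : M)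
    (v : Tan x) : pull1 (fun _ => y) α x v = 0 := by
  rw [pull1, mdiff_const, (hα y).map_zero]

end PullBack

/-! ### Smooth actions -/

section Actions

variable {G : Type u} [Group G] [TopologicalSpace G] [SmoothManifold G] [IsLieGroup G]
variable {M : Type v} [TopologicalSpace M] [SmoothManifold M] [MulAction G M] [IsSmoothAction G M]
variable {L : Type*} [TopologicalSpace L] [SmoothManifold L]

theorem SmoothAt.mul {f g : L → G} {l : L} (hf : SmoothAt f l) (hg : SmoothAt g l) :
    SmoothAt (fun l => f l * g l) l :=
  (IsLieGroup.smooth_mul (G := G)).comp_smoothAt (hf.prodMk hg)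

theorem SmoothAt.inv {f : L → G} {l : L} (hf : SmoothAt f l) : SmoothAt (fun l => (f l)⁻¹) l :=
  (IsLieGroup.smooth_inv (G := G)).comp_smoothAt hf

omit [IsLieGroup G] in
theorem SmoothAt.act {f : L → G} {g : L → M} {l : L} (hf : SmoothAt f l) (hg : SmoothAt g l) :
    SmoothAt (fun l => f l • g l) l :=
  (IsSmoothAction.smooth_smul (G := G) (M := M)).comp_smoothAt (hf.prodMk hg)

omit [IsLieGroup G] in
theorem SmoothAtW.act {f : L → G} {g : L → M} {l : L} {S : Set L} (hf : SmoothAtW f S l)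
    (hg : SmoothAtW g S l) : SmoothAtW (fun l => f l • g l) S l :=
  (IsSmoothAction.smooth_smul (G := G) (M := M)).comp_smoothAtW (hf.prodMk hg)

omit [IsLieGroup G] in
theorem smoothMap_const_smul (g : G) : SmoothMap (fun x : M => g • x) :=
  smoothMap_iff.2 fun x => (smoothAt_const g x).act (smoothAt_id x)

/-- The differential of a product `γ • ψ`. -/
theorem exists_mdiff_act {γ : L → G} {ψ : L → M} {l : L} (hγ : SmoothAt γ l) (hψ : SmoothAt ψ l)
    (v : Tan l) : ∃ X : Tan (1 : G), mdiff (fun l => γ l • ψ l) l (γ l • ψ l) v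
        = mdiff (fun x : M => γ l • x) (ψ l) (γ l • ψ l) (infAct X (ψ l) + mdiff ψ l (ψ l) v) := by
  -- Split off the constant factor `γ l`: the remaining factor takes the value `1` at `l`, so its
  -- derivative there lies in the Lie algebra.
  have hγ' : SmoothAt (fun l' => (γ l)⁻¹ * γ l') l := (smoothAt_const _ l).mul hγ
  refine ⟨mdiff (fun l' => (γ l)⁻¹ * γ l') l 1 v, ?_⟩
  have h1 : mdiff (fun l' => ((γ l)⁻¹ * γ l') • ψ l') l (ψ l) v
      = infAct (mdiff (fun l' => (γ l)⁻¹ * γ l') l 1 v) (ψ l) + mdiff ψ l (ψ l) v := by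
    have hact : SmoothAt (fun p : G × M => p.1 • p.2) (1, ψ l) :=
      (IsSmoothAction.smooth_smul (G := G) (M := M)).smoothAt _
    rw [mdiff_comp (f := fun l' => ((γ l)⁻¹ * γ l', ψ l')) (g := fun p : G × M => p.1 • p.2)
      (y := (1, ψ l)) hact (hγ'.prodMk hψ) (by simp) (by simp),
      mdiff_prodMk hγ' hψ (by simp) rfl, mdiff_prod hact (by simp)]
    congr 1
    simp only [one_smul]
    exact mdiff_id _ _
  have h2 : (fun l' => γ l' • ψ l') = fun l' => γ l • ((γ l)⁻¹ * γ l') • ψ l' := by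
    funext l'
    rw [smul_smul, mul_inv_cancel_left]
  rw [h2, mdiff_comp (g := fun x : M => γ l • x) (y := ψ l) ((smoothMap_const_smul _).smoothAt _)
    (hγ'.act hψ) (by simp) rfl, h1]

/-- `α` is invariant and vanishes on the tangent vectors to the orbits. -/
structure IsBasic1 (G : Type u) [Group G] [TopologicalSpace G] [SmoothManifold G]
    {M : Type v} [TopologicalSpace M] [SmoothManifold M] [MulAction G M]
    (α : ∀ x : M, Tan x → ℝ) : Prop where
  form : IsForm1 α
  invariant : IsInvariant1 G α
  horizontal : ∀ (X : Tan (1 : G)) (x : M), α x (infAct X x) = 0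

/-- `β` is invariant and vanishes on the tangent vectors to the orbits. -/
structure IsBasic2 (G : Type u) [Group G] [TopologicalSpace G] [SmoothManifold G]
    {M : Type v} [TopologicalSpace M] [SmoothManifold M] [MulAction G M]
    (β : ∀ x : M, Tan x → Tan x → ℝ) : Prop where
  form : IsForm2 β
  invariant : IsInvariant2 G β
  horizontal : ∀ (X : Tan (1 : G)) (x : M) (w : Tan x), β x (infAct X x) w = 0

theorem IsForm2.swap {β : ∀ x : M, Tan x → Tan x → ℝ} (hβ : IsForm2 β) (x : M) (v w : Tan x) :
    β x v w = -β x w v := by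
  have h := hβ.2.2.1 x (v + w)
  rw [(hβ.1 x (v + w)).map_add, (hβ.2.1 x v).map_add, (hβ.2.1 x w).map_add, hβ.2.2.1,
    hβ.2.2.1] at h
  linarith

/-- By `exists_mdiff_act` a `G`-valued factor changes the differential by an orbit direction and by
the action of one group element; a basic form sees neither. -/
theorem IsBasic1.pull1_act {α : ∀ x : M, Tan x → ℝ} (hα : IsBasic1 G α) {γ : L → G} {ψ : L → M}
    {l : L} (hγ : SmoothAt γ l) (hψ : SmoothAt ψ l) (v : Tan l) :
    pull1 (fun l => γ l • ψ l) α l v = pull1 ψ α l v := by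
  obtain ⟨X, hX⟩ := exists_mdiff_act hγ hψ v
  have h := hα.invariant (γ l) (ψ l) (infAct X (ψ l) + mdiff ψ l (ψ l) v)
  rw [pull1] at h
  rw [pull1, hX, h, (hα.form.1 _).map_add, hα.horizontal, zero_add, pull1]

theorem IsBasic2.pull2_act {β : ∀ x : M, Tan x → Tan x → ℝ} (hβ : IsBasic2 G β) {γ : L → G}
    {ψ : L → M} {l : L} (hγ : SmoothAt γ l) (hψ : SmoothAt ψ l) (v w : Tan l) :
    pull2 (fun l => γ l • ψ l) β l v w = pull2 ψ β l v w := by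
  obtain ⟨X, hX⟩ := exists_mdiff_act hγ hψ v
  obtain ⟨Z, hZ⟩ := exists_mdiff_act hγ hψ w
  have h := hβ.invariant (γ l) (ψ l) (infAct X (ψ l) + mdiff ψ l (ψ l) v)
    (infAct Z (ψ l) + mdiff ψ l (ψ l) w)
  rw [pull2] at h
  rw [pull2, hX, hZ, h, (hβ.form.2.1 _ _).map_add, hβ.horizontal, zero_add,
    (hβ.form.1 _ _).map_add, hβ.form.swap _ _ (infAct Z (ψ l)), hβ.horizontal, neg_zero, zero_add,
    pull2]

end Actions

/-! ### Principal bundles -/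

section Principal

variable {G : Type u} [Group G] [TopologicalSpace G] [SmoothManifold G] [IsLieGroup G]
variable {M : Type v} [TopologicalSpace M] [SmoothManifold M] [MulAction G M] [IsSmoothAction G M]
variable {B : Type w} [TopologicalSpace B] [SmoothManifold B] {q : M → B}
variable {L : Type*} [TopologicalSpace L] [SmoothManifold L]

/-- An element `g` of `G` with `g • x' = x`, if there is one. -/
def actDiv (G : Type u) [Group G] {M : Type v} [MulAction G M] (x x' : M) : G :=
  Classical.epsilon fun g : G => g • x' = x

omit [TopologicalSpace G] [SmoothManifold G] [IsLieGroup G] [TopologicalSpace M] [SmoothManifold M]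
  [IsSmoothAction G M] in
theorem actDiv_smul {x x' : M} (h : ∃ g : G, g • x' = x) : actDiv G x x' • x' = x :=
  Classical.epsilon_spec h

namespace IsPrincipalQuotient

omit [IsLieGroup G] [IsSmoothAction G M] in
theorem apply_smul (hq : IsPrincipalQuotient G q) (g : G) (x : M) : q (g • x) = q x :=
  ((hq.fiber x (g • x)).2 ⟨g, rfl⟩).symm

omit [IsLieGroup G] [IsSmoothAction G M] in
theorem smul_cancel (hq : IsPrincipalQuotient G q) {g g' : G} {x : M} (h : g • x = g' • x) :
    g = g' := by
  have h1 := hq.free (g'⁻¹ * g) x (by rw [mul_smul, h, inv_smul_smul])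
  exact (inv_mul_eq_one.1 h1).symm

omit [IsLieGroup G] [IsSmoothAction G M] in
theorem div_smul (hq : IsPrincipalQuotient G q) {x x' : M} (h : q x = q x') :
    actDiv G x x' • x' = x :=
  actDiv_smul ((hq.fiber x' x).1 h.symm)

omit [IsLieGroup G] [IsSmoothAction G M] in
theorem div_eq (hq : IsPrincipalQuotient G q) {x x' : M} {g : G} (h : g • x' = x) :
    actDiv G x x' = g :=
  hq.smul_cancel ((actDiv_smul ⟨g, h⟩).trans h.symm)

omit [IsSmoothAction G M] in
-- In a local trivialisation `x = τ x • σ (q x)` the quotient of `x` by `x'` is `τ x * (τ x')⁻¹`, an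
-- expression that is smooth off the fibre product too.
theorem smoothAtW_div (hq : IsPrincipalQuotient G q) {p : M × M} (hp : p ∈ fibreProd q q) :
    SmoothAtW (fun p : M × M => actDiv G p.1 p.2) (fibreProd q q) p := by
  have hp : q p.1 = q p.2 := hp
  obtain ⟨U, σ, τ, hb, hσ, hτ, hqσ, hx⟩ := hq.locally_trivial (q p.1)
  have h1 : SmoothAt (fun p : M × M => τ p.1 * (τ p.2)⁻¹) p := by
    refine SmoothAt.mul ?_ (SmoothAt.inv ?_)
    · exact (hτ.smoothAt (x := p.1) hb).comp (smoothAt_id p).fst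
    · exact SmoothAt.comp (hτ.smoothAt (x := p.2) (by rw [mem_preimage, ← hp]; exact hb))
        (smoothAt_id p).snd
  refine h1.smoothAtW_of_eq ?_
  have hU : ∀ᶠ p' : M × M in 𝓝 p, q p'.1 ∈ U :=
    (hq.smooth.continuous.comp continuous_fst).continuousAt.eventually (hσ.1.mem_nhds hb)
  filter_upwards [hU] with p' hp' hpf
  have hpf : q p'.1 = q p'.2 := hpf
  refine hq.div_eq ?_
  have e1 := hx p'.1 hp'
  have e2 := hx p'.2 (by rw [mem_preimage, ← hpf]; exact hp')
  rw [← hpf] at e2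
  rw [mul_smul]
  nth_rw 2 [e2]
  rw [inv_smul_smul, ← e1]

omit [IsSmoothAction G M] in
theorem smoothAt_div (hq : IsPrincipalQuotient G q) {f g : L → M} {l : L} (hf : SmoothAt f l)
    (hg : SmoothAt g l) (h : ∀ᶠ l in 𝓝 l, q (f l) = q (g l)) :
    SmoothAt (fun l => actDiv G (f l) (g l)) l :=
  SmoothAtW.comp_smoothAt (g := fun p : M × M => actDiv G p.1 p.2) (f := fun l => (f l, g l))
    (hq.smoothAtW_div (p := (f l, g l)) h.self_of_nhds) (hf.prodMk hg) h

omit [IsLieGroup G] in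
/-- Through every point there is a local section. -/
theorem exists_section (hq : IsPrincipalQuotient G q) (x : M) :
    ∃ σ : B → M, SmoothAt σ (q x) ∧ σ (q x) = x ∧ ∀ᶠ b in 𝓝 (q x), q (σ b) = b := by
  obtain ⟨U, σ, τ, hb, hσ, hτ, hqσ, hx⟩ := hq.locally_trivial (q x)
  refine ⟨fun b => τ x • σ b, (smoothAt_const _ _).act (hσ.smoothAt hb), (hx x hb).symm, ?_⟩
  filter_upwards [hσ.1.mem_nhds hb] with b hb'
  rw [hq.apply_smul, hqσ b hb']

omit [IsLieGroup G] in
theorem smoothAt_of_comp (hq : IsPrincipalQuotient G q) {f : B → L} {x : M}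
    (hf : SmoothAt (fun x => f (q x)) x) : SmoothAt f (q x) := by
  obtain ⟨σ, hσ, hσx, hqσ⟩ := hq.exists_section x
  refine (SmoothAt.comp_of_eq hf hσ hσx).congr ?_
  filter_upwards [hqσ] with b hb
  rw [hb]

omit [IsLieGroup G] in
theorem smoothMap_of_comp (hq : IsPrincipalQuotient G q) {f : B → L}
    (hf : SmoothMap (fun x => f (q x))) : SmoothMap f := by
  refine smoothMap_iff.2 fun b => ?_
  obtain ⟨x, rfl⟩ := hq.surjective b
  exact hq.smoothAt_of_comp (hf.smoothAt x)

omit [IsLieGroup G] in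
theorem exists_section' (hq : IsPrincipalQuotient G q) (b : B) :
    ∃ σ : B → M, SmoothAt σ b ∧ ∀ᶠ b' in 𝓝 b, q (σ b') = b' := by
  obtain ⟨x, rfl⟩ := hq.surjective b
  obtain ⟨σ, hσ, -, hqσ⟩ := hq.exists_section x
  exact ⟨σ, hσ, hqσ⟩

/-- At `b`, pull `α` back along a local section chosen at `b`. The choice is immaterial: `σ ∘ q` and
the identity differ by a `G`-valued function, so `IsBasic1.pull1_act` applies. -/
theorem exists_descend1 (hq : IsPrincipalQuotient G q) {α : ∀ x : M, Tan x → ℝ}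
    (hα : IsBasic1 G α) :
    ∃ αbar : ∀ b : B, Tan b → ℝ, IsForm1 αbar ∧ ∀ x v, pull1 q αbar x v = α x v := by
  choose σ hσ hqσ using fun b => hq.exists_section' b
  let αbar : ∀ b : B, Tan b → ℝ := fun b v => pull1 (σ b) α b v
  have key1 : ∀ (x : M) (v : Tan x), pull1 q αbar x v = α x v := by
    intro x v
    have h1 : pull1 q αbar x v = pull1 (fun x' => σ (q x) (q x')) α x v :=
      (pull1_comp (hq.smooth.smoothAt x) (hσ (q x)) α v).symm
    have hσq : SmoothAt (fun x' => σ (q x) (q x')) x := (hσ (q x)).comp (hq.smooth.smoothAt x)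
    have hev : ∀ᶠ x' in 𝓝 x, q (σ (q x) (q x')) = q x' :=
      hq.smooth.continuous.continuousAt.eventually (hqσ (q x))
    have hd := hq.smoothAt_div hσq (smoothAt_id x) hev
    rw [h1, ← pull1_id α x v, ← hα.pull1_act hd (smoothAt_id x)]
    refine pull1_congr ?_ α v
    filter_upwards [hev] with x' hx'
    exact (hq.div_smul hx').symm
  -- The section in the definition of `αbar` jumps from point to point. By `key1` the single section
  -- `σ b` gives the same form throughout a neighbourhood of `b`.
  refine ⟨αbar, isForm1_of_eventually_eq_pull1 hα.form fun b => ⟨σ b, hσ b, ?_⟩, key1⟩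
  filter_upwards [(hσ b).eventually, (hqσ b).eventually_nhds] with b' hs hb' v
  rw [← pull1_id αbar b' v, ← pull1_congr (f := fun b' => q (σ b b')) hb' αbar v,
    pull1_comp hs (hq.smooth.smoothAt _), pull1, key1]
  rfl

theorem exists_descend2 (hq : IsPrincipalQuotient G q) {β : ∀ x : M, Tan x → Tan x → ℝ}
    (hβ : IsBasic2 G β) :
    ∃ βbar : ∀ b : B, Tan b → Tan b → ℝ, IsForm2 βbar ∧
      ∀ x v w, pull2 q βbar x v w = β x v w := by
  choose σ hσ hqσ using fun b => hq.exists_section' b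
  let βbar : ∀ b : B, Tan b → Tan b → ℝ := fun b v w => pull2 (σ b) β b v w
  have key1 : ∀ (x : M) (v w : Tan x), pull2 q βbar x v w = β x v w := by
    intro x v w
    have h1 : pull2 q βbar x v w = pull2 (fun x' => σ (q x) (q x')) β x v w :=
      (pull2_comp (hq.smooth.smoothAt x) (hσ (q x)) β v w).symm
    have hσq : SmoothAt (fun x' => σ (q x) (q x')) x := (hσ (q x)).comp (hq.smooth.smoothAt x)
    have hev : ∀ᶠ x' in 𝓝 x, q (σ (q x) (q x')) = q x' :=
      hq.smooth.continuous.continuousAt.eventually (hqσ (q x))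
    have hd := hq.smoothAt_div hσq (smoothAt_id x) hev
    rw [h1, ← pull2_id β x v w, ← hβ.pull2_act hd (smoothAt_id x)]
    refine pull2_congr ?_ β v w
    filter_upwards [hev] with x' hx'
    exact (hq.div_smul hx').symm
  refine ⟨βbar, isForm2_of_eventually_eq_pull2 hβ.form fun b => ⟨σ b, hσ b, ?_⟩, key1⟩
  filter_upwards [(hσ b).eventually, (hqσ b).eventually_nhds] with b' hs hb' v w
  rw [← pull2_id βbar b' v w, ← pull2_congr (f := fun b' => q (σ b b')) hb' βbar v w,
    pull2_comp hs (hq.smooth.smoothAt _), pull2, key1]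
  rfl

omit [IsLieGroup G] in
/-- The differential of the projection is surjective. -/
theorem exists_mdiff_eq (hq : IsPrincipalQuotient G q) (x : M) (v : Tan (q x)) :
    ∃ w : Tan x, mdiff q x (q x) w = v := by
  obtain ⟨σ, hσ, hσx, hqσ⟩ := hq.exists_section x
  refine ⟨mdiff σ (q x) x v, ?_⟩
  rw [← mdiff_comp (hq.smooth.smoothAt x) hσ hσx rfl, mdiff_congr (g := fun b => b) hqσ, mdiff_id]

omit [IsLieGroup G] in
theorem pull1_injective (hq : IsPrincipalQuotient G q) {α α' : ∀ b : B, Tan b → ℝ}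
    (h : ∀ x v, pull1 q α x v = pull1 q α' x v) : α = α' := by
  funext b v
  obtain ⟨x, rfl⟩ := hq.surjective b
  obtain ⟨w, rfl⟩ := hq.exists_mdiff_eq x v
  exact h x w

omit [IsLieGroup G] in
theorem pull2_injective (hq : IsPrincipalQuotient G q) {β β' : ∀ b : B, Tan b → Tan b → ℝ}
    (h : ∀ x v w, pull2 q β x v w = pull2 q β' x v w) : β = β' := by
  funext b v v'
  obtain ⟨x, rfl⟩ := hq.surjective b
  obtain ⟨w, rfl⟩ := hq.exists_mdiff_eq x v
  obtain ⟨w', rfl⟩ := hq.exists_mdiff_eq x v'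
  exact h x w w'

end IsPrincipalQuotient

/-- Locally the bundle is `U × G`; a chart of `G` turns the fibre into an open subset of a locally
convex space. -/
theorem IsPrincipalQuotient.isSubmersion {M : Type u} [TopologicalSpace M] [SmoothManifold M]
    [MulAction G M] [IsSmoothAction G M] {q : M → B} (hq : IsPrincipalQuotient G q) :
    IsSubmersion q := by
  refine ⟨hq.smooth, fun x => ?_⟩
  obtain ⟨U, σ, τ, hb, hσ, hτ, hqσ, hx⟩ := hq.locally_trivial (q x)
  have hτσ : ∀ b ∈ U, ∀ g : G, q (g • σ b) = b ∧ τ (g • σ b) = g := by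
    intro b hb g
    have h1 : q (g • σ b) = b := by rw [hq.apply_smul, hqσ b hb]
    have h2 := hx (g • σ b) (by rw [mem_preimage, h1]; exact hb)
    rw [h1] at h2
    exact ⟨h1, (hq.smul_cancel h2).symm⟩
  refine ⟨Tan (τ x), inferInstance, inferInstance, inferInstance, inferInstance, inferInstance,
    inferInstance, inferInstance, q ⁻¹' U ∩ τ ⁻¹' (chart (τ x)).source,
    U ×ˢ (chart (τ x)).target, fun x' => chart (τ x) (τ x'),
    fun z => (chart (τ x)).symm z.2 • σ z.1, ⟨hb, SmoothManifold.mem_chart_source _⟩, ?_, ?_, ?_, ?_⟩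
  · have hopen := hτ.2.1.isOpen_inter_preimage hτ.1 (chart (τ x)).open_source
    exact (smoothOnOpen_chart (τ x)).comp (hτ.mono hopen inter_subset_left) fun y hy => hy.2
  · refine smoothOnOpen_iff.2 ⟨hσ.1.prod (chart (τ x)).open_target, ?_⟩
    rintro ⟨b, z⟩ ⟨hb', hz⟩
    refine SmoothAt.act ?_ ?_
    · exact SmoothAt.comp (smoothAt_chart_symm hz) (smoothAt_id _).snd
    · exact (hσ.smoothAt hb').comp (smoothAt_id _).fst
  · rintro x' ⟨hx1, hx2⟩
    refine ⟨⟨hx1, (chart (τ x)).map_source hx2⟩, ?_⟩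
    simp only [(chart (τ x)).left_inv hx2]
    exact (hx x' hx1).symm
  · rintro ⟨b, z⟩ ⟨hb', hz⟩
    obtain ⟨e1, e2⟩ := hτσ b hb' ((chart (τ x)).symm z)
    refine ⟨⟨?_, ?_⟩, ?_⟩
    · simp only [mem_preimage, e1]
      exact hb'
    · simp only [mem_preimage, e2]
      exact (chart (τ x)).map_target hz
    · simp only [e1, e2, (chart (τ x)).right_inv hz]

end Principal

/-! ### Quotient manifolds -/

section QuotientManifold

theorem SmoothOnOpen.isOpen_inter_preimage {M : Type*} [TopologicalSpace M] [SmoothManifold M]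
    {N : Type*} [TopologicalSpace N] [SmoothManifold N] {f : M → N} {U : Set M}
    (h : SmoothOnOpen f U) {V : Set N} (hV : IsOpen V) : IsOpen (U ∩ f ⁻¹' V) :=
  h.2.1.isOpen_inter_preimage h.1 hV

/-- A chart around `x` for the quotient `X` of the manifold `P`. -/
structure QuotientChart {P : Type u} [TopologicalSpace P] [SmoothManifold P] {X : Type u}
    (ρ : P → X) (x : X) where
  E : Type u
  [instAddCommGroup : AddCommGroup E]
  [instModule : Module ℝ E]
  [instTop : TopologicalSpace E]
  [instTopAddGroup : IsTopologicalAddGroup E]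
  [instContSMul : ContinuousSMul ℝ E]
  [instLocConvex : LocallyConvexSpace ℝ E]
  [instT2 : T2Space E]
  O : Set X
  W : Set E
  coord : P → E
  lift : E → P
  mem : x ∈ O
  smooth_coord : SmoothOnOpen coord (ρ ⁻¹' O)
  smooth_lift : SmoothOnOpen lift W
  coord_mem : ∀ p, ρ p ∈ O → coord p ∈ W
  lift_mem : ∀ e ∈ W, ρ (lift e) ∈ O
  coord_lift : ∀ e ∈ W, coord (lift e) = e
  lift_coord : ∀ p, ρ p ∈ O → ρ (lift (coord p)) = ρ p
  coord_congr : ∀ p p', ρ p = ρ p' → ρ p ∈ O → coord p = coord p'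

attribute [instance] QuotientChart.instAddCommGroup QuotientChart.instModule QuotientChart.instTop
  QuotientChart.instTopAddGroup QuotientChart.instContSMul QuotientChart.instLocConvex
  QuotientChart.instT2

variable {P : Type u} [TopologicalSpace P] [SmoothManifold P] {X : Type u} [TopologicalSpace X]
  {ρ : P → X}

/-- The homeomorphism given by a quotient chart. -/
def QuotientChart.toHomeomorph (hρ : IsOpenQuotientMap ρ) {x : X} (c : QuotientChart ρ x) :
    OpenPartialHomeomorph X c.E where
  toFun y := c.coord (Function.surjInv hρ.surjective y)
  invFun e := ρ (c.lift e)
  source := c.O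
  target := c.W
  map_source' y hy := c.coord_mem _ (by rwa [Function.surjInv_eq hρ.surjective])
  map_target' e he := c.lift_mem e he
  left_inv' y hy := by
    rw [c.lift_coord _ (by rwa [Function.surjInv_eq hρ.surjective]), Function.surjInv_eq hρ.surjective]
  right_inv' e he := by
    rw [c.coord_congr _ (c.lift e) (Function.surjInv_eq _ _)
      (by rw [Function.surjInv_eq hρ.surjective]; exact c.lift_mem e he), c.coord_lift e he]
  open_source := hρ.isQuotientMap.isOpen_preimage.1 c.smooth_coord.1
  open_target := c.smooth_lift.1
  continuousOn_toFun := by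
    intro y hy
    obtain ⟨p, rfl⟩ := hρ.surjective y
    refine ContinuousAt.continuousWithinAt ?_
    rw [← hρ.continuousAt_comp_iff]
    refine ContinuousAt.congr (c.smooth_coord.2.1.continuousAt (c.smooth_coord.1.mem_nhds hy)) ?_
    filter_upwards [c.smooth_coord.1.mem_nhds hy] with p' hp'
    exact c.coord_congr _ _ (Function.surjInv_eq _ _).symm hp'
  continuousOn_invFun := hρ.continuous.comp_continuousOn c.smooth_lift.2.1

/-- `X` has no smooth structure beforehand, so everything is tested on `P`: a change of charts is
`coord` of one chart after `lift` of the other. The lifts also yield the local sections that later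
make the quotient a principal bundle. -/
theorem exists_quotient_manifold [T2Space X] (hρ : IsOpenQuotientMap ρ)
    (c : ∀ x, QuotientChart ρ x) : ∃ _ : SmoothManifold X, SmoothMap ρ ∧
      ∀ x, ∃ σ : X → P, SmoothAt σ x ∧ ∀ᶠ x' in 𝓝 x, ρ (σ x') = x' := by
  let m : SmoothManifold X :=
    { Tan := fun x => (c x).E
      chart := fun x => (c x).toHomeomorph hρ
      mem_chart_source := fun x => (c x).mem
      smooth_transition := fun x y => by
        have h1 : SmoothOnOpen (c x).lift ((c x).W ∩ (c x).lift ⁻¹' (ρ ⁻¹' (c y).O)) :=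
          (c x).smooth_lift.mono ((c x).smooth_lift.isOpen_inter_preimage (c y).smooth_coord.1)
            inter_subset_left
        have h2 := (smoothOnOpen_iff_mbSmoothOn.1 ((c y).smooth_coord.comp h1 fun e he => he.2))
        refine h2.2.congrOn h2.1 ?_
        rintro e ⟨-, he⟩
        exact (c y).coord_congr _ _ (Function.surjInv_eq _ _).symm he }
  have hs : ∀ x : X, (chart x).source = (c x).O := fun _ => rfl
  refine ⟨m, smoothMap_iff.2 fun p => ?_, fun x => ?_⟩
  · have hp : ρ p ∈ (c (ρ p)).O := (c (ρ p)).mem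
    have h1 : SmoothAt ((chart (ρ p)).symm : Tan (ρ p) → X) ((c (ρ p)).coord p) :=
      smoothAt_chart_symm ((c (ρ p)).coord_mem p hp)
    refine (h1.comp ((c (ρ p)).smooth_coord.smoothAt hp)).congr ?_
    filter_upwards [(c (ρ p)).smooth_coord.1.mem_nhds hp] with p' hp'
    exact (c (ρ p)).lift_coord p' hp'
  · have hx : x ∈ (c x).O := (c x).mem
    have h1 : SmoothAt (chart x : X → Tan x) x := smoothAt_chart hx
    have h2 : SmoothAt (c x).lift (chart x x) := (c x).smooth_lift.smoothAt (chart_mem_target x)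
    refine ⟨fun x' => (c x).lift (chart x x'), SmoothAt.comp h2 h1, ?_⟩
    filter_upwards [(chart x).open_source.mem_nhds hx] with x' hx'
    exact (chart x).left_inv hx'

end QuotientManifold

/-! ### Local sections of quotients and submersions -/

section Sections

variable {G : Type u} [Group G] [TopologicalSpace G] [SmoothManifold G] [IsLieGroup G]
variable {M : Type v} [TopologicalSpace M] [SmoothManifold M] [MulAction G M]
variable {B : Type w} [TopologicalSpace B] [SmoothManifold B] {q : M → B}

/-- An equivariant map to a principal bundle makes a quotient with local sections principal. -/
theorem IsPrincipalQuotient.of_equivariant (hq : IsPrincipalQuotient G q)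
    {P : Type*} [TopologicalSpace P] [SmoothManifold P] [MulAction G P] {y : P → M}
    (hy : SmoothMap y) (hyg : ∀ (g : G) p, y (g • p) = g • y p)
    {X : Type*} [TopologicalSpace X] [SmoothManifold X] {ρ : P → X} (hρ : SmoothMap ρ)
    (hsurj : Function.Surjective ρ) (hfib : ∀ p p', ρ p = ρ p' ↔ ∃ g : G, g • p = p')
    (hsec : ∀ x, ∃ σ : X → P, SmoothAt σ x ∧ ∀ᶠ x' in 𝓝 x, ρ (σ x') = x') :
    IsPrincipalQuotient G ρ where
  smooth := hρ
  surjective := hsurj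
  fiber := hfib
  free g p h := hq.free g (y p) (by rw [← hyg, h])
  locally_trivial x := by
    obtain ⟨σ, ⟨U, hx, hU⟩, hσ⟩ := hsec x
    obtain ⟨V, hV, hVo, hxV⟩ := mem_nhds_iff.1 hσ
    have key : ∀ p ∈ ρ ⁻¹' (U ∩ V), ∃ g : G, g • σ (ρ p) = p := fun p hp =>
      (hfib _ _).1 (hV hp.2)
    refine ⟨U ∩ V, σ, fun p => actDiv G (y p) (y (σ (ρ p))), ⟨hx, hxV⟩,
      hU.mono (hU.1.inter hVo) inter_subset_left, ?_, fun x' hx' => hV hx'.2, ?_⟩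
    · refine smoothOnOpen_iff.2 ⟨(hU.1.inter hVo).preimage hρ.continuous, fun p hp => ?_⟩
      refine hq.smoothAt_div (hy.smoothAt p)
        (hy.comp_smoothAt ((hU.smoothAt hp.1).comp (hρ.smoothAt p))) ?_
      filter_upwards [((hU.1.inter hVo).preimage hρ.continuous).mem_nhds hp] with p' hp'
      obtain ⟨g, hg⟩ := key p' hp'
      rw [← hg, hyg, hg, hq.apply_smul]
    · intro p hp
      obtain ⟨g, hg⟩ := key p hp
      have h1 : g • y (σ (ρ p)) = y p := by rw [← hyg, hg]
      change p = actDiv G (y p) (y (σ (ρ p))) • σ (ρ p)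
      rw [hq.div_eq h1, hg]

/-- Freeze the fibre coordinate `h x` in the product decomposition. -/
theorem IsSubmersion.exists_section {M : Type u} [TopologicalSpace M] [SmoothManifold M]
    {N : Type v} [TopologicalSpace N] [SmoothManifold N] {f : M → N} (hf : IsSubmersion f) (x : M) :
    ∃ σ : N → M, SmoothAt σ (f x) ∧ σ (f x) = x ∧ ∀ᶠ y in 𝓝 (f x), f (σ y) = y := by
  obtain ⟨F, _, _, _, _, _, _, _, V, W, h, g, hxV, hh, hg, h1, h2⟩ := hf.2 x
  have hW : (f x, h x) ∈ W := (h1 x hxV).1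
  refine ⟨fun y => g (y, h x), ?_, (h1 x hxV).2, ?_⟩
  · exact SmoothAt.comp (hg.smoothAt hW) (smoothAt_prodMk_left (f x) (h x))
  · have hc : Tendsto (fun y => (y, h x)) (𝓝 (f x)) (𝓝 (f x, h x)) :=
      (Continuous.prodMk_left (h x)).tendsto _
    filter_upwards [hc.eventually (hg.1.mem_nhds hW)] with y hy
    exact congrArg Prod.fst (h2 _ hy).2

end Sections

/-! ### Circle valued functions -/

section CircleFunctions

variable {L : Type*} [TopologicalSpace L] [SmoothManifold L]

/-- `f : L → Circle` is smooth near `l`. -/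
abbrev CircleSmoothAt (f : L → Circle) (l : L) : Prop := SmoothAt (fun l => (f l : ℂ)) l

theorem CircleSmoothAt.mul {f g : L → Circle} {l : L} (hf : CircleSmoothAt f l)
    (hg : CircleSmoothAt g l) : CircleSmoothAt (fun l => f l * g l) l := by
  refine (smoothMap_complex_mul.comp_smoothAt (hf.prodMk hg)).congr (Eventually.of_forall fun _ => ?_)
  simp

/-- The argument is the imaginary part of the logarithm; it will be the angular coordinate on `P/G`.
-/
theorem CircleSmoothAt.arg {f : L → Circle} {l : L} (hf : CircleSmoothAt f l)
    (h : (f l : ℂ) ∈ Complex.slitPlane) : SmoothAt (fun l => Complex.arg (f l)) l := by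
  have h1 : SmoothOnOpen Complex.log Complex.slitPlane := by
    refine ContDiffOn.smoothOnOpen (fun z hz => ?_) Complex.isOpen_slitPlane
    exact (Complex.contDiffAt_log hz).restrict_scalars ℝ |>.contDiffWithinAt
  have h2 := (smoothMap_clm Complex.imCLM).comp_smoothAt (SmoothAt.comp (f := fun l => (f l : ℂ)) (h1.smoothAt h) hf)
  refine h2.congr (Eventually.of_forall fun x => ?_)
  simp [Complex.log_im]

end CircleFunctions

/-! ### Circle bundles -/

section CircleBundles

variable {B : Type u} [TopologicalSpace B] [SmoothManifold B] {S : Set B} (P : CircleBundle B S)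
variable {L : Type*} [TopologicalSpace L] [SmoothManifold L]

theorem CircleBundle.smoothAt_exp_smul {θ : L → ℝ} {p : L → P.Total} {l : L} (hθ : SmoothAt θ l)
    (hp : SmoothAt p l) : SmoothAt (fun l => Circle.exp (θ l) • p l) l :=
  P.smooth_act.comp_smoothAt (hp.prodMk hθ)

theorem CircleBundle.smoothMap_smul (z : Circle) : SmoothMap (fun p : P.Total => z • p) := by
  refine smoothMap_iff.2 fun p => ?_
  have h := P.smoothAt_exp_smul (smoothAt_const (Complex.arg z) p) (smoothAt_id p)
  simpa only [Circle.exp_arg] using h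

theorem CircleBundle.smul_cancel {z z' : Circle} {p : P.Total} (h : z • p = z' • p) : z = z' := by
  have h1 := P.free (z'⁻¹ * z) p (by rw [mul_smul, h, inv_smul_smul])
  exact (inv_mul_eq_one.1 h1).symm

/-- The value of a trivialisation on a multiple of the section. -/
theorem CircleBundle.triv_smul {U : Set B} {σ : B → P.Total} {τ : P.Total → Circle}
    (hσ : ∀ b ∈ U ∩ S, P.proj (σ b) = b) (hτ : ∀ p ∈ P.proj ⁻¹' U, p = τ p • σ (P.proj p))
    {b : B} (hb : b ∈ U ∩ S) (z : Circle) : P.proj (z • σ b) = b ∧ τ (z • σ b) = z := by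
  have h1 : P.proj (z • σ b) = b := by rw [P.proj_smul, hσ b hb]
  have h2 := hτ (z • σ b) (by rw [mem_preimage, h1]; exact hb.1)
  rw [h1] at h2
  exact ⟨h1, (P.smul_cancel h2).symm⟩

theorem CircleBundle.exists_proj_eq {b : B} (hb : b ∈ S) : ∃ p : P.Total, P.proj p = b := by
  obtain ⟨U, σ, τ, hU, hbU, hσ, hτ, h1, h2⟩ := P.locally_trivial b hb
  exact ⟨σ b, h1 b ⟨hbU, hb⟩⟩

/-- Elements of the same fibre differ by an element of the circle. -/
theorem CircleBundle.exists_smul_eq {p p' : P.Total} (h : P.proj p = P.proj p') :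
    ∃ z : Circle, z • p = p' := by
  obtain ⟨U, σ, τ, hU, hbU, hσ, hτ, h1, h2⟩ := P.locally_trivial (P.proj p) (P.proj_mem p)
  have e1 := h2 p hbU
  have e2 := h2 p' (by rw [mem_preimage, ← h]; exact hbU)
  refine ⟨τ p' * (τ p)⁻¹, ?_⟩
  rw [← h] at e2
  nth_rw 2 [e1]
  rw [smul_smul, inv_mul_cancel_right, ← e2]

end CircleBundles

/-! ### Quotient charts modelled on triple products -/

section FlatProduct

variable {E : Type*} [AddCommGroup E] [Module ℝ E] [TopologicalSpace E] [IsTopologicalAddGroup E]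
  [ContinuousSMul ℝ E] [LocallyConvexSpace ℝ E] [T2Space E]
variable {E' : Type*} [AddCommGroup E'] [Module ℝ E'] [TopologicalSpace E'] [IsTopologicalAddGroup E']
  [ContinuousSMul ℝ E'] [LocallyConvexSpace ℝ E'] [T2Space E']
variable {E'' : Type*} [AddCommGroup E''] [Module ℝ E''] [TopologicalSpace E'']
  [IsTopologicalAddGroup E''] [ContinuousSMul ℝ E''] [LocallyConvexSpace ℝ E''] [T2Space E'']
variable {F : Type u} [AddCommGroup F] [Module ℝ F] [TopologicalSpace F] [IsTopologicalAddGroup F]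
  [ContinuousSMul ℝ F] [LocallyConvexSpace ℝ F] [T2Space F]

/-- A quotient chart has a single locally convex space as model, whereas coordinates arise in a
product of manifolds; this and the next lemma pass between the two structures. -/
theorem smoothMap_clm_to_prod₃ (L : F →L[ℝ] E × E' × E'') : SmoothMap (fun x => L x) := by
  have h1 := smoothMap_clm ((ContinuousLinearMap.fst ℝ E (E' × E'')).comp L)
  have h2 := smoothMap_clm (((ContinuousLinearMap.fst ℝ E' E'').comp
    (ContinuousLinearMap.snd ℝ E (E' × E''))).comp L)
  have h3 := smoothMap_clm (((ContinuousLinearMap.snd ℝ E' E'').comp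
    (ContinuousLinearMap.snd ℝ E (E' × E''))).comp L)
  exact h1.prodMk (h2.prodMk h3)

theorem smoothMap_clm_from_prod₃ (L : E × E' × E'' →L[ℝ] F) : SmoothMap (fun x => L x) :=
  smoothOnOpen_prod₃_iff_mbSmoothOn.2 ⟨isOpen_univ, MBSmoothOn.clm L _⟩

/-- A quotient chart with values in a triple product. -/
theorem nonempty_quotientChart_of_prod₃ {P : Type u} [TopologicalSpace P] [SmoothManifold P]
    {X : Type u} {ρ : P → X} {x : X} (K : (E × E' × E'') ≃L[ℝ] F) {O : Set X}
    {W : Set (E × E' × E'')} {C : P → E × E' × E''} {D : E × E' × E'' → P} (hx : x ∈ O)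
    (hC : SmoothOnOpen C (ρ ⁻¹' O)) (hD : SmoothOnOpen D W) (hCW : ∀ p, ρ p ∈ O → C p ∈ W)
    (hDO : ∀ z ∈ W, ρ (D z) ∈ O) (hCD : ∀ z ∈ W, C (D z) = z)
    (hDC : ∀ p, ρ p ∈ O → ρ (D (C p)) = ρ p)
    (hCC : ∀ p p', ρ p = ρ p' → ρ p ∈ O → C p = C p') : Nonempty (QuotientChart ρ x) :=
  ⟨{  E := F
      O := O
      W := K.symm ⁻¹' W
      coord := fun p => K (C p)
      lift := fun z => D (K.symm z)
      mem := hx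
      smooth_coord := SmoothOnOpen.comp (smoothMap_clm_from_prod₃ (K : E × E' × E'' →L[ℝ] F)) hC
        (mapsTo_univ _ _)
      smooth_lift := SmoothOnOpen.comp hD
        (SmoothOnOpen.mono (smoothMap_clm_to_prod₃ (K.symm : F →L[ℝ] E × E' × E''))
          (hD.1.preimage K.symm.continuous) (subset_univ _)) fun z hz => hz
      coord_mem := fun p hp => by simpa using hCW p hp
      lift_mem := fun z hz => hDO _ hz
      coord_lift := fun z hz => by simp [hCD _ hz]
      lift_coord := fun p hp => by simp [hDC p hp]
      coord_congr := fun p p' h hp => by rw [hCC p p' h hp] }⟩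

end FlatProduct

/-! ### The quotient of the circle bundle of an equivariant gerbe -/

section QuotientBundle

variable {G : Type u} [Group G] [TopologicalSpace G] [SmoothManifold G] [IsLieGroup G]
variable {M : Type u} [TopologicalSpace M] [SmoothManifold M] [MulAction G M]
variable {Y : Type u} [TopologicalSpace Y] [SmoothManifold Y] [MulAction G Y]
variable {Mbar : Type u} [TopologicalSpace Mbar] [SmoothManifold Mbar]
variable {Ybar : Type u} [TopologicalSpace Ybar] [SmoothManifold Ybar]
variable {L : Type*} [TopologicalSpace L] [SmoothManifold L]

theorem BundleGerbe.smoothMap_y₁ (𝒢 : BundleGerbe M Y) : SmoothMap 𝒢.y₁ :=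
  smoothMap_fst.comp 𝒢.P.smooth_proj

theorem BundleGerbe.smoothMap_y₂ (𝒢 : BundleGerbe M Y) : SmoothMap 𝒢.y₂ :=
  smoothMap_snd.comp 𝒢.P.smooth_proj

theorem BundleGerbe.π_y₁ (𝒢 : BundleGerbe M Y) (p : 𝒢.P.Total) : 𝒢.π (𝒢.y₁ p) = 𝒢.π (𝒢.y₂ p) :=
  𝒢.P.proj_mem p

theorem BundleGerbe.proj_eq (𝒢 : BundleGerbe M Y) (p : 𝒢.P.Total) :
    𝒢.P.proj p = (𝒢.y₁ p, 𝒢.y₂ p) := rfl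

namespace EquivariantGerbe

variable (𝒢 : EquivariantGerbe G M Y)

theorem y₁_smul (g : G) (p : 𝒢.P.Total) : 𝒢.y₁ (g • p) = g • 𝒢.y₁ p :=
  congrArg Prod.fst (𝒢.proj_smul g p)

theorem y₂_smul (g : G) (p : 𝒢.P.Total) : 𝒢.y₂ (g • p) = g • 𝒢.y₂ p :=
  congrArg Prod.snd (𝒢.proj_smul g p)

/-- The translate of `p` by an element of `G` that lies over `y` in the first component. -/
def align (y : Y) (p : 𝒢.P.Total) : 𝒢.P.Total := actDiv G y (𝒢.y₁ p) • p

/-- The translate of `p` by an element of `G` that lies over `y` in the second component. -/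
def align₂ (y : Y) (p : 𝒢.P.Total) : 𝒢.P.Total := actDiv G y (𝒢.y₂ p) • p

variable {qY : Y → Ybar} (hqY : IsPrincipalQuotient G qY)

include hqY

theorem y₁_align {y : Y} {p : 𝒢.P.Total} (h : qY y = qY (𝒢.y₁ p)) : 𝒢.y₁ (𝒢.align y p) = y := by
  rw [align, y₁_smul, hqY.div_smul h]

theorem y₂_align₂ {y : Y} {p : 𝒢.P.Total} (h : qY y = qY (𝒢.y₂ p)) :
    𝒢.y₂ (𝒢.align₂ y p) = y := by
  rw [align₂, y₂_smul, hqY.div_smul h]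

theorem align_eq_self {y : Y} {p : 𝒢.P.Total} (h : 𝒢.y₁ p = y) : 𝒢.align y p = p := by
  rw [align, hqY.div_eq (g := 1) (by rw [one_smul, h]), one_smul]

theorem align₂_eq_self {y : Y} {p : 𝒢.P.Total} (h : 𝒢.y₂ p = y) : 𝒢.align₂ y p = p := by
  rw [align₂, hqY.div_eq (g := 1) (by rw [one_smul, h]), one_smul]

/-- Alignment depends only on the orbit of `p`, so it selects a normal form in each orbit. -/
theorem align_smul {y : Y} {p : 𝒢.P.Total} (h : qY y = qY (𝒢.y₁ p)) (g : G) :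
    𝒢.align y (g • p) = 𝒢.align y p := by
  have h1 : actDiv G y (𝒢.y₁ (g • p)) = actDiv G y (𝒢.y₁ p) * g⁻¹ := by
    refine hqY.div_eq ?_
    rw [y₁_smul, mul_smul, inv_smul_smul, hqY.div_smul h]
  rw [align, h1, mul_smul, inv_smul_smul, align]

theorem smoothAt_align {y : L → Y} {p : L → 𝒢.P.Total} {l : L} (hy : SmoothAt y l)
    (hp : SmoothAt p l) (h : ∀ᶠ l in 𝓝 l, qY (y l) = qY (𝒢.y₁ (p l))) :
    SmoothAt (fun l => 𝒢.align (y l) (p l)) l := by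
  have := 𝒢.smooth_smul_P
  exact (hqY.smoothAt_div hy (𝒢.smoothMap_y₁.comp_smoothAt hp) h).act hp

theorem smoothAt_align₂ {y : L → Y} {p : L → 𝒢.P.Total} {l : L} (hy : SmoothAt y l)
    (hp : SmoothAt p l) (h : ∀ᶠ l in 𝓝 l, qY (y l) = qY (𝒢.y₂ (p l))) :
    SmoothAt (fun l => 𝒢.align₂ (y l) (p l)) l := by
  have := 𝒢.smooth_smul_P
  exact (hqY.smoothAt_div hy (𝒢.smoothMap_y₂.comp_smoothAt hp) h).act hp

/-- As `G` acts freely on `Y`, each orbit near that of `p₀` contains exactly one element whose first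
footpoint lies on the local section `σ` of `qY`. Its coordinates are the image of the first
footpoint in `Y/G`, the fibre coordinate of the second footpoint for the submersion `π`, and the
angle in the fibre of `P`. -/
theorem nonempty_quotientChart {X : Type u} {ρ : 𝒢.P.Total → X}
    (hfib : ∀ p p', ρ p = ρ p' ↔ ∃ g : G, g • p = p') (p₀ : 𝒢.P.Total) :
    Nonempty (QuotientChart ρ (ρ p₀)) := by
  have := 𝒢.smooth_smul_P
  have := 𝒢.smooth_smul_Y
  obtain ⟨σ, ⟨Ω', ha', hσ'⟩, hσa, hqσ'⟩ := hqY.exists_section (𝒢.y₁ p₀)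
  obtain ⟨Ω'', hΩ'', hΩo, ha''⟩ := mem_nhds_iff.1 hqσ'
  set a := qY (𝒢.y₁ p₀) with ha
  let Ω := Ω' ∩ Ω'' ∩ (chart a).source
  have hΩ : IsOpen Ω := (hσ'.1.inter hΩo).inter (chart a).open_source
  have hσ : SmoothOnOpen σ Ω := hσ'.mono hΩ fun b hb => hb.1.1
  have hqσ : ∀ b ∈ Ω, qY (σ b) = b := fun b hb => hΩ'' hb.1.2
  have haΩ : a ∈ Ω := ⟨⟨ha', ha''⟩, SmoothManifold.mem_chart_source a⟩
  obtain ⟨F, _, _, _, _, _, _, _, V, Wπ, h, gπ, hxV, hh, hg, hV, hW⟩ := 𝒢.submersion.2 (𝒢.y₂ p₀)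
  obtain ⟨U, σP, τP, hU, hbU, hσP, hτP, hpσ, hpτ⟩ :=
    𝒢.P.locally_trivial (𝒢.P.proj p₀) (𝒢.P.proj_mem p₀)
  -- The section `σP` of `P` is smooth only along `Y^{[2]}`. The extension `gσ` to an open set is
  -- what makes the lift smooth on an open set of coordinates.
  obtain ⟨U', gσ, hbU', hgσ, hgσeq⟩ := hσP (𝒢.P.proj p₀) ⟨hbU, 𝒢.P.proj_mem p₀⟩
  have hsec : ∀ b ∈ (U ∩ U') ∩ fibreProd 𝒢.π 𝒢.π, gσ b = σP b :=
    fun b hb => (hgσeq b ⟨hb.1.2, hb.1.1, hb.2⟩).symm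
  -- the normalised representative of an orbit
  let N : 𝒢.P.Total → 𝒢.P.Total := fun p => 𝒢.align (σ (qY (𝒢.y₁ p))) p
  let A : Set 𝒢.P.Total := {p | qY (𝒢.y₁ p) ∈ Ω}
  have hqy : SmoothMap fun p => qY (𝒢.y₁ p) := hqY.smooth.comp 𝒢.smoothMap_y₁
  have hA : IsOpen A := hΩ.preimage hqy.continuous
  have hqN : ∀ p ∈ A, qY (σ (qY (𝒢.y₁ p))) = qY (𝒢.y₁ p) := fun p hp => hqσ _ hp
  have hN : SmoothOnOpen N A := by
    refine smoothOnOpen_iff.2 ⟨hA, fun p hp => ?_⟩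
    refine 𝒢.smoothAt_align hqY (SmoothAt.comp (f := fun p => qY (𝒢.y₁ p)) (hσ.smoothAt hp) (hqy.smoothAt p))
      (smoothAt_id p) ?_
    filter_upwards [hA.mem_nhds hp] with p' hp' using hqN p' hp'
  have hNy₁ : ∀ p ∈ A, 𝒢.y₁ (N p) = σ (qY (𝒢.y₁ p)) := fun p hp => 𝒢.y₁_align hqY (hqN p hp)
  have hqg : ∀ (g : G) p, qY (𝒢.y₁ (g • p)) = qY (𝒢.y₁ p) := fun g p => by
    rw [y₁_smul, hqY.apply_smul]
  have hNg : ∀ p ∈ A, ∀ g : G, N (g • p) = N p := fun p hp g => by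
    simp only [N, hqg]
    exact 𝒢.align_smul hqY (hqN p hp) g
  have hρN : ∀ p, ρ (N p) = ρ p := fun p => ((hfib _ _).2 ⟨_, rfl⟩).symm
  have hNself : ∀ b ∈ Ω, ∀ p, 𝒢.y₁ p = σ b → p ∈ A ∧ N p = p := fun b hb p hp => by
    have h1 : qY (𝒢.y₁ p) = b := by rw [hp, hqσ b hb]
    refine ⟨show qY (𝒢.y₁ p) ∈ Ω by rw [h1]; exact hb, 𝒢.align_eq_self hqY ?_⟩
    rw [h1, hp]
  -- the domain of the chart
  let D₁ : Set 𝒢.P.Total := {p | 𝒢.y₂ p ∈ V ∧ 𝒢.P.proj p ∈ U ∩ U'}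
  have hD₁ : IsOpen D₁ := (hh.1.preimage 𝒢.smoothMap_y₂.continuous).inter
    ((hU.inter hgσ.1).preimage 𝒢.P.smooth_proj.continuous)
  -- Angles are measured from `p₀`, which thereby has `ϑ = 1` and avoids the cut of `Complex.arg`.
  let ϑ : 𝒢.P.Total → Circle := fun p => τP p * (τP p₀)⁻¹
  have hϑ : ∀ p ∈ D₁, CircleSmoothAt ϑ p := fun p hp =>
    CircleSmoothAt.mul (hτP.smoothAt hp.2.1) (smoothAt_const _ p)
  have hϑ' : SmoothOnOpen (fun p => (ϑ p : ℂ)) D₁ := smoothOnOpen_iff.2 ⟨hD₁, hϑ⟩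
  let D₂ : Set 𝒢.P.Total := D₁ ∩ (fun p => (ϑ p : ℂ)) ⁻¹' Complex.slitPlane
  have hD₂ : IsOpen D₂ := hϑ'.isOpen_inter_preimage Complex.isOpen_slitPlane
  let O : Set 𝒢.P.Total := A ∩ N ⁻¹' D₂
  have hO : IsOpen O := hN.isOpen_inter_preimage hD₂
  have hOg : ∀ p ∈ O, ∀ g : G, g • p ∈ O := fun p hp g =>
    ⟨show qY (𝒢.y₁ (g • p)) ∈ Ω by rw [hqg]; exact hp.1,
      show N (g • p) ∈ D₂ by rw [hNg p hp.1]; exact hp.2⟩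
  have hOρ : ρ ⁻¹' (ρ '' O) = O := by
    refine Subset.antisymm ?_ (subset_preimage_image _ _)
    rintro p ⟨p', hp', hpp⟩
    obtain ⟨g, rfl⟩ := (hfib _ _).1 hpp
    exact hOg _ hp' g
  have hON : ∀ p ∈ O, N p ∈ O := fun p hp => by
    have h1 := hNself _ hp.1 (N p) (hNy₁ p hp.1)
    exact ⟨h1.1, show N (N p) ∈ D₂ by rw [h1.2]; exact hp.2⟩
  -- the coordinates
  let C : 𝒢.P.Total → Tan a × F × ℝ := fun p =>
    (chart a (qY (𝒢.y₁ p)), h (𝒢.y₂ (N p)), Complex.arg (ϑ (N p)))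
  have hC : SmoothOnOpen C O := by
    refine smoothOnOpen_iff.2 ⟨hO, fun p hp => ?_⟩
    have hNp : SmoothAt N p := hN.smoothAt hp.1
    refine SmoothAt.prodMk ?_ (SmoothAt.prodMk ?_ ?_)
    · exact SmoothAt.comp (smoothAt_chart (show qY (𝒢.y₁ p) ∈ _ from hp.1.2)) (hqy.smoothAt p)
    · exact SmoothAt.comp (hh.smoothAt hp.2.1.1) (𝒢.smoothMap_y₂.comp_smoothAt hNp)
    · exact SmoothAt.comp (g := fun p => Complex.arg (ϑ p)) (CircleSmoothAt.arg (hϑ _ hp.2.1) hp.2.2) hNp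
  -- the inverse
  let W₁ : Set (Tan a) := (chart a).target ∩ (chart a).symm ⁻¹' Ω
  have hs₁ : SmoothOnOpen (fun e => σ ((chart a).symm e)) W₁ :=
    hσ.comp ((smoothOnOpen_chart_symm a).mono ((chart a).isOpen_inter_preimage_symm hΩ)
      inter_subset_left) fun e he => he.2
  let s : Tan a → Y := fun e => σ ((chart a).symm e)
  have hs : ∀ e ∈ W₁, SmoothAt s e := fun e he => hs₁.smoothAt he
  let A₂ : Set (Tan a × F × ℝ) := {z | z.1 ∈ W₁}
  have hA₂ : IsOpen A₂ := hs₁.1.preimage continuous_fst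
  have hs₂ : ∀ z ∈ A₂, SmoothAt (fun z : Tan a × F × ℝ => (𝒢.π (s z.1), z.2.1)) z := fun z hz =>
    (𝒢.submersion.1.comp_smoothAt (SmoothAt.comp (hs _ hz) (smoothAt_id z).fst)).prodMk
      (smoothAt_id z).snd.fst
  have hs₂' : SmoothOnOpen (fun z : Tan a × F × ℝ => (𝒢.π (s z.1), z.2.1)) A₂ :=
    smoothOnOpen_iff.2 ⟨hA₂, hs₂⟩
  let W₂ : Set (Tan a × F × ℝ) := A₂ ∩ (fun z => (𝒢.π (s z.1), z.2.1)) ⁻¹' Wπ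
  have hW₂ : IsOpen W₂ := hs₂'.isOpen_inter_preimage hg.1
  -- The second footpoint is recovered from its fibre coordinate and its image in `M`, the latter
  -- being that of the first footpoint.
  let b : Tan a × F × ℝ → Y × Y := fun z => (s z.1, gπ (𝒢.π (s z.1), z.2.1))
  have hb : ∀ z ∈ W₂, SmoothAt b z := fun z hz =>
    (SmoothAt.comp (hs _ hz.1) (smoothAt_id z).fst).prodMk
      (SmoothAt.comp (hg.smoothAt hz.2) (hs₂ z hz.1))
  have hb' : SmoothOnOpen b W₂ := smoothOnOpen_iff.2 ⟨hW₂, hb⟩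
  let W : Set (Tan a × F × ℝ) := (W₂ ∩ b ⁻¹' (U ∩ U')) ∩ {z | z.2.2 ∈ Ioo (-Real.pi) Real.pi}
  have hWo : IsOpen W := (hb'.isOpen_inter_preimage (hU.inter hgσ.1)).inter
    (isOpen_Ioo.preimage (continuous_snd.comp continuous_snd))
  let D : Tan a × F × ℝ → 𝒢.P.Total := fun z => Circle.exp z.2.2 • τP p₀ • gσ (b z)
  have hD : SmoothOnOpen D W := by
    refine smoothOnOpen_iff.2 ⟨hWo, fun z hz => ?_⟩
    refine 𝒢.P.smoothAt_exp_smul (smoothAt_id z).snd.snd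
      ((𝒢.P.smoothMap_smul _).comp_smoothAt ?_)
    exact SmoothAt.comp (hgσ.smoothAt hz.1.2.2) (hb z hz.1.1)
  -- both are inverse to each other
  have hkey : ∀ z ∈ W, 𝒢.P.proj (D z) = b z ∧ τP (D z) = Circle.exp z.2.2 * τP p₀ ∧ D z ∈ A ∧
      N (D z) = D z ∧ 𝒢.y₂ (D z) ∈ V ∧ h (𝒢.y₂ (D z)) = z.2.1 ∧
      qY (𝒢.y₁ (D z)) = (chart a).symm z.1 := by
    intro z hz
    obtain ⟨h1, h2⟩ := hW _ hz.1.1.2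
    have h3 : 𝒢.π (gπ (𝒢.π (s z.1), z.2.1)) = 𝒢.π (s z.1) := congrArg Prod.fst h2
    have h4 : h (gπ (𝒢.π (s z.1), z.2.1)) = z.2.1 := congrArg Prod.snd h2
    have hbS : b z ∈ fibreProd 𝒢.π 𝒢.π := h3.symm
    have h5 : D z = (Circle.exp z.2.2 * τP p₀) • σP (b z) := by
      simp only [D]
      rw [hsec _ ⟨hz.1.2, hbS⟩, mul_smul]
    obtain ⟨h6, h7⟩ := 𝒢.P.triv_smul hpσ hpτ ⟨hz.1.2.1, hbS⟩ (Circle.exp z.2.2 * τP p₀)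
    rw [← h5] at h6 h7
    have h8 : 𝒢.y₁ (D z) = s z.1 := congrArg Prod.fst h6
    have h9 : 𝒢.y₂ (D z) = gπ (𝒢.π (s z.1), z.2.1) := congrArg Prod.snd h6
    obtain ⟨h10, h11⟩ := hNself _ hz.1.1.1.2 (D z) h8
    refine ⟨h6, h7, h10, h11, by rw [h9]; exact h1, by rw [h9]; exact h4, ?_⟩
    rw [h8, hqσ _ hz.1.1.1.2]
  have hϑD : ∀ z ∈ W, ϑ (D z) = Circle.exp z.2.2 := fun z hz => by
    simp only [ϑ]
    rw [(hkey z hz).2.1, mul_inv_cancel_right]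
  have hDO : ∀ z ∈ W, D z ∈ O := by
    intro z hz
    obtain ⟨h1, h2, h3, h4, h5, h6, h7⟩ := hkey z hz
    refine ⟨h3, ?_⟩
    rw [mem_preimage, h4]
    refine ⟨⟨h5, by rw [h1]; exact hz.1.2⟩, ?_⟩
    rw [mem_preimage, hϑD z hz, Complex.mem_slitPlane_iff_arg]
    refine ⟨?_, Circle.coe_ne_zero _⟩
    rw [Circle.arg_exp hz.2.1 hz.2.2.le]
    exact hz.2.2.ne
  have hCD : ∀ z ∈ W, C (D z) = z := by
    intro z hz
    obtain ⟨h1, h2, h3, h4, h5, h6, h7⟩ := hkey z hz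
    simp only [C]
    rw [h4, h7, h6, hϑD z hz, Circle.arg_exp hz.2.1 hz.2.2.le,
      (chart a).right_inv hz.1.1.1.1]
  have hbC : ∀ p ∈ O, b (C p) = 𝒢.P.proj (N p) := by
    intro p hp
    have h1 : s (C p).1 = 𝒢.y₁ (N p) := by
      simp only [s, C]
      rw [(chart a).left_inv hp.1.2, hNy₁ p hp.1]
    have h2 := (hV (𝒢.y₂ (N p)) hp.2.1.1).2
    simp only [b]
    rw [h1, 𝒢.π_y₁, 𝒢.proj_eq]
    exact congrArg _ h2
  have hCW : ∀ p ∈ O, C p ∈ W := by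
    intro p hp
    have h1 : s (C p).1 = 𝒢.y₁ (N p) := congrArg Prod.fst (hbC p hp)
    have h2 : (C p).1 ∈ W₁ := ⟨(chart a).map_source hp.1.2, by
      simp only [C, mem_preimage]
      rw [(chart a).left_inv hp.1.2]
      exact hp.1⟩
    refine ⟨⟨⟨h2, ?_⟩, ?_⟩, ?_, ?_⟩
    · rw [mem_preimage, h1, 𝒢.π_y₁]
      exact (hV (𝒢.y₂ (N p)) hp.2.1.1).1
    · rw [mem_preimage, hbC p hp]
      exact hp.2.1.2
    · exact Complex.neg_pi_lt_arg _
    · exact lt_of_le_of_ne (Complex.arg_le_pi _) (Complex.mem_slitPlane_iff_arg.1 hp.2.2).1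
  have hDC : ∀ p ∈ O, D (C p) = N p := by
    intro p hp
    have h1 : Circle.exp (C p).2.2 = ϑ (N p) := Circle.exp_arg _
    have h2 : 𝒢.P.proj (N p) ∈ (U ∩ U') ∩ fibreProd 𝒢.π 𝒢.π := ⟨hp.2.1.2, 𝒢.P.proj_mem _⟩
    simp only [D]
    rw [h1, hbC p hp, hsec _ h2, smul_smul]
    simp only [ϑ]
    rw [inv_mul_cancel_right]
    exact (hpτ (N p) h2.1.1).symm
  have hp₀ : p₀ ∈ O := by
    obtain ⟨h1, h2⟩ := hNself a haΩ p₀ hσa.symm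
    refine ⟨h1, ?_⟩
    rw [mem_preimage, h2]
    refine ⟨⟨hxV, hbU, hbU'⟩, ?_⟩
    simp [ϑ]
  refine nonempty_quotientChart_of_prod₃ (ContinuousLinearEquiv.refl ℝ (Tan a × F × ℝ))
    (O := ρ '' O) (W := W) (C := C) (D := D) ⟨p₀, hp₀, rfl⟩ (by rw [hOρ]; exact hC) hD
    (fun p hp => hCW p (by rw [← hOρ]; exact hp)) (fun z hz => ⟨D z, hDO z hz, rfl⟩) hCD
    (fun p hp => by rw [hDC p (by rw [← hOρ]; exact hp), hρN]) fun p p' hpp hp => ?_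
  have hp : p ∈ O := by rw [← hOρ]; exact hp
  obtain ⟨g, rfl⟩ := (hfib _ _).1 hpp
  simp only [C]
  rw [hqg, hNg p hp.1]

end EquivariantGerbe

end QuotientBundle

/-! ### The quotient gerbe -/

section QuotientGerbe

variable {G : Type u} [Group G] [TopologicalSpace G] [SmoothManifold G] [IsLieGroup G]
variable {M : Type u} [TopologicalSpace M] [SmoothManifold M] [MulAction G M] [IsSmoothAction G M]
variable {Y : Type u} [TopologicalSpace Y] [SmoothManifold Y] [MulAction G Y]
variable {Mbar : Type u} [TopologicalSpace Mbar] [SmoothManifold Mbar]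
variable {Ybar : Type u} [TopologicalSpace Ybar] [SmoothManifold Ybar]
variable {L : Type*} [TopologicalSpace L] [SmoothManifold L]

namespace EquivariantGerbe

variable (𝒢 : EquivariantGerbe G M Y)

theorem exists_principalQuotient {qY : Y → Ybar} (hqY : IsPrincipalQuotient G qY) :
    ∃ (X : Type u) (_ : TopologicalSpace X) (_ : SmoothManifold X) (ρ : 𝒢.P.Total → X),
      IsPrincipalQuotient G ρ := by
  have := 𝒢.smooth_smul_P
  have := 𝒢.smooth_smul_Y
  have hcont : ContinuousConstSMul G 𝒢.P.Total :=
    ⟨fun g => (smoothMap_const_smul (G := G) (M := 𝒢.P.Total) g).continuous⟩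
  let ρ : 𝒢.P.Total → Quotient (MulAction.orbitRel G 𝒢.P.Total) := Quotient.mk _
  have hρ : IsOpenQuotientMap ρ := MulAction.isOpenQuotientMap_quotientMk
  have hfib : ∀ p p', ρ p = ρ p' ↔ ∃ g : G, g • p = p' := by
    intro p p'
    rw [eq_comm]
    exact Quotient.eq.trans (MulAction.orbitRel_apply.trans MulAction.mem_orbit_iff)
  have hT2Y := SmoothManifold.instT2 (M := Ybar)
  have hT2P := SmoothManifold.instT2 (M := 𝒢.P.Total)
  have hqy : SmoothMap fun p => qY (𝒢.y₁ p) := hqY.smooth.comp 𝒢.smoothMap_y₁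
  -- The orbit relation is closed: it says that the first footpoints have the same image in `Y/G`, a
  -- closed condition, and that the element of `G` matching these footpoints also matches the points
  -- of `P`. That element depends continuously on the pair.
  have hT2 : T2Space (Quotient (MulAction.orbitRel G 𝒢.P.Total)) := by
    refine (t2Space_iff_of_isOpenQuotientMap hρ).2 ?_
    let S : Set (𝒢.P.Total × 𝒢.P.Total) := {x | qY (𝒢.y₁ x.1) = qY (𝒢.y₁ x.2)}
    have hS : IsClosed S := isClosed_eq (hqy.continuous.comp continuous_fst)
      (hqy.continuous.comp continuous_snd)
    let f : 𝒢.P.Total × 𝒢.P.Total → 𝒢.P.Total × 𝒢.P.Total :=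
      fun x => (actDiv G (𝒢.y₁ x.1) (𝒢.y₁ x.2) • x.2, x.1)
    have hf : ContinuousOn f S := by
      intro x hx
      have h1 : SmoothAtW (fun x : 𝒢.P.Total × 𝒢.P.Total => actDiv G (𝒢.y₁ x.1) (𝒢.y₁ x.2)) S x :=
        SmoothAtW.comp (f := fun x : 𝒢.P.Total × 𝒢.P.Total => (𝒢.y₁ x.1, 𝒢.y₁ x.2))
          (hqY.smoothAtW_div (p := (𝒢.y₁ x.1, 𝒢.y₁ x.2)) hx)
          (((𝒢.smoothMap_y₁.comp_smoothAt (smoothAt_id x).fst).prodMk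
            (𝒢.smoothMap_y₁.comp_smoothAt (smoothAt_id x).snd)).smoothAtW S) hx
          (Eventually.of_forall fun _ h => h)
      have h2 : SmoothAtW f S x :=
        (h1.act ((smoothAt_id x).snd.smoothAtW S)).prodMk ((smoothAt_id x).fst.smoothAtW S)
      obtain ⟨f', hf', hff'⟩ := h2.exists_smoothAt
      refine hf'.continuousAt.continuousWithinAt.congr_of_eventuallyEq ?_ (hff'.self_of_nhds hx)
      exact eventually_nhdsWithin_iff.2 hff'
    have h1 := hf.preimage_isClosed_of_isClosed hS isClosed_diagonal
    convert h1 using 1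
    ext ⟨p, p'⟩
    simp only [mem_ofPred_eq, hfib, S, f, mem_inter_iff, mem_preimage, mem_diagonal_iff]
    constructor
    · rintro ⟨g, rfl⟩
      have h2 : g⁻¹ • 𝒢.y₁ (g • p) = 𝒢.y₁ p := by rw [𝒢.y₁_smul, inv_smul_smul]
      refine ⟨by rw [𝒢.y₁_smul, hqY.apply_smul], ?_⟩
      rw [hqY.div_eq h2, inv_smul_smul]
    · rintro ⟨-, h⟩
      exact ⟨(actDiv G (𝒢.y₁ p) (𝒢.y₁ p'))⁻¹, by rw [inv_smul_eq_iff, h]⟩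
  have hc : ∀ x, Nonempty (QuotientChart ρ x) := by
    intro x
    obtain ⟨p, rfl⟩ := hρ.surjective x
    exact 𝒢.nonempty_quotientChart hqY hfib p
  obtain ⟨m, hm, hsec⟩ := exists_quotient_manifold hρ fun x => (hc x).some
  exact ⟨_, _, m, ρ, hqY.of_equivariant 𝒢.smoothMap_y₁ 𝒢.y₁_smul hm hρ.surjective hfib hsec⟩

variable {q : M → Mbar} (hq : IsPrincipalQuotient G q)
variable {qY : Y → Ybar} (hqY : IsPrincipalQuotient G qY)

include hq hqY

/-- Two such points differ by some `g`, which fixes their common image in `M` and is trivial since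
`G` acts freely there. So `Y → M × Y/G` is injective. -/
theorem eq_of_π_eq {y y' : Y} (h : qY y = qY y') (hπ : 𝒢.π y = 𝒢.π y') : y = y' := by
  obtain ⟨g, rfl⟩ := (hqY.fiber y y').1 h
  rw [𝒢.π_smul] at hπ
  rw [hq.free g _ hπ.symm, one_smul]

/-- The orbits of three elements that form a triangle contain elements that form a triangle. -/
theorem isTriangle_align {p p' p'' : 𝒢.P.Total} (h₁ : qY (𝒢.y₂ p) = qY (𝒢.y₂ p'))
    (h₂ : qY (𝒢.y₁ p) = qY (𝒢.y₂ p'')) (h₃ : qY (𝒢.y₁ p'') = qY (𝒢.y₁ p')) :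
    IsTriangle 𝒢.P.proj p (𝒢.align₂ (𝒢.y₂ p) p') (𝒢.align₂ (𝒢.y₁ p) p'') := by
  have e1 := 𝒢.y₂_align₂ hqY h₁
  have e2 := 𝒢.y₂_align₂ hqY h₂
  refine ⟨e2, 𝒢.eq_of_π_eq hq hqY ?_ ?_, e1.symm⟩
  · change qY (𝒢.y₁ (𝒢.align₂ (𝒢.y₁ p) p'')) = qY (𝒢.y₁ (𝒢.align₂ (𝒢.y₂ p) p'))
    rw [align₂, align₂, y₁_smul, y₁_smul, hqY.apply_smul, hqY.apply_smul, h₃]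
  · change 𝒢.π (𝒢.y₁ (𝒢.align₂ (𝒢.y₁ p) p'')) = 𝒢.π (𝒢.y₁ (𝒢.align₂ (𝒢.y₂ p) p'))
    rw [𝒢.π_y₁, 𝒢.π_y₁, e1, e2, 𝒢.π_y₁]

/-- A local section of `q` determines a local section `s` of `qY` whose values lie over it. On this
slice `π` corresponds to `πbar`, and a product decomposition of `π` restricts to one of `πbar`. -/
theorem quotient_submersion {πbar : Ybar → Mbar} (hπ : ∀ y, πbar (qY y) = q (𝒢.π y)) :
    IsSubmersion πbar := by
  have := 𝒢.smooth_smul_Y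
  have hπs : SmoothMap πbar := hqY.smoothMap_of_comp (by
    simp only [hπ]
    exact hq.smooth.comp 𝒢.submersion.1)
  refine ⟨hπs, fun b => ?_⟩
  obtain ⟨y, rfl⟩ := hqY.surjective b
  obtain ⟨σM', ⟨U', hU', hσM''⟩, hσMy, hqσM''⟩ := hq.exists_section (𝒢.π y)
  obtain ⟨U, hUU, hUo, hyU⟩ := mem_nhds_iff.1 (inter_mem (hσM''.1.mem_nhds hU') hqσM'')
  have hσM : SmoothOnOpen σM' U := hσM''.mono hUo fun x hx => (hUU hx).1
  have hqσM : ∀ x ∈ U, q (σM' x) = x := fun x hx => (hUU hx).2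
  obtain ⟨σY, ⟨V', hV', hσY'⟩, hσYy, hqσY'⟩ := hqY.exists_section y
  obtain ⟨V, hVV, hVo, hyV⟩ := mem_nhds_iff.1 (inter_mem (hσY'.1.mem_nhds hV') hqσY')
  have hσY : SmoothOnOpen σY V := hσY'.mono hVo fun x hx => (hVV hx).1
  have hqσY : ∀ x ∈ V, qY (σY x) = x := fun x hx => (hVV hx).2
  -- the section of `qY` compatible with that of `q`
  let A : Set Ybar := V ∩ πbar ⁻¹' U
  have hA : IsOpen A := hVo.inter (hUo.preimage hπs.continuous)
  -- An arbitrary section `σY` is corrected by the element of `G` that moves its image in `M` onto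
  -- `σM'`.
  let s : Ybar → Y := fun b => actDiv G (σM' (πbar b)) (𝒢.π (σY b)) • σY b
  have hqs : ∀ b ∈ A, q (σM' (πbar b)) = q (𝒢.π (σY b)) := fun b hb => by
    rw [hqσM _ hb.2, ← hπ, hqσY b hb.1]
  have hs : SmoothOnOpen s A := by
    refine smoothOnOpen_iff.2 ⟨hA, fun b hb => ?_⟩
    refine SmoothAt.act (hq.smoothAt_div ((hσM.smoothAt hb.2).comp (hπs.smoothAt b))
      (𝒢.submersion.1.comp_smoothAt (hσY.smoothAt hb.1)) ?_) (hσY.smoothAt hb.1)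
    filter_upwards [hA.mem_nhds hb] with b' hb' using hqs b' hb'
  have hπs' : ∀ b ∈ A, 𝒢.π (s b) = σM' (πbar b) := fun b hb => by
    simp only [s]
    rw [𝒢.π_smul, hq.div_smul (hqs b hb)]
  have hqYs : ∀ b ∈ A, qY (s b) = b := fun b hb => by
    simp only [s]
    rw [hqY.apply_smul, hqσY b hb.1]
  have hyA : qY y ∈ A := ⟨hyV, by rw [mem_preimage, hπ]; exact hyU⟩
  have hsy : s (qY y) = y := by
    refine 𝒢.eq_of_π_eq hq hqY (hqYs _ hyA) ?_
    rw [hπs' _ hyA, hπ, hσMy]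
  obtain ⟨F, _, _, _, _, _, _, _, Vπ, Wπ, h, g, hyVπ, hh, hg, h1, h2⟩ := 𝒢.submersion.2 y
  let W₁ : Set (Mbar × F) := {z | z.1 ∈ U}
  have hm₁ : ∀ z ∈ W₁, SmoothAt (fun z : Mbar × F => (σM' z.1, z.2)) z := fun z hz =>
    (SmoothAt.comp (hσM.smoothAt hz) (smoothAt_id z).fst).prodMk (smoothAt_id z).snd
  have hm : SmoothOnOpen (fun z : Mbar × F => (σM' z.1, z.2)) W₁ :=
    smoothOnOpen_iff.2 ⟨hUo.preimage continuous_fst, hm₁⟩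
  let W₂ : Set (Mbar × F) := W₁ ∩ (fun z => (σM' z.1, z.2)) ⁻¹' Wπ
  have hW₂ : IsOpen W₂ := hm.isOpen_inter_preimage hg.1
  have hg₂ : SmoothOnOpen (fun z : Mbar × F => qY (g (σM' z.1, z.2))) W₂ :=
    smoothOnOpen_iff.2 ⟨hW₂, fun z hz => hqY.smooth.comp_smoothAt
      (SmoothAt.comp (f := fun z : Mbar × F => (σM' z.1, z.2)) (hg.smoothAt hz.2) (hm₁ z hz.1))⟩
  let W : Set (Mbar × F) := W₂ ∩ (fun z => qY (g (σM' z.1, z.2))) ⁻¹' A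
  have hW : IsOpen W := hg₂.isOpen_inter_preimage hA
  refine ⟨F, inferInstance, inferInstance, inferInstance, inferInstance, inferInstance,
    inferInstance, inferInstance, A ∩ s ⁻¹' Vπ, W, fun b => h (s b),
    fun z => qY (g (σM' z.1, z.2)), ⟨hyA, by rw [mem_preimage, hsy]; exact hyVπ⟩, ?_,
    hg₂.mono hW inter_subset_left, ?_, ?_⟩
  · exact hh.comp (hs.mono (hs.isOpen_inter_preimage hh.1) inter_subset_left) fun b hb => hb.2
  · rintro b ⟨hb, hb'⟩
    obtain ⟨h3, h4⟩ := h1 (s b) hb'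
    rw [hπs' b hb] at h3 h4
    have h5 : qY (g (σM' (πbar b), h (s b))) = b := by rw [h4, hqYs b hb]
    refine ⟨⟨⟨hb.2, h3⟩, ?_⟩, h5⟩
    simp only [mem_preimage, h5]
    exact hb
  · rintro ⟨m, c⟩ ⟨⟨hm₁, hm₂⟩, hA'⟩
    simp only [mem_preimage] at hm₂ hA'
    have hm₁ : m ∈ U := hm₁
    obtain ⟨h3, h4⟩ := h2 _ hm₂
    have h5 : 𝒢.π (g (σM' m, c)) = σM' m := congrArg Prod.fst h4
    have h6 : h (g (σM' m, c)) = c := congrArg Prod.snd h4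
    have h7 : πbar (qY (g (σM' m, c))) = m := by rw [hπ, h5, hqσM m hm₁]
    have h8 : s (qY (g (σM' m, c))) = g (σM' m, c) := by
      refine 𝒢.eq_of_π_eq hq hqY (hqYs _ hA') ?_
      rw [hπs' _ hA', h7, h5]
    refine ⟨⟨hA', ?_⟩, ?_⟩
    · rw [mem_preimage, h8]
      exact h3
    · simp only [h7, h8, h6]

/-- A pair in `Y/G` over one point of `M/G` lifts to `Y^{[2]}`: lift both entries, then translate
the second until the images in `M` agree. This lift `Λ` is unique once the first entry is fixed, so
trivialisations of `P` along `Λ` trivialise `P/G`. -/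
theorem exists_quotient_bundle {πbar : Ybar → Mbar} (hπ : ∀ y, πbar (qY y) = q (𝒢.π y)) :
    ∃ (Pbar : CircleBundle (Ybar × Ybar) (fibreProd πbar πbar)) (ρ : 𝒢.P.Total → Pbar.Total),
      IsPrincipalQuotient G ρ ∧ (∀ (z : Circle) p, ρ (z • p) = z • ρ p) ∧
      ∀ p, Pbar.proj (ρ p) = (qY (𝒢.y₁ p), qY (𝒢.y₂ p)) := by
  have := 𝒢.smooth_smul_Y
  have := 𝒢.smooth_smul_P
  obtain ⟨X, _, _, ρ, hρ⟩ := 𝒢.exists_principalQuotient hqY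
  let r : X → 𝒢.P.Total := Function.surjInv hρ.surjective
  have hr : ∀ x, ρ (r x) = x := Function.surjInv_eq hρ.surjective
  have hrg : ∀ p, ∃ g : G, g • p = r (ρ p) := fun p => (hρ.fiber _ _).1 (hr (ρ p)).symm
  have hsmul : ∀ (z : Circle) p, ρ (z • r (ρ p)) = ρ (z • p) := by
    intro z p
    obtain ⟨g, hg⟩ := hrg p
    rw [← hg, ← 𝒢.smul_circle_smul, hρ.apply_smul]
  let act : MulAction Circle X :=
    { smul := fun z x => ρ (z • r x)
      one_smul := fun x => by
        change ρ ((1 : Circle) • r x) = x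
        rw [one_smul, hr]
      mul_smul := fun z z' x => by
        change ρ ((z * z') • r x) = ρ (z • r (ρ (z' • r x)))
        rw [hsmul, mul_smul] }
  have hact : ∀ (z : Circle) p, ρ (z • p) = z • ρ p := fun z p => (hsmul z p).symm
  let proj : X → Ybar × Ybar := fun x => (qY (𝒢.y₁ (r x)), qY (𝒢.y₂ (r x)))
  have hproj : ∀ p, proj (ρ p) = (qY (𝒢.y₁ p), qY (𝒢.y₂ p)) := by
    intro p
    obtain ⟨g, hg⟩ := hrg p
    simp only [proj]
    rw [← hg, y₁_smul, y₂_smul, hqY.apply_smul, hqY.apply_smul]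
  have hsproj : SmoothMap proj := hρ.smoothMap_of_comp (by
    simp only [hproj]
    exact (hqY.smooth.comp 𝒢.smoothMap_y₁).prodMk (hqY.smooth.comp 𝒢.smoothMap_y₂))
  have hproj_mem : ∀ x, proj x ∈ fibreProd πbar πbar := fun x => by
    change πbar _ = πbar _
    rw [hπ, hπ, 𝒢.π_y₁]
  have hproj_smul : ∀ (z : Circle) x, proj (z • x) = proj x := by
    intro z x
    obtain ⟨p, rfl⟩ := hρ.surjective x
    rw [← hact, hproj, hproj]
    have := 𝒢.P.proj_smul z p
    rw [BundleGerbe.y₁, BundleGerbe.y₂, this]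
    rfl
  have hfree : ∀ (z : Circle) (x : X), z • x = x → z = 1 := by
    intro z x hz
    obtain ⟨p, rfl⟩ := hρ.surjective x
    rw [← hact] at hz
    -- Such a `g` fixes the first footpoint, which the circle does not move, and is trivial by
    -- freeness on `Y`.
    obtain ⟨g, hg⟩ := (hρ.fiber _ _).1 hz
    have h1 : 𝒢.y₁ (g • z • p) = 𝒢.y₁ p := by rw [hg]
    rw [y₁_smul, show 𝒢.y₁ (z • p) = 𝒢.y₁ p from congrArg Prod.fst (𝒢.P.proj_smul z p)] at h1
    rw [hqY.free g _ h1, one_smul] at hg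
    exact 𝒢.P.free z p hg
  have hsact : SmoothMap (fun x : X × ℝ => Circle.exp x.2 • x.1) := by
    refine smoothMap_iff.2 fun ⟨x, t⟩ => ?_
    obtain ⟨σ, hσ, hρσ⟩ := hρ.exists_section' x
    have h1 : SmoothAt (fun x : X × ℝ => Circle.exp x.2 • σ x.1) (x, t) :=
      𝒢.P.smoothAt_exp_smul (smoothAt_id _).snd
        (SmoothAt.comp (g := σ) (f := fun x : X × ℝ => x.1) hσ (smoothAt_id _).fst)
    refine (hρ.smooth.comp_smoothAt h1).congr ?_
    have h2 : Tendsto (fun x : X × ℝ => x.1) (𝓝 (x, t)) (𝓝 x) := continuous_fst.tendsto _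
    filter_upwards [h2.eventually hρσ] with x' hx'
    rw [hact, hx']
  have htriv : ∀ b ∈ fibreProd πbar πbar, ∃ (U : Set (Ybar × Ybar)) (σ : Ybar × Ybar → X)
      (τ : X → Circle), IsOpen U ∧ b ∈ U ∧ SmoothOnSubset σ (U ∩ fibreProd πbar πbar) ∧
      SmoothOnOpen (fun p => (τ p : ℂ)) (proj ⁻¹' U) ∧
      (∀ b' ∈ U ∩ fibreProd πbar πbar, proj (σ b') = b') ∧
      ∀ p ∈ proj ⁻¹' U, p = τ p • σ (proj p) := by
    rintro ⟨b₁, b₂⟩ hb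
    have hb : πbar b₁ = πbar b₂ := hb
    obtain ⟨σ₁, ⟨U₁, hU₁, hσ₁⟩, hqσ₁⟩ := hqY.exists_section' b₁
    obtain ⟨V₁, hV₁, hV₁o, hbV₁⟩ := mem_nhds_iff.1 hqσ₁
    obtain ⟨σ₂, ⟨U₂, hU₂, hσ₂⟩, hqσ₂⟩ := hqY.exists_section' b₂
    obtain ⟨V₂, hV₂, hV₂o, hbV₂⟩ := mem_nhds_iff.1 hqσ₂
    let S := fibreProd πbar πbar
    let Λ : Ybar × Ybar → Y × Y := fun b =>
      (σ₁ b.1, actDiv G (𝒢.π (σ₁ b.1)) (𝒢.π (σ₂ b.2)) • σ₂ b.2)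
    let A : Set (Ybar × Ybar) := (U₁ ∩ V₁) ×ˢ (U₂ ∩ V₂)
    have hA : IsOpen A := (hσ₁.1.inter hV₁o).prod (hσ₂.1.inter hV₂o)
    have hqπ : ∀ b ∈ A ∩ S, q (𝒢.π (σ₁ b.1)) = q (𝒢.π (σ₂ b.2)) := by
      rintro b ⟨hbA, hbS⟩
      rw [← hπ, ← hπ, hV₁ hbA.1.2, hV₂ hbA.2.2]
      exact hbS
    have hΛ : ∀ b ∈ A ∩ S, SmoothAtW Λ S b := by
      rintro b ⟨hbA, hbS⟩
      have h1 : SmoothAt (fun b : Ybar × Ybar => σ₁ b.1) b :=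
        SmoothAt.comp (hσ₁.smoothAt hbA.1.1) (smoothAt_id b).fst
      have h2 : SmoothAt (fun b : Ybar × Ybar => σ₂ b.2) b :=
        SmoothAt.comp (hσ₂.smoothAt hbA.2.1) (smoothAt_id b).snd
      have h3 : SmoothAtW (fun b : Ybar × Ybar => actDiv G (𝒢.π (σ₁ b.1)) (𝒢.π (σ₂ b.2))) S b :=
        SmoothAtW.comp (f := fun b : Ybar × Ybar => (𝒢.π (σ₁ b.1), 𝒢.π (σ₂ b.2)))
          (hq.smoothAtW_div (p := (𝒢.π (σ₁ b.1), 𝒢.π (σ₂ b.2))) (hqπ b ⟨hbA, hbS⟩))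
          (((𝒢.submersion.1.comp_smoothAt h1).prodMk
            (𝒢.submersion.1.comp_smoothAt h2)).smoothAtW S) hbS (by
            filter_upwards [hA.mem_nhds hbA] with b' hb' hbS' using hqπ b' ⟨hb', hbS'⟩)
      exact (h1.smoothAtW S).prodMk (h3.act (h2.smoothAtW S))
    have hΛS : ∀ b ∈ A ∩ S, Λ b ∈ fibreProd 𝒢.π 𝒢.π := by
      intro b hb
      change 𝒢.π _ = 𝒢.π _
      simp only [Λ]
      rw [𝒢.π_smul, hq.div_smul (hqπ b hb)]
    have hqΛ : ∀ b ∈ A, (qY (Λ b).1, qY (Λ b).2) = b := by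
      intro b hb
      simp only [Λ]
      rw [hqY.apply_smul, hV₁ hb.1.2, hV₂ hb.2.2]
    have hbAS : (b₁, b₂) ∈ A ∩ S := ⟨⟨⟨hU₁, hbV₁⟩, hU₂, hbV₂⟩, hb⟩
    obtain ⟨UP, σP, τP, hUP, hbUP, hσP, hτP, hpσ, hpτ⟩ :=
      𝒢.P.locally_trivial (Λ (b₁, b₂)) (hΛS _ hbAS)
    obtain ⟨U', Λ', hbU', hΛ', hΛΛ'⟩ := hΛ _ hbAS
    let U : Set (Ybar × Ybar) := (U' ∩ Λ' ⁻¹' UP) ∩ A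
    have hU : IsOpen U := (hΛ'.isOpen_inter_preimage hUP).inter hA
    have hΛU : ∀ b ∈ U ∩ S, Λ b ∈ UP ∩ fibreProd 𝒢.π 𝒢.π := fun b hb =>
      ⟨by rw [hΛΛ' b ⟨hb.1.1.1, hb.2⟩]; exact hb.1.1.2, hΛS b ⟨hb.1.2, hb.2⟩⟩
    -- `N p` is the element of the orbit of `p` that lies over the image of `Λ`; the trivialisation
    -- of `P/G` is read off from it.
    let N : 𝒢.P.Total → 𝒢.P.Total := fun p => 𝒢.align (σ₁ (qY (𝒢.y₁ p))) p
    have hqN : ∀ p, proj (ρ p) ∈ U → qY (σ₁ (qY (𝒢.y₁ p))) = qY (𝒢.y₁ p) := by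
      intro p hp
      rw [hproj] at hp
      exact hV₁ hp.2.1.2
    have hNg : ∀ p, proj (ρ p) ∈ U → ∀ g : G, N (g • p) = N p := by
      intro p hp g
      simp only [N]
      rw [y₁_smul, hqY.apply_smul]
      exact 𝒢.align_smul hqY (hqN p hp) g
    have hNproj : ∀ p, proj (ρ p) ∈ U → 𝒢.P.proj (N p) = Λ (proj (ρ p)) := by
      intro p hp
      have h1 : 𝒢.y₁ (N p) = (Λ (proj (ρ p))).1 := by
        simp only [Λ, hproj]
        exact 𝒢.y₁_align hqY (hqN p hp)
      refine Prod.ext h1 (𝒢.eq_of_π_eq hq hqY ?_ ?_)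
      · have h2 := congrArg Prod.snd (hqΛ _ hp.2)
        simp only [hproj] at h2 ⊢
        rw [h2]
        change qY (𝒢.y₂ (N p)) = _
        simp only [N, align]
        rw [y₂_smul, hqY.apply_smul]
      · have h2 : 𝒢.π _ = 𝒢.π _ := hΛS _ ⟨hp.2, hproj_mem (ρ p)⟩
        rw [← h2, ← h1, 𝒢.π_y₁]
        rfl
    have hτN : ∀ p, proj (ρ p) ∈ U → N (r (ρ p)) = N p := by
      intro p hp
      obtain ⟨g, hg⟩ := hrg p
      rw [← hg, hNg p hp]
    refine ⟨U, fun b => ρ (σP (Λ b)), fun x => τP (N (r x)), hU,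
      ⟨⟨hbU', by rw [mem_preimage, ← hΛΛ' _ ⟨hbU', hbAS.2⟩]; exact hbUP⟩, hbAS.1⟩, ?_, ?_, ?_, ?_⟩
    · intro b hbUS
      have h1 : SmoothAtW σP (UP ∩ fibreProd 𝒢.π 𝒢.π) (Λ b) := hσP _ (hΛU b hbUS)
      have h2 : SmoothAtW Λ (U ∩ S) b := (hΛ b ⟨hbUS.1.2, hbUS.2⟩).mono inter_subset_right
      exact hρ.smooth.comp_smoothAtW (h1.comp h2 hbUS (Eventually.of_forall hΛU))
    · refine smoothOnOpen_iff.2 ⟨hU.preimage hsproj.continuous, fun x hx => ?_⟩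
      obtain ⟨p, rfl⟩ := hρ.surjective x
      refine hρ.smoothAt_of_comp (f := fun x => (τP (N (r x)) : ℂ)) ?_
      have hnear : ∀ᶠ p' in 𝓝 p, proj (ρ p') ∈ U :=
        ((hU.preimage hsproj.continuous).preimage hρ.smooth.continuous).mem_nhds hx
      have hy : SmoothAt (fun p => qY (𝒢.y₁ p)) p := (hqY.smooth.comp 𝒢.smoothMap_y₁).smoothAt p
      have hx' : qY (𝒢.y₁ p) ∈ U₁ := by
        have h1 := hx.2.1.1
        rwa [hproj] at h1
      have hN : SmoothAt N p := 𝒢.smoothAt_align hqY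
        (SmoothAt.comp (f := fun p => qY (𝒢.y₁ p)) (hσ₁.smoothAt hx') hy) (smoothAt_id p)
        (hnear.mono fun p' hp' => hqN p' hp')
      have hNU : N p ∈ 𝒢.P.proj ⁻¹' UP := by
        rw [mem_preimage, hNproj p hx]
        exact (hΛU _ ⟨hx, hproj_mem _⟩).1
      refine (SmoothAt.comp (f := N) (g := fun p => (τP p : ℂ)) (hτP.smoothAt hNU) hN).congr ?_
      filter_upwards [hnear] with p' hp'
      rw [hτN p' hp']
    · intro b hbUS
      simp only [hproj]
      rw [BundleGerbe.y₁, BundleGerbe.y₂, hpσ _ (hΛU b hbUS)]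
      exact hqΛ b hbUS.1.2
    · intro x hx
      obtain ⟨p, rfl⟩ := hρ.surjective x
      have hNU : N p ∈ 𝒢.P.proj ⁻¹' UP := by
        rw [mem_preimage, hNproj p hx]
        exact (hΛU _ ⟨hx, hproj_mem _⟩).1
      change ρ p = τP (N (r (ρ p))) • ρ (σP (Λ (proj (ρ p))))
      rw [hτN p hx, ← hact, ← hNproj p hx, ← hpτ (N p) hNU]
      exact (hρ.apply_smul _ _).symm
  exact ⟨{
    Total := X
    act := act
    proj := proj
    proj_mem := hproj_mem
    smooth_proj := hsproj
    smooth_act := hsact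
    proj_smul := hproj_smul
    free := hfree
    locally_trivial := htriv }, ρ, hρ, hact, hproj⟩

end EquivariantGerbe

end QuotientGerbe

/-! ### The quotient gerbe -/

section QuotientGerbe

variable {G : Type u} [Group G] [TopologicalSpace G] [SmoothManifold G] [IsLieGroup G]
variable {M : Type u} [TopologicalSpace M] [SmoothManifold M] [MulAction G M] [IsSmoothAction G M]
variable {Y : Type u} [TopologicalSpace Y] [SmoothManifold Y] [MulAction G Y]
variable {Mbar : Type u} [TopologicalSpace Mbar] [SmoothManifold Mbar]
variable {Ybar : Type u} [TopologicalSpace Ybar] [SmoothManifold Ybar]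
variable {L : Type*} [TopologicalSpace L] [SmoothManifold L]

namespace EquivariantGerbe

variable (𝒢 : EquivariantGerbe G M Y)
variable {q : M → Mbar} (hq : IsPrincipalQuotient G q)
variable {qY : Y → Ybar} (hqY : IsPrincipalQuotient G qY)

include hqY

theorem smoothAtW_align₂ {y : L → Y} {p : L → 𝒢.P.Total} {S : Set L} {l : L} (hy : SmoothAtW y S l)
    (hp : SmoothAtW p S l) (hl : l ∈ S)
    (h : ∀ᶠ l in 𝓝 l, l ∈ S → qY (y l) = qY (𝒢.y₂ (p l))) :
    SmoothAtW (fun l => 𝒢.align₂ (y l) (p l)) S l := by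
  have := 𝒢.smooth_smul_P
  have hpair : SmoothAtW (fun l => (y l, 𝒢.y₂ (p l))) S l :=
    hy.prodMk (𝒢.smoothMap_y₂.comp_smoothAtW hp)
  have hl' : (y l, 𝒢.y₂ (p l)) ∈ fibreProd qY qY := h.self_of_nhds hl
  exact (SmoothAtW.comp (g := fun z : Y × Y => actDiv G z.1 z.2) 
    (f := fun l => (y l, 𝒢.y₂ (p l))) (T := fibreProd qY qY) (hqY.smoothAtW_div hl') hpair hl h).act hp

variable {S : Set (Ybar × Ybar)} {Pbar : CircleBundle (Ybar × Ybar) S} {ρ : 𝒢.P.Total → Pbar.Total}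
variable (hρ : IsPrincipalQuotient G ρ)
variable (hproj : ∀ p, Pbar.proj (ρ p) = (qY (𝒢.y₁ p), qY (𝒢.y₂ p)))

theorem align₂_eq {p p' : 𝒢.P.Total} (h : ∃ g : G, g • p = p') {y : Y} (hy : 𝒢.y₂ p' = y) :
    𝒢.align₂ y p = p' := by
  obtain ⟨g, rfl⟩ := h
  rw [align₂, hqY.div_eq (g := g) (by rw [← hy, y₂_smul])]

include hρ

/-- By freeness on `Y`, an orbit in `P` has at most one element over a given second footpoint. -/
theorem eq_of_y₂_eq {p p' : 𝒢.P.Total} (h : ρ p = ρ p') (hy : 𝒢.y₂ p = 𝒢.y₂ p') : p = p' := by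
  rw [← 𝒢.align₂_eq hqY ((hρ.fiber _ _).1 h.symm) hy, 𝒢.align₂_eq_self hqY rfl]

include hproj

include hq

omit hρ in
theorem isTriangle_align_of_map {p p' p'' : 𝒢.P.Total}
    (h : IsTriangle Pbar.proj (ρ p) (ρ p') (ρ p'')) :
    qY (𝒢.y₂ p) = qY (𝒢.y₂ p') ∧ qY (𝒢.y₁ p) = qY (𝒢.y₂ p'') ∧
      IsTriangle 𝒢.P.proj p (𝒢.align₂ (𝒢.y₂ p) p') (𝒢.align₂ (𝒢.y₁ p) p'') := by
  obtain ⟨h1, h2, h3⟩ := h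
  rw [hproj, hproj] at h1 h2 h3
  exact ⟨h3, h1.symm, 𝒢.isTriangle_align hq hqY h3 h1.symm h2⟩

/-- The lift of one edge may be prescribed, and the other two edges are aligned with its ends. This
allows adjacent triangles to be lifted coherently. -/
theorem exists_triangle_lift {p : 𝒢.P.Total} {x x' x'' : Pbar.Total} (hp : ρ p = x)
    (h : IsTriangle Pbar.proj x x' x'') :
    ∃ p' p'', ρ p' = x' ∧ ρ p'' = x'' ∧ IsTriangle 𝒢.P.proj p p' p'' := by
  subst hp
  obtain ⟨p', rfl⟩ := hρ.surjective x'
  obtain ⟨p'', rfl⟩ := hρ.surjective x''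
  exact ⟨_, _, hρ.apply_smul _ _, hρ.apply_smul _ _,
    (𝒢.isTriangle_align_of_map hq hqY hproj h).2.2⟩

omit hq hproj

/-- Aligned lifts of one triangle are simultaneous translates of each other and `s` is invariant, so
its value on them does not depend on the representatives. -/
theorem s_align_eq {p p' p'' r r' r'' : 𝒢.P.Total} (h : IsTriangle 𝒢.P.proj p p' p'')
    (hr : ρ r = ρ p) (hr' : ρ r' = ρ p') (hr'' : ρ r'' = ρ p'') :
    𝒢.s r (𝒢.align₂ (𝒢.y₂ r) r') (𝒢.align₂ (𝒢.y₁ r) r'') = 𝒢.s p p' p'' := by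
  obtain ⟨g, rfl⟩ := (hρ.fiber _ _).1 hr.symm
  rw [𝒢.align₂_eq hqY (p' := g • p'), 𝒢.align₂_eq hqY (p' := g • p''), 𝒢.s_invariant g _ _ _ h]
  · exact (hρ.fiber _ _).1 (by rw [hr'', hρ.apply_smul])
  · rw [y₁_smul, y₂_smul]
    exact congrArg _ h.1
  · exact (hρ.fiber _ _).1 (by rw [hr', hρ.apply_smul])
  · rw [y₂_smul, y₂_smul]
    exact congrArg _ h.2.2.symm

include hq hproj

theorem smoothOnSubset_s_bar {sbar : Pbar.Total → Pbar.Total → Pbar.Total → Circle}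
    (hs : ∀ p p' p'', IsTriangle 𝒢.P.proj p p' p'' → sbar (ρ p) (ρ p') (ρ p'') = 𝒢.s p p' p'') :
    SmoothOnSubset (fun x : Pbar.Total × Pbar.Total × Pbar.Total => (sbar x.1 x.2.1 x.2.2 : ℂ))
      {x | IsTriangle Pbar.proj x.1 x.2.1 x.2.2} := by
  have := 𝒢.smooth_smul_P
  rintro ⟨x, x', x''⟩ hx
  set T := {x : Pbar.Total × Pbar.Total × Pbar.Total | IsTriangle Pbar.proj x.1 x.2.1 x.2.2} with hT
  obtain ⟨σ, hσ, hρσ⟩ := hρ.exists_section' x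
  obtain ⟨σ', hσ', hρσ'⟩ := hρ.exists_section' x'
  obtain ⟨σ'', hσ'', hρσ''⟩ := hρ.exists_section' x''
  set X : Pbar.Total × Pbar.Total × Pbar.Total := (x, x', x'')
  have c1 : Tendsto (fun z : Pbar.Total × Pbar.Total × Pbar.Total => z.1) (𝓝 X) (𝓝 x) :=
    continuous_fst.tendsto X
  have c2 : Tendsto (fun z : Pbar.Total × Pbar.Total × Pbar.Total => z.2.1) (𝓝 X) (𝓝 x') :=
    (continuous_fst.comp continuous_snd).tendsto X
  have c3 : Tendsto (fun z : Pbar.Total × Pbar.Total × Pbar.Total => z.2.2) (𝓝 X) (𝓝 x'') :=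
    (continuous_snd.comp continuous_snd).tendsto X
  have hev : ∀ᶠ z in 𝓝 X, ρ (σ z.1) = z.1 ∧ ρ (σ' z.2.1) = z.2.1 ∧ ρ (σ'' z.2.2) = z.2.2 :=
    (c1.eventually hρσ).and ((c2.eventually hρσ').and (c3.eventually hρσ''))
  have hev' : ∀ᶠ z in 𝓝 X, z ∈ T → qY (𝒢.y₂ (σ z.1)) = qY (𝒢.y₂ (σ' z.2.1)) ∧
      qY (𝒢.y₁ (σ z.1)) = qY (𝒢.y₂ (σ'' z.2.2)) ∧ IsTriangle 𝒢.P.proj (σ z.1)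
        (𝒢.align₂ (𝒢.y₂ (σ z.1)) (σ' z.2.1)) (𝒢.align₂ (𝒢.y₁ (σ z.1)) (σ'' z.2.2)) := by
    filter_upwards [hev] with z hz hzT
    refine 𝒢.isTriangle_align_of_map hq hqY hproj ?_
    rw [hz.1, hz.2.1, hz.2.2]
    exact hzT
  have s1 : SmoothAt (fun z : Pbar.Total × Pbar.Total × Pbar.Total => σ z.1) X :=
    SmoothAt.comp (g := σ) (f := Prod.fst) hσ (smoothAt_id X).fst
  have s2 : SmoothAt (fun z : Pbar.Total × Pbar.Total × Pbar.Total => σ' z.2.1) X :=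
    SmoothAt.comp (g := σ') (f := fun z : Pbar.Total × Pbar.Total × Pbar.Total => z.2.1) hσ'
      (smoothAt_id X).snd.fst
  have s3 : SmoothAt (fun z : Pbar.Total × Pbar.Total × Pbar.Total => σ'' z.2.2) X :=
    SmoothAt.comp (g := σ'') (f := fun z : Pbar.Total × Pbar.Total × Pbar.Total => z.2.2) hσ''
      (smoothAt_id X).snd.snd
  have t2 := 𝒢.smoothAtW_align₂ hqY ((𝒢.smoothMap_y₂.comp_smoothAt s1).smoothAtW T) (s2.smoothAtW T)
    hx (hev'.mono fun z hz hzT => (hz hzT).1)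
  have t3 := 𝒢.smoothAtW_align₂ hqY ((𝒢.smoothMap_y₁.comp_smoothAt s1).smoothAtW T) (s3.smoothAtW T)
    hx (hev'.mono fun z hz hzT => (hz hzT).2.1)
  have hX := hev'.self_of_nhds hx
  let F : Pbar.Total × Pbar.Total × Pbar.Total → 𝒢.P.Total × 𝒢.P.Total × 𝒢.P.Total := fun z =>
    (σ z.1, 𝒢.align₂ (𝒢.y₂ (σ z.1)) (σ' z.2.1), 𝒢.align₂ (𝒢.y₁ (σ z.1)) (σ'' z.2.2))
  have hF : SmoothAtW F T X := (s1.smoothAtW T).prodMk (t2.prodMk t3)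
  have h := SmoothAtW.comp (f := F) (𝒢.s_smooth (F X) hX.2.2) hF hx
    (hev'.mono fun z hz hzT => (hz hzT).2.2)
  refine SmoothAtW.congr h ?_
  filter_upwards [hev, hev'] with z hz hz' hzT
  have e := hs _ _ _ (hz' hzT).2.2
  rw [align₂, align₂, hρ.apply_smul, hρ.apply_smul, hz.1, hz.2.1, hz.2.2] at e
  rw [e]
  rfl

/-- Three faces of the tetrahedron are lifted successively along common edges. The third brings a
second lift of `x₁₄`, which agrees with the first by `eq_of_y₂_eq`, and then the fourth face closes
up by itself. -/
theorem delta_s_bar {sbar : Pbar.Total → Pbar.Total → Pbar.Total → Circle}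
    (hs : ∀ p p' p'', IsTriangle 𝒢.P.proj p p' p'' → sbar (ρ p) (ρ p') (ρ p'') = 𝒢.s p p' p'')
    (x₁₂ x₁₃ x₁₄ x₂₃ x₂₄ x₃₄ : Pbar.Total) (h₁ : IsTriangle Pbar.proj x₃₄ x₂₄ x₂₃)
    (h₂ : IsTriangle Pbar.proj x₃₄ x₁₄ x₁₃) (h₃ : IsTriangle Pbar.proj x₂₄ x₁₄ x₁₂) :
    sbar x₃₄ x₂₄ x₂₃ * (sbar x₃₄ x₁₄ x₁₃)⁻¹ * sbar x₂₄ x₁₄ x₁₂ * (sbar x₂₃ x₁₃ x₁₂)⁻¹ = 1 := by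
  obtain ⟨p₃₄, rfl⟩ := hρ.surjective x₃₄
  obtain ⟨p₂₄, p₂₃, rfl, rfl, t₁⟩ := 𝒢.exists_triangle_lift hq hqY hρ hproj rfl h₁
  obtain ⟨p₁₄, p₁₃, rfl, rfl, t₂⟩ := 𝒢.exists_triangle_lift hq hqY hρ hproj rfl h₂
  obtain ⟨p₁₄', p₁₂, h, rfl, t₃⟩ := 𝒢.exists_triangle_lift hq hqY hρ hproj rfl h₃
  obtain rfl := 𝒢.eq_of_y₂_eq hqY hρ h (t₃.2.2.symm.trans (t₁.2.2.symm.trans t₂.2.2))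
  have t₄ : IsTriangle 𝒢.P.proj p₂₃ p₁₃ p₁₂ :=
    ⟨t₃.1.trans t₁.2.1.symm, t₃.2.1.trans t₂.2.1.symm, t₁.1.trans t₂.1.symm⟩
  rw [hs _ _ _ t₁, hs _ _ _ t₂, hs _ _ _ t₃, hs _ _ _ t₄]
  exact 𝒢.delta_s _ _ _ _ _ _ t₁ t₂ t₃ t₄

omit hρ hproj

theorem exists_quotient_gerbe : ∃ (𝒢bar : BundleGerbe Mbar Ybar) (ρ : 𝒢.P.Total → 𝒢bar.P.Total),
    IsQuotientGerbe 𝒢 q qY 𝒢bar ρ := by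
  have := 𝒢.smooth_smul_P
  let πbar : Ybar → Mbar := fun b => q (𝒢.π (Function.surjInv hqY.surjective b))
  have hπ : ∀ y, πbar (qY y) = q (𝒢.π y) := by
    intro y
    obtain ⟨g, hg⟩ := (hqY.fiber _ _).1 (Function.surjInv_eq hqY.surjective (qY y)).symm
    change q (𝒢.π (Function.surjInv hqY.surjective (qY y))) = _
    rw [← hg, 𝒢.π_smul, hq.apply_smul]
  obtain ⟨Pbar, ρ, hρ, hcirc, hproj⟩ := 𝒢.exists_quotient_bundle hq hqY hπ
  let r : Pbar.Total → 𝒢.P.Total := Function.surjInv hρ.surjective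
  have hr : ∀ x, ρ (r x) = x := Function.surjInv_eq hρ.surjective
  let sbar : Pbar.Total → Pbar.Total → Pbar.Total → Circle := fun x x' x'' =>
    𝒢.s (r x) (𝒢.align₂ (𝒢.y₂ (r x)) (r x')) (𝒢.align₂ (𝒢.y₁ (r x)) (r x''))
  have hs : ∀ p p' p'', IsTriangle 𝒢.P.proj p p' p'' → sbar (ρ p) (ρ p') (ρ p'') = 𝒢.s p p' p'' :=
    fun p p' p'' h => 𝒢.s_align_eq hqY hρ h (hr _) (hr _) (hr _)
  refine ⟨{
    π := πbar
    surjective := ?_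
    submersion := 𝒢.quotient_submersion hq hqY hπ
    P := Pbar
    s := sbar
    s_smooth := 𝒢.smoothOnSubset_s_bar hq hqY hρ hproj hs
    s_smul := ?_
    delta_s := ?_ }, ρ, hπ, hρ.isSubmersion, hρ.surjective, hρ.fiber, hcirc, hproj, hs⟩
  · intro m
    obtain ⟨m, rfl⟩ := hq.surjective m
    obtain ⟨y, rfl⟩ := 𝒢.surjective m
    exact ⟨qY y, hπ y⟩
  · intro a b c x x' x'' h
    obtain ⟨p, rfl⟩ := hρ.surjective x
    obtain ⟨p', p'', rfl, rfl, t⟩ := 𝒢.exists_triangle_lift hq hqY hρ hproj rfl h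
    rw [hs _ _ _ t, ← hcirc, ← hcirc, ← hcirc, hs, 𝒢.s_smul a b c _ _ _ t]
    simpa only [IsTriangle, 𝒢.P.proj_smul] using t
  · intro x₁₂ x₁₃ x₁₄ x₂₃ x₂₄ x₃₄ h₁ h₂ h₃ _
    exact 𝒢.delta_s_bar hq hqY hρ hproj hs _ _ _ _ _ _ h₁ h₂ h₃

end EquivariantGerbe

end QuotientGerbe

/-! ### Invariant forms -/

section InvariantForms

variable {G : Type u} [Group G] [TopologicalSpace G] [SmoothManifold G] [IsLieGroup G]
variable {M : Type v} [TopologicalSpace M] [SmoothManifold M] [MulAction G M] [IsSmoothAction G M]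
variable {N : Type w} [TopologicalSpace N] [SmoothManifold N] [MulAction G N]

theorem smoothAt_orbit (x : M) (g : G) : SmoothAt (fun h : G => h • x) g :=
  (smoothAt_id g).act (smoothAt_const x g)

/-- An equivariant map takes orbits to orbits, and so generated vectors to generated vectors. -/
theorem pull1_infAct {F : Type*} {φ : M → N} (hφ : SmoothMap φ)
    (hg : ∀ (g : G) x, φ (g • x) = g • φ x) (α : ∀ y : N, Tan y → F) (X : Tan (1 : G)) (x : M) :
    pull1 φ α x (infAct X x) = α (φ x) (infAct X (φ x)) := by
  rw [pull1, infAct, ← mdiff_comp (hφ.smoothAt x) (smoothAt_orbit x 1) (one_smul _ _) rfl, infAct]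
  simp only [hg]

theorem IsInvariant1.pull1 [IsSmoothAction G N] {φ : M → N} (hφ : SmoothMap φ)
    (hg : ∀ (g : G) x, φ (g • x) = g • φ x) {α : ∀ y : N, Tan y → ℝ} (hα : IsInvariant1 G α) :
    IsInvariant1 G (pull1 φ α) := by
  intro g x v
  rw [← pull1_comp ((smoothMap_const_smul g).smoothAt x) (hφ.smoothAt _)]
  simp only [hg]
  rw [pull1_comp (hφ.smoothAt x) ((smoothMap_const_smul g).smoothAt _)]
  exact hα g (φ x) _

theorem IsInvariant1.sub {α β : ∀ x : M, Tan x → ℝ} (hα : IsInvariant1 G α)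
    (hβ : IsInvariant1 G β) : IsInvariant1 G fun x v => α x v - β x v := fun g x v =>
  congrArg₂ (· - ·) (hα g x v) (hβ g x v)

theorem IsInvariant1.add {α β : ∀ x : M, Tan x → ℝ} (hα : IsInvariant1 G α)
    (hβ : IsInvariant1 G β) : IsInvariant1 G fun x v => α x v + β x v := fun g x v =>
  congrArg₂ (· + ·) (hα g x v) (hβ g x v)

theorem IsInvariant2.sub {α β : ∀ x : M, Tan x → Tan x → ℝ} (hα : IsInvariant2 G α)
    (hβ : IsInvariant2 G β) : IsInvariant2 G fun x v w => α x v w - β x v w := fun g x v w =>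
  congrArg₂ (· - ·) (hα g x v w) (hβ g x v w)

theorem IsInvariant1.dForm {α : ∀ x : M, Tan x → ℝ} (hα : IsInvariant1 G α) (hf : IsForm1 α) :
    IsInvariant2 G (dForm α) := by
  intro g x v w
  rw [← hf.dForm_pull1 (smoothMap_const_smul g)]
  have h : _root_.pull1 (fun x : M => g • x) α = α := by
    funext x v
    exact hα g x v
  rw [h]

theorem dirDeriv_eq_line {E : Type*} [AddCommGroup E] [Module ℝ E] [TopologicalSpace E]
    {F : Type*} [AddCommGroup F] [Module ℝ F] [TopologicalSpace F] (f : E → F) (x v : E) :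
    dirDeriv f x v = dirDeriv (fun t : ℝ => f (x + t • v)) 0 (1 : ℝ) := by
  simp [dirDeriv]

theorem smoothMap_clm_to_prod {E E' F : Type*} [AddCommGroup E] [Module ℝ E] [TopologicalSpace E]
    [IsTopologicalAddGroup E] [ContinuousSMul ℝ E] [LocallyConvexSpace ℝ E] [T2Space E]
    [AddCommGroup E'] [Module ℝ E'] [TopologicalSpace E'] [IsTopologicalAddGroup E']
    [ContinuousSMul ℝ E'] [LocallyConvexSpace ℝ E'] [T2Space E'] [AddCommGroup F] [Module ℝ F]
    [TopologicalSpace F] [IsTopologicalAddGroup F] [ContinuousSMul ℝ F] [LocallyConvexSpace ℝ F]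
    [T2Space F] (L : F →L[ℝ] E × E') : SmoothMap (fun x => L x) :=
  (smoothMap_clm ((ContinuousLinearMap.fst ℝ E E').comp L)).prodMk
    (smoothMap_clm ((ContinuousLinearMap.snd ℝ E E').comp L))

theorem SmoothAt.comp_clm_to_prod {E E' F : Type*} [AddCommGroup E] [Module ℝ E]
    [TopologicalSpace E] [IsTopologicalAddGroup E] [ContinuousSMul ℝ E] [LocallyConvexSpace ℝ E]
    [T2Space E] [AddCommGroup E'] [Module ℝ E'] [TopologicalSpace E'] [IsTopologicalAddGroup E']
    [ContinuousSMul ℝ E'] [LocallyConvexSpace ℝ E'] [T2Space E'] [AddCommGroup F] [Module ℝ F]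
    [TopologicalSpace F] [IsTopologicalAddGroup F] [ContinuousSMul ℝ F] [LocallyConvexSpace ℝ F]
    [T2Space F] (L : F →L[ℝ] E × E') {φ : E × E' → M} {x : F} (h : SmoothAt φ (L x)) :
    SmoothAt (fun x => φ (L x)) x :=
  h.comp ((smoothMap_clm_to_prod L).smoothAt x)

/-- The exterior derivative of a form along a map depending on two real parameters. -/
theorem IsForm1.dForm_surface {α : ∀ x : M, Tan x → ℝ} (hα : IsForm1 α) {φ : ℝ × ℝ → M} {x : M}
    (hφ : SmoothAt φ (0, 0)) (hx : φ (0, 0) = x) :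
    dForm α x (mdiff (fun s : ℝ => φ (s, 0)) 0 x (1 : ℝ)) (mdiff (fun t : ℝ => φ (0, t)) 0 x (1 : ℝ))
      = dirDeriv (fun s : ℝ => _root_.pull1 (fun t : ℝ => φ (s, t)) α 0 (1 : ℝ)) 0 (1 : ℝ)
        - dirDeriv (fun t : ℝ => _root_.pull1 (fun s : ℝ => φ (s, t)) α 0 (1 : ℝ)) 0 (1 : ℝ) := by
  -- `IsForm1.dForm_mdiff` takes a map from a locally convex space, whereas `ℝ × ℝ` occurs as a
  -- product of manifolds.
  have hflat : @SmoothAt (ℝ × ℝ) _ (instSmoothManifoldSpace (ℝ × ℝ)) M _ _ φ (0, 0) := by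
    exact SmoothAt.comp_clm_to_prod (ContinuousLinearMap.id ℝ (ℝ × ℝ)) hφ
  have hz : ∀ z : ℝ × ℝ, SmoothAt φ z → mdiff (fun s : ℝ => φ (s, z.2)) z.1 (φ z) (1 : ℝ)
      = @mdiff (ℝ × ℝ) _ (instSmoothManifoldSpace (ℝ × ℝ)) M _ _ φ z (φ z) ((1 : ℝ), (0 : ℝ)) := by
    intro z hz
    have h := mdiff_prod (x := z.1) (y := z.2) hz rfl (1 : ℝ) (0 : ℝ)
    rw [(mdiff_isLinearMap (SmoothAt.comp (f := fun y => (z.1, y)) hz (smoothAt_prodMk_right _ _))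
      rfl).map_zero, add_zero] at h
    exact h.symm
  have hz' : ∀ z : ℝ × ℝ, SmoothAt φ z → mdiff (fun t : ℝ => φ (z.1, t)) z.2 (φ z) (1 : ℝ)
      = @mdiff (ℝ × ℝ) _ (instSmoothManifoldSpace (ℝ × ℝ)) M _ _ φ z (φ z) ((0 : ℝ), (1 : ℝ)) := by
    intro z hz
    have h := mdiff_prod (x := z.1) (y := z.2) hz rfl (0 : ℝ) (1 : ℝ)
    rw [(mdiff_isLinearMap (SmoothAt.comp (f := fun y => (y, z.2)) hz (smoothAt_prodMk_left _ _))
      rfl).map_zero, zero_add] at h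
    exact h.symm
  subst hx
  have key := hα.dForm_mdiff hflat rfl ((1 : ℝ), (0 : ℝ)) ((0 : ℝ), (1 : ℝ))
  rw [← hz _ hφ, ← hz' _ hφ, dirDeriv_eq_line (E := ℝ × ℝ), dirDeriv_eq_line (E := ℝ × ℝ)] at key
  refine key.trans ?_
  have c1 : Tendsto (fun s : ℝ => (s, (0 : ℝ))) (𝓝 0) (𝓝 (0, 0)) :=
    (Continuous.prodMk_left (0 : ℝ)).tendsto 0
  have c2 : Tendsto (fun s : ℝ => ((0 : ℝ), s)) (𝓝 0) (𝓝 (0, 0)) :=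
    (Continuous.prodMk_right (0 : ℝ)).tendsto 0
  congr 1
  · refine dirDeriv_congr (1 : ℝ) ?_
    filter_upwards [c1.eventually hφ.eventually] with s hs
    have e : ((0 : ℝ), (0 : ℝ)) + s • ((1 : ℝ), (0 : ℝ)) = (s, 0) := by ext <;> simp
    rw [e, ← hz' _ hs]
    rfl
  · refine dirDeriv_congr (1 : ℝ) ?_
    filter_upwards [c2.eventually hφ.eventually] with s hs
    have e : ((0 : ℝ), (0 : ℝ)) + s • ((0 : ℝ), (1 : ℝ)) = (0, s) := by ext <;> simp
    rw [e, ← hz _ hs]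
    rfl

/-- Cartan's formula for invariant forms. -/
theorem IsForm1.dForm_infAct {α : ∀ x : M, Tan x → ℝ} (hα : IsForm1 α) (hinv : IsInvariant1 G α)
    (X : Tan (1 : G)) (x : M) (w : Tan x) :
    dForm α x (infAct X x) w = -dFun (fun x => α x (infAct X x)) x w := by
  -- With `X` and `w` as velocities of `c` and `γ`, the surface `(s, t) ↦ c s • γ t` has `X^*` and
  -- `w` as partial derivatives at the origin. No flows are needed.
  obtain ⟨c, hc, hc0, rfl⟩ := exists_curve (1 : G) X
  obtain ⟨γ, hγ, hγ0, rfl⟩ := exists_curve x w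
  have hφ : SmoothAt (fun z : ℝ × ℝ => c z.1 • γ z.2) (0, 0) :=
    SmoothAt.act (SmoothAt.comp (f := fun z : ℝ × ℝ => z.1) hc (smoothAt_id _).fst)
      (SmoothAt.comp (f := fun z : ℝ × ℝ => z.2) hγ (smoothAt_id _).snd)
  have h := hα.dForm_surface hφ (x := x) (by simp [hc0, hγ0])
  have hinf : ∀ y : M, infAct (mdiff c 0 1 (1 : ℝ)) y = mdiff (fun s : ℝ => c s • y) 0 y (1 : ℝ) := by
    intro y
    rw [infAct, ← mdiff_comp (smoothAt_orbit y 1) hc hc0 (one_smul _ _)]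
  have e1 : mdiff (fun s : ℝ => c s • γ 0) 0 x (1 : ℝ) = infAct (mdiff c 0 1 (1 : ℝ)) x := by
    rw [hinf, hγ0]
  have e2 : mdiff (fun t : ℝ => c 0 • γ t) 0 x (1 : ℝ) = mdiff γ 0 x (1 : ℝ) := by
    simp only [hc0, one_smul]
  -- By invariance the value of `α` on the `t`-derivative does not depend on `s`, so one of the two
  -- terms of `dα` vanishes.
  have e3 : ∀ s : ℝ, _root_.pull1 (fun t : ℝ => c s • γ t) α 0 (1 : ℝ)
      = _root_.pull1 γ α 0 (1 : ℝ) := by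
    intro s
    rw [pull1_comp (g := fun y => c s • y) hγ ((smoothMap_const_smul (c s)).smoothAt _)]
    exact hinv _ _ _
  have e4 : ∀ t : ℝ, _root_.pull1 (fun s : ℝ => c s • γ t) α 0 (1 : ℝ)
      = α (γ t) (infAct (mdiff c 0 1 (1 : ℝ)) (γ t)) := by
    intro t
    rw [hinf, ← form1_velocity_congr α (c := fun s : ℝ => c s • γ t) (by simp [hc0])]
    rfl
  simp only [e1, e2, e3, e4] at h
  have e5 : dirDeriv (fun _ : ℝ => _root_.pull1 γ α 0 (1 : ℝ)) 0 (1 : ℝ) = 0 :=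
    mdiff_const (M := ℝ) (N := ℝ) 0 _ (1 : ℝ)
  rw [h, e5, zero_sub]
  congr 1
  have h2 : SmoothAt (fun x => α x (infAct (mdiff c 0 1 (1 : ℝ)) x)) x := by
    have hd : SmoothAt (fun p : M × ℝ => c p.2 • p.1) (x, 0) :=
      SmoothAt.act (SmoothAt.comp (f := fun p : M × ℝ => p.2) hc (smoothAt_id _).snd)
        (smoothAt_id _).fst
    refine (hα.smoothAt_velocity hd).congr (Eventually.of_forall fun y => ?_)
    change _ = α y (infAct (mdiff c 0 1 (1 : ℝ)) y)
    rw [hinf, ← form1_velocity_congr α (c := fun s : ℝ => c s • y) (by simp [hc0])]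
  exact mdiff_comp (N := ℝ) h2 hγ hγ0 rfl _

end InvariantForms

/-! ### The form `κ` -/

section Kappa

variable {G : Type u} [Group G] [TopologicalSpace G] [SmoothManifold G] [IsLieGroup G]
variable {M : Type u} [TopologicalSpace M] [SmoothManifold M] [MulAction G M] [IsSmoothAction G M]
variable {Y : Type u} [TopologicalSpace Y] [SmoothManifold Y] [MulAction G Y]

theorem lieAd_inv_lieAd (g : G) (X : Tan (1 : G)) : lieAd g⁻¹ (lieAd g X) = X := by
  have hs : ∀ g h : G, SmoothAt (fun h : G => g * h * g⁻¹) h := fun g h =>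
    ((smoothAt_const g h).mul (smoothAt_id h)).mul (smoothAt_const g⁻¹ h)
  rw [lieAd, lieAd, ← mdiff_comp (hs g⁻¹ 1) (hs g 1) (by simp) (by simp)]
  simp only [inv_inv, mul_assoc, inv_mul_cancel, mul_one, inv_mul_cancel_left]
  exact mdiff_id 1 X

namespace EquivariantGerbe

variable {𝒢 : EquivariantGerbe G M Y} {nab : ∀ p : 𝒢.P.Total, Tan p → ℝ}
  {f : ∀ y : Y, Tan y → Tan y → ℝ} {lam : Y → Tan (1 : G) →L[ℝ] ℝ}
  {Ξ : ∀ x : M, Tan x → Tan (1 : G)}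

/-- Smoothness of `κ` uses that `λ` is jointly smooth in the point and the Lie algebra element. -/
theorem isForm1_kappa (hlam : IsReductionMap 𝒢 nab f lam) (hΞ : IsPrincipalConnection Ξ) :
    IsForm1 (kappa 𝒢 Ξ lam) := by
  have h1 : IsForm1 (pull1 𝒢.π Ξ) := hΞ.1.pull1 𝒢.submersion.1
  refine ⟨fun y => ((lam y : Tan (1 : G) →ₗ[ℝ] ℝ).comp (h1.1 y).mk').isLinear, fun a => ?_⟩
  have h2 := smoothOnOpen_prod_iff_mbSmoothOn.2 ⟨isOpen_chart_target_prod a (Tan a), h1.2 a⟩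
  refine (smoothOnOpen_prod_iff_mbSmoothOn.1 (smoothOnOpen_iff.2
    ⟨isOpen_chart_target_prod a (Tan a), fun z hz => ?_⟩)).2
  exact hlam.smooth.comp_smoothAt (f := fun z : Tan a × Tan a => ((chart a).symm z.1,
      pull1 𝒢.π Ξ ((chart a).symm z.1) (chartVec a z.1 z.2)))
    ((SmoothAt.comp (f := fun z : Tan a × Tan a => z.1) (smoothAt_chart_symm hz.1)
      (smoothAt_id z).fst).prodMk (h2.smoothAt hz))

theorem kappa_infAct (hΞ : IsPrincipalConnection Ξ) (X : Tan (1 : G)) (y : Y) :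
    kappa 𝒢 Ξ lam y (infAct X y) = lam y X := by
  have := 𝒢.smooth_smul_Y
  rw [kappa, pull1_infAct 𝒢.submersion.1 𝒢.π_smul, hΞ.2.1]

/-- Translation by `g` produces `Ad_g` in `π^*Ξ`, while `ζ = 0` says that `λ` at `g • y` is `λ` at
`y` after `Ad_{g⁻¹}`; the two cancel. -/
theorem isInvariant1_kappa (hlam : IsReductionMap 𝒢 nab f lam) (hΞ : IsPrincipalConnection Ξ) :
    IsInvariant1 G (kappa 𝒢 Ξ lam) := by
  have := 𝒢.smooth_smul_Y
  intro g y w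
  have h1 : pull1 (fun y : Y => g • y) (pull1 𝒢.π Ξ) y w = lieAd g (pull1 𝒢.π Ξ y w) := by
    rw [← pull1_comp ((smoothMap_const_smul g).smoothAt y) (𝒢.submersion.1.smoothAt _)]
    simp only [𝒢.π_smul]
    rw [pull1_comp (𝒢.submersion.1.smoothAt y) ((smoothMap_const_smul g).smoothAt _)]
    exact hΞ.2.2 g _ _
  have h2 : pull1 (fun y : Y => g • y) (kappa 𝒢 Ξ lam) y w
      = lam (g • y) (pull1 (fun y : Y => g • y) (pull1 𝒢.π Ξ) y w) := rfl
  rw [h2, h1, sub_eq_zero.1 (hlam.zeta_eq_zero g _ y), lieAd_inv_lieAd, kappa]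

variable (h𝒢 : 𝒢.IsConnectionCurving nab f) (hlam : IsReductionMap 𝒢 nab f lam)
  (hΞ : IsPrincipalConnection Ξ)

include hlam hΞ

include h𝒢

/-- On `X^*` the two terms agree: `δκ(X^*) = δ⟨X | λ⟩`, which is the moment `∇(X^*)`. -/
theorem isBasic1_sub_kappa : IsBasic1 G fun p v => nab p v - 𝒢.delta1 (kappa 𝒢 Ξ lam) p v where
  form := h𝒢.connection.1.1.sub (((isForm1_kappa hlam hΞ).pull1 𝒢.smoothMap_y₂).sub
    ((isForm1_kappa hlam hΞ).pull1 𝒢.smoothMap_y₁))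
  invariant := by
    have := 𝒢.smooth_smul_Y
    have := 𝒢.smooth_smul_P
    exact h𝒢.connection_invariant.sub
      (((isInvariant1_kappa hlam hΞ).pull1 𝒢.smoothMap_y₂ 𝒢.y₂_smul).sub
        ((isInvariant1_kappa hlam hΞ).pull1 𝒢.smoothMap_y₁ 𝒢.y₁_smul))
  horizontal X p := by
    have := 𝒢.smooth_smul_P
    rw [BundleGerbe.delta1, pull1_infAct 𝒢.smoothMap_y₂ 𝒢.y₂_smul,
      pull1_infAct 𝒢.smoothMap_y₁ 𝒢.y₁_smul, kappa_infAct hΞ, kappa_infAct hΞ, hlam.delta_lam,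
      sub_self]

/-- Cartan's formula gives `ι_{X^*} dκ = -d⟨X | λ⟩`, and `E = 0` identifies this with `ι_{X^*} f`.
-/
theorem isBasic2_sub_kappa : IsBasic2 G fun y v w => f y v w - dForm (kappa 𝒢 Ξ lam) y v w where
  form := h𝒢.curving.1.sub (isForm1_kappa hlam hΞ).isForm2_dForm
  invariant := by
    have := 𝒢.smooth_smul_Y
    exact h𝒢.curving_invariant.sub ((isInvariant1_kappa hlam hΞ).dForm (isForm1_kappa hlam hΞ))
  horizontal X y w := by
    have := 𝒢.smooth_smul_Y
    rw [(isForm1_kappa hlam hΞ).dForm_infAct (isInvariant1_kappa hlam hΞ)]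
    simp only [kappa_infAct hΞ]
    linarith [hlam.E_eq_zero X y w]

end EquivariantGerbe

end Kappa

/-! ### Flatness along curves -/

section Flatness

/-- Flatness is required along curves smooth on all of `ℝ`, but lifts exist for short times only.
Precomposition with `θ` makes a local curve global without changing its germ at `t`. -/
theorem exists_smooth_reparam {t : ℝ} {U : Set ℝ} (hU : U ∈ 𝓝 t) :
    ∃ θ : ℝ → ℝ, SmoothMap θ ∧ (∀ᶠ s in 𝓝 t, θ s = s) ∧ ∀ s, θ s ∈ U := by
  obtain ⟨ε, hε, hεU⟩ := Metric.mem_nhds_iff.1 hU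
  let b : ContDiffBump t := ⟨ε / 2, ε, by positivity, by linarith⟩
  refine ⟨fun s => t + b s * (s - t), ContDiff.smoothMap ?_, ?_, fun s => hεU ?_⟩
  · exact contDiff_const.add (b.contDiff.mul (contDiff_id.sub contDiff_const))
  · filter_upwards [b.eventuallyEq_one] with s hs
    rw [hs]
    simp
  · rw [Metric.mem_ball, Real.dist_eq, add_sub_cancel_left, abs_mul, abs_of_nonneg b.nonneg]
    by_cases hs : s ∈ Metric.ball t ε
    · rw [Metric.mem_ball, Real.dist_eq] at hs
      exact (mul_le_of_le_one_left (abs_nonneg _) b.le_one).trans_lt hs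
    · rw [b.zero_of_le_dist (by simpa using hs), zero_mul]
      exact hε

variable {M : Type u} [TopologicalSpace M] [SmoothManifold M]

theorem SmoothAt.exists_reparam {c : ℝ → M} {t : ℝ} (hc : SmoothAt c t) :
    ∃ U ∈ 𝓝 t, ∀ θ : ℝ → ℝ, SmoothMap θ → (∀ s, θ s ∈ U) → SmoothMap fun s => c (θ s) := by
  obtain ⟨U, ht, hU⟩ := hc
  exact ⟨U, hU.1.mem_nhds ht, fun θ hθ hθU =>
    smoothMap_iff.2 fun s => SmoothAt.comp (f := θ) (hU.smoothAt (hθU s)) (hθ.smoothAt s)⟩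

variable {Y : Type u} [TopologicalSpace Y] [SmoothManifold Y]

/-- A gerbe connection is flat along curves that are merely defined locally. -/
theorem BundleGerbe.IsConnection.hasDerivAt {𝒢 : BundleGerbe M Y}
    {nab : ∀ p : 𝒢.P.Total, Tan p → ℝ} (h : 𝒢.IsConnection nab) {p q r : ℝ → 𝒢.P.Total} {t : ℝ}
    (hp : SmoothAt p t) (hq : SmoothAt q t) (hr : SmoothAt r t)
    (ht : ∀ᶠ s in 𝓝 t, IsTriangle 𝒢.P.proj (p s) (q s) (r s)) :
    HasDerivAt (fun t => (𝒢.s (p t) (q t) (r t) : ℂ))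
      (-Complex.I * ((pull1 p nab t (1 : ℝ) - pull1 q nab t (1 : ℝ) + pull1 r nab t (1 : ℝ) : ℝ) : ℂ)
        * (𝒢.s (p t) (q t) (r t) : ℂ)) t := by
  obtain ⟨U₁, hU₁, h₁⟩ := hp.exists_reparam
  obtain ⟨U₂, hU₂, h₂⟩ := hq.exists_reparam
  obtain ⟨U₃, hU₃, h₃⟩ := hr.exists_reparam
  obtain ⟨θ, hθ, hθt, hθU⟩ := exists_smooth_reparam
    (inter_mem (inter_mem hU₁ hU₂) (inter_mem hU₃ ht))
  have key := h.2 (fun s => p (θ s)) (fun s => q (θ s)) (fun s => r (θ s))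
    (h₁ θ hθ fun s => (hθU s).1.1) (h₂ θ hθ fun s => (hθU s).1.2) (h₃ θ hθ fun s => (hθU s).2.1)
    (fun s => (hθU s).2.2) t
  have e : ∀ c : ℝ → 𝒢.P.Total, nab (c (θ t)) (velocity (fun s => c (θ s)) t)
      = pull1 c nab t (1 : ℝ) := by
    intro c
    refine pull1_congr (f := fun s => c (θ s)) ?_ nab (1 : ℝ)
    filter_upwards [hθt] with s hs
    rw [hs]
  rw [e, e, e, hθt.self_of_nhds] at key
  refine key.congr_of_eventuallyEq ?_
  filter_upwards [hθt] with s hs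
  rw [hs]

end Flatness

/-! ### Connection and curving on the quotient gerbe -/

section Descent

variable {G : Type u} [Group G] [TopologicalSpace G] [SmoothManifold G] [IsLieGroup G]
variable {M : Type u} [TopologicalSpace M] [SmoothManifold M] [MulAction G M] [IsSmoothAction G M]
variable {Y : Type u} [TopologicalSpace Y] [SmoothManifold Y] [MulAction G Y]
variable {Mbar : Type u} [TopologicalSpace Mbar] [SmoothManifold Mbar]
variable {Ybar : Type u} [TopologicalSpace Ybar] [SmoothManifold Ybar]

theorem CircleBundle.smoothAt_orbit {B : Type u} [TopologicalSpace B] [SmoothManifold B] {S : Set B}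
    (P : CircleBundle B S) (p : P.Total) : SmoothAt (fun t : ℝ => Circle.exp t • p) 0 :=
  P.smoothAt_exp_smul (smoothAt_id _) (smoothAt_const p _)

/-- Curves in `Y` along a triangle: the terms of `δκ` cancel. -/
theorem BundleGerbe.delta1_triangle (𝒢 : BundleGerbe M Y) (κ : ∀ y : Y, Tan y → ℝ)
    {p q r : ℝ → 𝒢.P.Total} {t : ℝ} (hp : SmoothAt p t) (hq : SmoothAt q t) (hr : SmoothAt r t)
    (ht : ∀ᶠ s in 𝓝 t, IsTriangle 𝒢.P.proj (p s) (q s) (r s)) :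
    pull1 p (𝒢.delta1 κ) t (1 : ℝ) - pull1 q (𝒢.delta1 κ) t (1 : ℝ)
      + pull1 r (𝒢.delta1 κ) t (1 : ℝ) = 0 := by
  have e : ∀ c : ℝ → 𝒢.P.Total, SmoothAt c t → pull1 c (𝒢.delta1 κ) t (1 : ℝ)
      = pull1 (fun s => 𝒢.y₂ (c s)) κ t (1 : ℝ) - pull1 (fun s => 𝒢.y₁ (c s)) κ t (1 : ℝ) := by
    intro c hc
    rw [pull1_comp hc (𝒢.smoothMap_y₂.smoothAt _), pull1_comp hc (𝒢.smoothMap_y₁.smoothAt _)]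
    rfl
  rw [e p hp, e q hq, e r hr,
    pull1_congr (f := fun s => 𝒢.y₂ (r s)) (g := fun s => 𝒢.y₁ (p s)) (ht.mono fun s hs => hs.1),
    pull1_congr (f := fun s => 𝒢.y₁ (r s)) (g := fun s => 𝒢.y₁ (q s)) (ht.mono fun s hs => hs.2.1),
    pull1_congr (f := fun s => 𝒢.y₂ (p s)) (g := fun s => 𝒢.y₂ (q s)) (ht.mono fun s hs => hs.2.2)]
  ring

theorem BundleGerbe.pull1_delta1_of_const (𝒢 : BundleGerbe M Y) {κ : ∀ y : Y, Tan y → ℝ}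
    (hκ : IsForm1 κ) {L : Type*} [TopologicalSpace L] [SmoothManifold L] {c : L → 𝒢.P.Total} {l : L}
    (hc : SmoothAt c l) (h : ∀ l', 𝒢.P.proj (c l') = 𝒢.P.proj (c l)) (v : Tan l) :
    pull1 c (𝒢.delta1 κ) l v = 0 := by
  have h1 : ∀ l', 𝒢.y₁ (c l') = 𝒢.y₁ (c l) := fun l' => congrArg Prod.fst (h l')
  have h2 : ∀ l', 𝒢.y₂ (c l') = 𝒢.y₂ (c l) := fun l' => congrArg Prod.snd (h l')
  have e : pull1 c (𝒢.delta1 κ) l v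
      = pull1 (fun s => 𝒢.y₂ (c s)) κ l v - pull1 (fun s => 𝒢.y₁ (c s)) κ l v := by
    rw [pull1_comp hc (𝒢.smoothMap_y₂.smoothAt _), pull1_comp hc (𝒢.smoothMap_y₁.smoothAt _)]
    rfl
  rw [e]
  simp only [h1, h2]
  rw [pull1_const hκ.1, pull1_const hκ.1, sub_self]

theorem form1_apply_congr {N : Type*} [TopologicalSpace N] [SmoothManifold N]
    (α : ∀ y : N, Tan y → ℝ) {L : Type*} [TopologicalSpace L] [SmoothManifold L] {c : L → N} {l : L}
    {y : N} (h : c l = y) (v : Tan l) : α y (mdiff c l y v) = pull1 c α l v := by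
  subst h
  rfl

theorem BundleGerbe.isForm1_delta1 (𝒢 : BundleGerbe M Y) {κ : ∀ y : Y, Tan y → ℝ}
    (hκ : IsForm1 κ) : IsForm1 (𝒢.delta1 κ) :=
  (hκ.pull1 𝒢.smoothMap_y₂).sub (hκ.pull1 𝒢.smoothMap_y₁)

theorem BundleGerbe.dForm_delta1 (𝒢 : BundleGerbe M Y) {κ : ∀ y : Y, Tan y → ℝ}
    (hκ : IsForm1 κ) (p : 𝒢.P.Total) (v w : Tan p) :
    dForm (𝒢.delta1 κ) p v w = 𝒢.delta2 (dForm κ) p v w := by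
  rw [BundleGerbe.delta2, ← hκ.dForm_pull1 𝒢.smoothMap_y₂, ← hκ.dForm_pull1 𝒢.smoothMap_y₁]
  exact (hκ.pull1 𝒢.smoothMap_y₂).dForm_sub (hκ.pull1 𝒢.smoothMap_y₁) p v w

/-- Subtraction of a coboundary does not affect invariance under the circle and normalisation. -/
theorem BundleGerbe.isCircleConnection_sub_delta1 (𝒢 : BundleGerbe M Y)
    {nab : ∀ p : 𝒢.P.Total, Tan p → ℝ} (h : IsCircleConnection 𝒢.P nab) {κ : ∀ y : Y, Tan y → ℝ}
    (hκ : IsForm1 κ) : IsCircleConnection 𝒢.P fun p v => nab p v - 𝒢.delta1 κ p v := by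
  refine ⟨h.1.sub (𝒢.isForm1_delta1 hκ), ?_, fun p => ?_⟩
  · refine fun z p v => congrArg₂ (· - ·) (h.2.1 z p v) ?_
    have hz := (𝒢.P.smoothMap_smul z).smoothAt p
    change pull1 (fun p : 𝒢.P.Total => z • p) (pull1 𝒢.y₂ κ) p v
      - pull1 (fun p : 𝒢.P.Total => z • p) (pull1 𝒢.y₁ κ) p v = _
    rw [← pull1_comp hz (𝒢.smoothMap_y₂.smoothAt _), ← pull1_comp hz (𝒢.smoothMap_y₁.smoothAt _)]
    simp only [BundleGerbe.y₁, BundleGerbe.y₂, 𝒢.P.proj_smul]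
    rfl
  · change nab p _ - 𝒢.delta1 κ p _ = 1
    rw [h.2.2 p, form1_apply_congr (𝒢.delta1 κ) (c := fun t : ℝ => Circle.exp t • p) (by simp),
      𝒢.pull1_delta1_of_const hκ (𝒢.P.smoothAt_orbit p)
        (fun t => by rw [𝒢.P.proj_smul, 𝒢.P.proj_smul]), sub_zero]

/-- Points and tangent vectors lift along `ρ`, which intertwines the circle actions, so both
conditions can be checked upstairs. -/
theorem IsCircleConnection.of_pull1 {B B' : Type u} [TopologicalSpace B] [SmoothManifold B]
    [TopologicalSpace B'] [SmoothManifold B'] {S : Set B} {S' : Set B'} {P : CircleBundle B S}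
    {P' : CircleBundle B' S'} {ρ : P.Total → P'.Total} (hρ : SmoothMap ρ)
    (hsurj : Function.Surjective ρ) (hmd : ∀ p (v : Tan (ρ p)), ∃ w : Tan p, mdiff ρ p (ρ p) w = v)
    (hcirc : ∀ (z : Circle) p, ρ (z • p) = z • ρ p) {θ : ∀ p : P'.Total, Tan p → ℝ}
    (hθ : IsForm1 θ) (h : IsCircleConnection P (pull1 ρ θ)) : IsCircleConnection P' θ := by
  refine ⟨hθ, fun z x v => ?_, fun x => ?_⟩
  · obtain ⟨p, rfl⟩ := hsurj x
    obtain ⟨w, rfl⟩ := hmd p v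
    change pull1 ρ (pull1 (fun x : P'.Total => z • x) θ) p w = pull1 ρ θ p w
    rw [← pull1_comp (hρ.smoothAt p) ((P'.smoothMap_smul z).smoothAt _)]
    simp only [← hcirc]
    rw [pull1_comp ((P.smoothMap_smul z).smoothAt p) (hρ.smoothAt _)]
    exact h.2.1 z p w
  · obtain ⟨p, rfl⟩ := hsurj x
    refine Eq.trans ?_ (h.2.2 p)
    rw [pull1, ← mdiff_comp (hρ.smoothAt p) (P.smoothAt_orbit p) (by simp) rfl]
    simp only [hcirc]

theorem IsCircleConnection.pull1 {B B' : Type u} [TopologicalSpace B] [SmoothManifold B]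
    [TopologicalSpace B'] [SmoothManifold B'] {S : Set B} {S' : Set B'} {P : CircleBundle B S}
    {P' : CircleBundle B' S'} {ρ : P.Total → P'.Total} (hρ : SmoothMap ρ)
    (hcirc : ∀ (z : Circle) p, ρ (z • p) = z • ρ p) {θ : ∀ p : P'.Total, Tan p → ℝ}
    (h : IsCircleConnection P' θ) : IsCircleConnection P (pull1 ρ θ) := by
  refine ⟨h.1.pull1 hρ, fun z p v => ?_, fun p => ?_⟩
  · rw [← pull1_comp ((P.smoothMap_smul z).smoothAt p) (hρ.smoothAt _)]
    simp only [hcirc]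
    rw [pull1_comp (hρ.smoothAt p) ((P'.smoothMap_smul z).smoothAt _)]
    exact h.2.1 z (ρ p) _
  · refine Eq.trans ?_ (h.2.2 (ρ p))
    rw [_root_.pull1, ← mdiff_comp (hρ.smoothAt p) (P.smoothAt_orbit p) (by simp) rfl]
    simp only [hcirc]

namespace IsQuotientGerbe

variable {𝒢 : EquivariantGerbe G M Y} {q : M → Mbar} {qY : Y → Ybar} {𝒢bar : BundleGerbe Mbar Ybar}
  {ρ : 𝒢.P.Total → 𝒢bar.P.Total}

/-- The submersion `ρ` has local sections and `y₁` is equivariant into the principal bundle `qY`. So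
any quotient gerbe, not just the one constructed, comes with a principal bundle `P → P/G`. -/
theorem isPrincipalQuotient (hqY : IsPrincipalQuotient G qY) (h : IsQuotientGerbe 𝒢 q qY 𝒢bar ρ) :
    IsPrincipalQuotient G ρ :=
  hqY.of_equivariant 𝒢.smoothMap_y₁ 𝒢.y₁_smul h.submersion.1 h.surjective h.fiber fun x => by
    obtain ⟨p, rfl⟩ := h.surjective x
    obtain ⟨σ, hσ, -, hρσ⟩ := h.submersion.exists_section p
    exact ⟨σ, hσ, hρσ⟩

variable {nab : ∀ p : 𝒢.P.Total, Tan p → ℝ} {f : ∀ y : Y, Tan y → Tan y → ℝ}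
  {κ : ∀ y : Y, Tan y → ℝ} (hq : IsPrincipalQuotient G q) (hqY : IsPrincipalQuotient G qY)
  (h : IsQuotientGerbe 𝒢 q qY 𝒢bar ρ) (hκ : IsForm1 κ)
  {nabbar : ∀ p : 𝒢bar.P.Total, Tan p → ℝ} (hnabbar : IsForm1 nabbar)
  (hnab : ∀ p v, pull1 ρ nabbar p v = nab p v - 𝒢.delta1 κ p v)

include hq hqY h hκ hnabbar hnab

/-- Lift the three curves locally and align them to triangles in `P`. There `∇` is flat and `s`
equals `s̄`, and passing to `∇ - δκ` changes nothing by `delta1_triangle`. -/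
theorem isConnection (hc : 𝒢.IsConnection nab) : 𝒢bar.IsConnection nabbar := by
  have := 𝒢.smooth_smul_P
  have hρ := h.isPrincipalQuotient hqY
  have hfun : pull1 ρ nabbar = fun p v => nab p v - 𝒢.delta1 κ p v := by
    funext p v
    exact hnab p v
  refine ⟨IsCircleConnection.of_pull1 hρ.smooth hρ.surjective hρ.exists_mdiff_eq h.circle_smul hnabbar
    (hfun ▸ 𝒢.isCircleConnection_sub_delta1 hc.1 hκ), fun x y z hx hy hz hxyz t => ?_⟩
  obtain ⟨σ, hσ, hρσ⟩ := hρ.exists_section' (x t)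
  obtain ⟨σ', hσ', hρσ'⟩ := hρ.exists_section' (y t)
  obtain ⟨σ'', hσ'', hρσ''⟩ := hρ.exists_section' (z t)
  have s1 : SmoothAt (fun s => σ (x s)) t := hσ.comp (hx.smoothAt t)
  have s2 : SmoothAt (fun s => σ' (y s)) t := hσ'.comp (hy.smoothAt t)
  have s3 : SmoothAt (fun s => σ'' (z s)) t := hσ''.comp (hz.smoothAt t)
  have hev : ∀ᶠ s in 𝓝 t, ρ (σ (x s)) = x s ∧ ρ (σ' (y s)) = y s ∧ ρ (σ'' (z s)) = z s :=
    (hx.continuous.continuousAt.eventually hρσ).and ((hy.continuous.continuousAt.eventually hρσ').and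
      (hz.continuous.continuousAt.eventually hρσ''))
  have hev' : ∀ᶠ s in 𝓝 t, qY (𝒢.y₂ (σ (x s))) = qY (𝒢.y₂ (σ' (y s))) ∧
      qY (𝒢.y₁ (σ (x s))) = qY (𝒢.y₂ (σ'' (z s))) ∧ IsTriangle 𝒢.P.proj (σ (x s))
        (𝒢.align₂ (𝒢.y₂ (σ (x s))) (σ' (y s))) (𝒢.align₂ (𝒢.y₁ (σ (x s))) (σ'' (z s))) := by
    filter_upwards [hev] with s hs
    refine 𝒢.isTriangle_align_of_map hq hqY h.proj_comm ?_
    rw [hs.1, hs.2.1, hs.2.2]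
    exact hxyz s
  have t2 := 𝒢.smoothAt_align₂ hqY (𝒢.smoothMap_y₂.comp_smoothAt s1) s2 (hev'.mono fun s hs => hs.1)
  have t3 := 𝒢.smoothAt_align₂ hqY (𝒢.smoothMap_y₁.comp_smoothAt s1) s3
    (hev'.mono fun s hs => hs.2.1)
  have htri := hev'.mono fun s hs => hs.2.2
  have key := hc.hasDerivAt s1 t2 t3 htri
  have hdel := 𝒢.delta1_triangle κ s1 t2 t3 htri
  have e : ∀ (c : ℝ → 𝒢bar.P.Total) (c' : ℝ → 𝒢.P.Total), SmoothAt c' t →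
      (∀ᶠ s in 𝓝 t, ρ (c' s) = c s) → nabbar (c t) (velocity c t)
        = pull1 c' nab t (1 : ℝ) - pull1 c' (𝒢.delta1 κ) t (1 : ℝ) := by
    intro c c' hc' hcc'
    change pull1 c nabbar t (1 : ℝ) = _
    rw [← pull1_congr (f := fun s => ρ (c' s)) hcc', pull1_comp hc' (hρ.smooth.smoothAt _), hfun]
    rfl
  have e1 := e x _ s1 (hev.mono fun s hs => hs.1)
  have e2 := e y _ t2 (hev.mono fun s hs => by
    rw [EquivariantGerbe.align₂, hρ.apply_smul, hs.2.1])
  have e3 := e z _ t3 (hev.mono fun s hs => by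
    rw [EquivariantGerbe.align₂, hρ.apply_smul, hs.2.2])
  have hs : ∀ᶠ s in 𝓝 t, 𝒢bar.s (x s) (y s) (z s) = 𝒢.s (σ (x s))
      (𝒢.align₂ (𝒢.y₂ (σ (x s))) (σ' (y s))) (𝒢.align₂ (𝒢.y₁ (σ (x s))) (σ'' (z s))) := by
    filter_upwards [hev, htri] with s hs hs'
    rw [← h.s_comm _ _ _ hs', EquivariantGerbe.align₂, EquivariantGerbe.align₂, hρ.apply_smul,
      hρ.apply_smul, hs.1, hs.2.1, hs.2.2]
  have hval : nabbar (x t) (velocity x t) - nabbar (y t) (velocity y t)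
      + nabbar (z t) (velocity z t)
      = pull1 (fun s => σ (x s)) nab t (1 : ℝ)
        - pull1 (fun s => 𝒢.align₂ (𝒢.y₂ (σ (x s))) (σ' (y s))) nab t (1 : ℝ)
        + pull1 (fun s => 𝒢.align₂ (𝒢.y₁ (σ (x s))) (σ'' (z s))) nab t (1 : ℝ) := by
    rw [e1, e2, e3]
    linarith
  rw [hval, hs.self_of_nhds]
  refine key.congr_of_eventuallyEq ?_
  filter_upwards [hs] with s hs
  rw [hs]

/-- `d(∇ - δκ) = δf - δ(dκ) = δ(f - dκ)`, compared after pull-back to `P`. -/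
theorem isCurving (hnabf : IsForm1 nab) (hf : 𝒢.IsCurving nab f)
    {fbar : ∀ y : Ybar, Tan y → Tan y → ℝ} (hfbar : IsForm2 fbar)
    (hff : ∀ y v w, pull2 qY fbar y v w = f y v w - dForm κ y v w) :
    𝒢bar.IsCurving nabbar fbar := by
  have := 𝒢.smooth_smul_P
  have hρ := h.isPrincipalQuotient hqY
  have hfun : pull1 ρ nabbar = fun p v => nab p v - 𝒢.delta1 κ p v := by
    funext p v
    exact hnab p v
  have hffun : pull2 qY fbar = fun y v w => f y v w - dForm κ y v w := by
    funext y v w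
    exact hff y v w
  refine ⟨hfbar, fun x v w => ?_⟩
  obtain ⟨p, rfl⟩ := hρ.surjective x
  obtain ⟨v, rfl⟩ := hρ.exists_mdiff_eq p v
  obtain ⟨w, rfl⟩ := hρ.exists_mdiff_eq p w
  have h1 := hnabbar.dForm_pull1 hρ.smooth p v w
  rw [hfun, hnabf.dForm_sub (𝒢.isForm1_delta1 hκ), 𝒢.dForm_delta1 hκ, ← hf.2] at h1
  refine Eq.trans ?_ h1
  change pull2 ρ (pull2 𝒢bar.y₂ fbar) p v w - pull2 ρ (pull2 𝒢bar.y₁ fbar) p v w = _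
  rw [← pull2_comp (hρ.smooth.smoothAt p) (𝒢bar.smoothMap_y₂.smoothAt _),
    ← pull2_comp (hρ.smooth.smoothAt p) (𝒢bar.smoothMap_y₁.smoothAt _)]
  have e1 : (fun p => 𝒢bar.y₁ (ρ p)) = fun p => qY (𝒢.y₁ p) := by
    funext p
    exact congrArg Prod.fst (h.proj_comm p)
  have e2 : (fun p => 𝒢bar.y₂ (ρ p)) = fun p => qY (𝒢.y₂ p) := by
    funext p
    exact congrArg Prod.snd (h.proj_comm p)
  rw [e1, e2, pull2_comp (𝒢.smoothMap_y₂.smoothAt p) (hqY.smooth.smoothAt _),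
    pull2_comp (𝒢.smoothMap_y₁.smoothAt p) (hqY.smooth.smoothAt _), hffun]
  simp only [pull2, BundleGerbe.delta2]
  ring

end IsQuotientGerbe

end Descent

/-! ### Pull-backs of gerbes -/

section Pullback

variable {G : Type u} [Group G] [TopologicalSpace G] [SmoothManifold G] [IsLieGroup G]
variable {M : Type u} [TopologicalSpace M] [SmoothManifold M] [MulAction G M]
variable {Y : Type u} [TopologicalSpace Y] [SmoothManifold Y] [MulAction G Y]
variable {Y' : Type u} [TopologicalSpace Y'] [SmoothManifold Y'] [MulAction G Y']
variable {Mbar : Type u} [TopologicalSpace Mbar] [SmoothManifold Mbar]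
variable {Ybar : Type u} [TopologicalSpace Ybar] [SmoothManifold Ybar]
variable {L : Type*} [TopologicalSpace L] [SmoothManifold L]

/-- An equivariant gerbe is the pull-back of its quotient. -/
theorem IsQuotientGerbe.isPullbackGerbe {𝒢 : EquivariantGerbe G M Y} {q : M → Mbar} {qY : Y → Ybar}
    {𝒢bar : BundleGerbe Mbar Ybar} {ρ : 𝒢.P.Total → 𝒢bar.P.Total} (hq : IsPrincipalQuotient G q)
    [IsSmoothAction G M] (hqY : IsPrincipalQuotient G qY) (h : IsQuotientGerbe 𝒢 q qY 𝒢bar ρ) :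
    IsPullbackGerbe q 𝒢bar 𝒢 qY ρ where
  smooth_prY := hqY.smooth
  comm y := (h.π_comm y).symm
  isFibreProd := by
    have := 𝒢.smooth_smul_Y
    -- Translate any lift of the second entry until its image in `M` is the first entry. By
    -- `eq_of_π_eq` the lift does not matter, so local sections may be used to prove smoothness.
    let inv : M × Ybar → Y := fun x => actDiv G x.1 (𝒢.π (Function.surjInv hqY.surjective x.2)) •
      Function.surjInv hqY.surjective x.2
    have hinv : ∀ x ∈ fibreProd q 𝒢bar.π, 𝒢.π (inv x) = x.1 ∧ qY (inv x) = x.2 := by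
      intro x hx
      have hx : q x.1 = 𝒢bar.π x.2 := hx
      have hy := Function.surjInv_eq hqY.surjective x.2
      refine ⟨?_, by rw [hqY.apply_smul, hy]⟩
      rw [𝒢.π_smul, hq.div_smul (by rw [← h.π_comm, hy, hx])]
    refine ⟨inv, fun x hx => ?_, fun y => ?_, fun x hx => Prod.ext (hinv x hx).1 (hinv x hx).2⟩
    · have hqx : q x.1 = 𝒢bar.π x.2 := hx
      obtain ⟨σ, hσ, hqσ⟩ := hqY.exists_section' x.2
      have s2 : SmoothAt (fun x : M × Ybar => σ x.2) x := SmoothAt.comp hσ (smoothAt_id x).snd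
      have hev : ∀ᶠ x' in 𝓝 x, qY (σ x'.2) = x'.2 :=
        (continuous_snd.tendsto x).eventually hqσ
      have hmem : ∀ᶠ x' in 𝓝 x, x' ∈ fibreProd q 𝒢bar.π →
          (x'.1, 𝒢.π (σ x'.2)) ∈ fibreProd q q := by
        filter_upwards [hev] with x' hx' hx''
        have hx'' : q x'.1 = 𝒢bar.π x'.2 := hx''
        change q x'.1 = q (𝒢.π (σ x'.2))
        rw [← h.π_comm, hx', hx'']
      have hd : SmoothAtW (fun x : M × Ybar => actDiv G x.1 (𝒢.π (σ x.2)))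
          (fibreProd q 𝒢bar.π) x :=
        SmoothAtW.comp (g := fun z : M × M => actDiv G z.1 z.2)
          (f := fun x : M × Ybar => (x.1, 𝒢.π (σ x.2)))
          (hq.smoothAtW_div (p := (x.1, 𝒢.π (σ x.2))) (hmem.self_of_nhds hx))
          (((smoothAt_id x).fst.prodMk (𝒢.submersion.1.comp_smoothAt s2)).smoothAtW _) hx hmem
      refine SmoothAtW.congr (hd.act (s2.smoothAtW _)) ?_
      filter_upwards [hev, hmem] with x' hx' hm hx''
      refine 𝒢.eq_of_π_eq hq hqY ?_ ?_
      · rw [(hinv x' hx'').2, hqY.apply_smul, hx']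
      · rw [(hinv x' hx'').1, 𝒢.π_smul, hq.div_smul (hm hx'')]
    · have hy : (𝒢.π y, qY y) ∈ fibreProd q 𝒢bar.π := (h.π_comm y).symm
      exact 𝒢.eq_of_π_eq hq hqY (hinv _ hy).2 (hinv _ hy).1
  smooth_prP := h.submersion.1
  circle_smul := h.circle_smul
  proj_comm := h.proj_comm
  s_comm := h.s_comm
  prY_smul := hqY.apply_smul
  prP_smul := (h.isPrincipalQuotient hqY).apply_smul

namespace IsPullbackGerbe

variable {q : M → Mbar} {𝒢bar : BundleGerbe Mbar Ybar} {𝒢' : EquivariantGerbe G M Y'}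
  {prY : Y' → Ybar} {prP : 𝒢'.P.Total → 𝒢bar.P.Total} (hP : IsPullbackGerbe q 𝒢bar 𝒢' prY prP)

include hP

theorem eq_of_eq {y y' : Y'} (h₁ : 𝒢'.π y = 𝒢'.π y') (h₂ : prY y = prY y') : y = y' := by
  obtain ⟨inv, -, h, -⟩ := hP.isFibreProd
  rw [← h y, h₁, h₂, h]

/-- The universal property of the fibre product for smooth maps. -/
theorem exists_lift {m : L → M} {b : L → Ybar} (hm : SmoothMap m) (hb : SmoothMap b)
    (h : ∀ l, q (m l) = 𝒢bar.π (b l)) :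
    ∃ φ : L → Y', SmoothMap φ ∧ (∀ l, 𝒢'.π (φ l) = m l) ∧ ∀ l, prY (φ l) = b l := by
  obtain ⟨inv, hinv, -, h'⟩ := hP.isFibreProd
  refine ⟨fun l => inv (m l, b l), smoothMap_iff.2 fun l => ?_,
    fun l => congrArg Prod.fst (h' _ (h l)), fun l => congrArg Prod.snd (h' _ (h l))⟩
  exact SmoothAtW.comp_smoothAt (f := fun l => (m l, b l)) (hinv (m l, b l) (h l))
    ((hm.smoothAt l).prodMk (hb.smoothAt l)) (Eventually.of_forall h)

theorem prY_y₁ (p : 𝒢'.P.Total) : prY (𝒢'.y₁ p) = 𝒢bar.y₁ (prP p) :=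
  (congrArg Prod.fst (hP.proj_comm p)).symm

theorem prY_y₂ (p : 𝒢'.P.Total) : prY (𝒢'.y₂ p) = 𝒢bar.y₂ (prP p) :=
  (congrArg Prod.snd (hP.proj_comm p)).symm

theorem isTriangle_map {p p' p'' : 𝒢'.P.Total} (h : IsTriangle 𝒢'.P.proj p p' p'') :
    IsTriangle 𝒢bar.P.proj (prP p) (prP p') (prP p'') := by
  obtain ⟨h1, h2, h3⟩ := h
  refine ⟨?_, ?_, ?_⟩
  · rw [hP.proj_comm, hP.proj_comm]
    exact congrArg prY h1
  · rw [hP.proj_comm, hP.proj_comm]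
    exact congrArg prY h2
  · rw [hP.proj_comm, hP.proj_comm]
    exact congrArg prY h3

/-- The pull-back of a connection and a curving. -/
theorem isConnectionCurving {nabbar : ∀ p : 𝒢bar.P.Total, Tan p → ℝ}
    {fbar : ∀ y : Ybar, Tan y → Tan y → ℝ} (hc : 𝒢bar.IsConnection nabbar)
    (hf : 𝒢bar.IsCurving nabbar fbar) :
    𝒢'.IsConnectionCurving (pull1 prP nabbar) (pull2 prY fbar) where
  connection := by
    refine ⟨hc.1.pull1 hP.smooth_prP hP.circle_smul, fun x y z hx hy hz hxyz t => ?_⟩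
    have key := hc.hasDerivAt (hP.smooth_prP.comp_smoothAt (hx.smoothAt t))
      (hP.smooth_prP.comp_smoothAt (hy.smoothAt t)) (hP.smooth_prP.comp_smoothAt (hz.smoothAt t))
      (Eventually.of_forall fun s => hP.isTriangle_map (hxyz s))
    rw [pull1_comp (hx.smoothAt t) (hP.smooth_prP.smoothAt _),
      pull1_comp (hy.smoothAt t) (hP.smooth_prP.smoothAt _),
      pull1_comp (hz.smoothAt t) (hP.smooth_prP.smoothAt _)] at key
    simp only [fun s => hP.s_comm _ _ _ (hxyz s)] at key
    exact key
  connection_invariant := by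
    have := 𝒢'.smooth_smul_P
    intro g p v
    rw [← pull1_comp ((smoothMap_const_smul g).smoothAt p) (hP.smooth_prP.smoothAt _)]
    simp only [hP.prP_smul]
  curving := by
    refine ⟨hf.1.pull2 hP.smooth_prY, fun p v w => ?_⟩
    rw [hc.1.1.dForm_pull1 hP.smooth_prP, pull2, ← hf.2]
    change _ = pull2 prP (pull2 𝒢bar.y₂ fbar) p v w - pull2 prP (pull2 𝒢bar.y₁ fbar) p v w
    rw [BundleGerbe.delta2, ← pull2_comp (𝒢'.smoothMap_y₁.smoothAt p) (hP.smooth_prY.smoothAt _),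
      ← pull2_comp (𝒢'.smoothMap_y₂.smoothAt p) (hP.smooth_prY.smoothAt _),
      ← pull2_comp (hP.smooth_prP.smoothAt p) (𝒢bar.smoothMap_y₁.smoothAt _),
      ← pull2_comp (hP.smooth_prP.smoothAt p) (𝒢bar.smoothMap_y₂.smoothAt _)]
    simp only [hP.prY_y₁, hP.prY_y₂]
  curving_invariant := by
    have := 𝒢'.smooth_smul_Y
    intro g p v w
    rw [← pull2_comp ((smoothMap_const_smul g).smoothAt p) (hP.smooth_prY.smoothAt _)]
    simp only [hP.prY_smul]

variable {𝒢 : EquivariantGerbe G M Y} {qY : Y → Ybar} {ρ : 𝒢.P.Total → 𝒢bar.P.Total}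

/-- The isomorphism from a pull-back of the quotient to the original gerbe. -/
theorem exists_iso [IsSmoothAction G M] (hq : IsPrincipalQuotient G q)
    (hqY : IsPrincipalQuotient G qY)
    (h : IsQuotientGerbe 𝒢 q qY 𝒢bar ρ) :
    ∃ (ψ : Y' → Y) (φ : Y → Y') (J : 𝒢'.P.Total → 𝒢.P.Total), SmoothMap ψ ∧ SmoothMap φ ∧
      SmoothMap J ∧ (∀ y, φ (ψ y) = y) ∧ (∀ y, ψ (φ y) = y) ∧ (∀ y, 𝒢.π (ψ y) = 𝒢'.π y) ∧
      (∀ y, prY (φ y) = qY y) ∧ (∀ (g : G) y, φ (g • y) = g • φ y) ∧ (∀ p, ρ (J p) = prP p) ∧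
      (∀ p, 𝒢.P.proj (J p) = (ψ (𝒢'.y₁ p), ψ (𝒢'.y₂ p))) ∧ (∀ (g : G) p, J (g • p) = g • J p) ∧
      (∀ (z : Circle) p, J (z • p) = z • J p) := by
  have := 𝒢.smooth_smul_P
  have hS := h.isPullbackGerbe hq hqY
  have hρ := h.isPrincipalQuotient hqY
  obtain ⟨ψ, hψ, hψπ, hψY⟩ := hS.exists_lift 𝒢'.submersion.1 hP.smooth_prY hP.comm
  obtain ⟨φ, hφ, hφπ, hφY⟩ := hP.exists_lift 𝒢.submersion.1 hqY.smooth hS.comm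
  have hψg : ∀ (g : G) y, ψ (g • y) = g • ψ y := fun g y =>
    hS.eq_of_eq (by rw [hψπ, 𝒢'.π_smul, 𝒢.π_smul, hψπ])
      (by rw [hψY, hP.prY_smul, hqY.apply_smul, hψY])
  -- `J p` is the element of the orbit `prP p` over `ψ` of the first footpoint; the second footpoint
  -- is then forced.
  let J : 𝒢'.P.Total → 𝒢.P.Total := fun p =>
    𝒢.align (ψ (𝒢'.y₁ p)) (Function.surjInv hρ.surjective (prP p))
  have hJ : ∀ p p', ρ p' = prP p → 𝒢.align (ψ (𝒢'.y₁ p)) p' = J p ∧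
      qY (ψ (𝒢'.y₁ p)) = qY (𝒢.y₁ p') := by
    intro p p' hp'
    have e : qY (ψ (𝒢'.y₁ p)) = qY (𝒢.y₁ p') := by
      rw [hψY, hP.prY_y₁, hS.prY_y₁, hp']
    obtain ⟨g, hg⟩ := (hρ.fiber p' _).1 (hp'.trans (Function.surjInv_eq hρ.surjective (prP p)).symm)
    refine ⟨?_, e⟩
    change _ = 𝒢.align (ψ (𝒢'.y₁ p)) (Function.surjInv hρ.surjective (prP p))
    rw [← hg, 𝒢.align_smul hqY e]
  have hJρ : ∀ p, ρ (J p) = prP p := fun p =>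
    (hρ.apply_smul _ _).trans (Function.surjInv_eq hρ.surjective (prP p))
  have hJ₁ : ∀ p, 𝒢.y₁ (J p) = ψ (𝒢'.y₁ p) := by
    intro p
    have hp := hJ p _ (Function.surjInv_eq hρ.surjective (prP p))
    rw [← hp.1, 𝒢.y₁_align hqY hp.2]
  have hJ₂ : ∀ p, 𝒢.y₂ (J p) = ψ (𝒢'.y₂ p) := by
    intro p
    refine hS.eq_of_eq ?_ ?_
    · rw [← 𝒢.π_y₁, hJ₁, hψπ, hψπ, 𝒢'.π_y₁]
    · rw [hS.prY_y₂, hJρ, hψY, hP.prY_y₂]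
  refine ⟨ψ, φ, J, hψ, hφ, smoothMap_iff.2 fun p => ?_, fun y => hP.eq_of_eq ?_ ?_,
    fun y => hS.eq_of_eq ?_ ?_, hψπ, hφY, fun g y => hP.eq_of_eq ?_ ?_, hJρ,
    fun p => Prod.ext (hJ₁ p) (hJ₂ p), fun g p => 𝒢.eq_of_y₂_eq hqY hρ ?_ ?_,
    fun z p => 𝒢.eq_of_y₂_eq hqY hρ ?_ ?_⟩
  · obtain ⟨σ, hσ, hρσ⟩ := hρ.exists_section' (prP p)
    have s1 : SmoothAt (fun p => σ (prP p)) p := hσ.comp (hP.smooth_prP.smoothAt p)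
    have hev := hP.smooth_prP.continuous.continuousAt.eventually hρσ
    refine (𝒢.smoothAt_align hqY (hψ.comp_smoothAt (𝒢'.smoothMap_y₁.smoothAt p)) s1
      (hev.mono fun p' hp' => (hJ p' _ hp').2)).congr (hev.mono fun p' hp' => (hJ p' _ hp').1)
  · rw [hφπ, hψπ]
  · rw [hφY, hψY]
  · rw [hψπ, hφπ]
  · rw [hψY, hφY]
  · rw [hφπ, 𝒢.π_smul, 𝒢'.π_smul, hφπ]
  · rw [hφY, hqY.apply_smul, hP.prY_smul, hφY]
  · rw [hJρ, hP.prP_smul, hρ.apply_smul, hJρ]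
  · rw [hJ₂, 𝒢'.y₂_smul, hψg, 𝒢.y₂_smul, hJ₂]
  · rw [hJρ, hP.circle_smul, h.circle_smul, hJρ]
  · have e : ∀ (z : Circle) p, 𝒢.y₂ (z • p) = 𝒢.y₂ p := fun z p =>
      congrArg Prod.snd (𝒢.P.proj_smul z p)
    have e' : 𝒢'.y₂ (z • p) = 𝒢'.y₂ p := congrArg Prod.snd (𝒢'.P.proj_smul z p)
    rw [hJ₂, e', e, hJ₂]

end IsPullbackGerbe

end Pullback

/-! ### Squares in a gerbe -/

section Squares

variable {M : Type u} [TopologicalSpace M] [SmoothManifold M]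
variable {Y : Type u} [TopologicalSpace Y] [SmoothManifold Y]
variable {L : Type*} [TopologicalSpace L] [SmoothManifold L]

theorem SmoothAtW.circle_mul {f g : L → Circle} {S : Set L} {l : L}
    (hf : SmoothAtW (fun l => (f l : ℂ)) S l) (hg : SmoothAtW (fun l => (g l : ℂ)) S l) :
    SmoothAtW (fun l => ((f l * g l : Circle) : ℂ)) S l :=
  (smoothMap_complex_mul.comp_smoothAtW (hf.prodMk hg)).congr
    (Eventually.of_forall fun _ _ => by simp)

theorem SmoothAtW.circle_inv {f : L → Circle} {S : Set L} {l : L}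
    (hf : SmoothAtW (fun l => (f l : ℂ)) S l) : SmoothAtW (fun l => (((f l)⁻¹ : Circle) : ℂ)) S l :=
  ((smoothMap_clm (Complex.conjCLE : ℂ →L[ℝ] ℂ)).comp_smoothAtW hf).congr
    (Eventually.of_forall fun l _ => Circle.coe_inv_eq_conj (f l))

theorem HasDerivAt.circle_mul_inv {f g : ℝ → Circle} {t a b : ℝ}
    (hf : HasDerivAt (fun t => (f t : ℂ)) (-Complex.I * (a : ℂ) * f t) t)
    (hg : HasDerivAt (fun t => (g t : ℂ)) (-Complex.I * (b : ℂ) * g t) t) :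
    HasDerivAt (fun t => ((f t * (g t)⁻¹ : Circle) : ℂ))
      (-Complex.I * ((a - b : ℝ) : ℂ) * ((f t * (g t)⁻¹ : Circle) : ℂ)) t := by
  have hg0 : ∀ t, (g t : ℂ) ≠ 0 := fun t => Circle.coe_ne_zero _
  have h := hf.div hg (hg0 t)
  have e : (fun t => ((f t * (g t)⁻¹ : Circle) : ℂ)) = fun t => (f t : ℂ) / g t := by
    funext t
    rw [Circle.coe_mul, Circle.coe_inv, div_eq_mul_inv]
  rw [e]
  refine h.congr_deriv ?_
  rw [Circle.coe_mul, Circle.coe_inv]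
  have := hg0 t
  push_cast
  field_simp
  ring

namespace BundleGerbe

variable (𝒢 : BundleGerbe M Y)

/-- `r₂`, `r₁`, `m`, `p` lie over `(x₂, y₂)`, `(x₁, y₁)`, `(x₁, x₂)`, `(y₁, y₂)`. -/
structure IsSquare (r₂ r₁ m p : 𝒢.P.Total) : Prop where
  left : 𝒢.y₁ r₂ = 𝒢.y₂ m
  right : 𝒢.y₂ r₂ = 𝒢.y₂ p
  left' : 𝒢.y₁ r₁ = 𝒢.y₁ m
  right' : 𝒢.y₂ r₁ = 𝒢.y₁ p

/-- The coordinate of the section of `δr^{-1} ⊗ m^{-1} ⊗ p` given by the gerbe product, which is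
computed by means of any `u` over the diagonal of the square. -/
def square (r₂ r₁ m p : 𝒢.P.Total) : Circle :=
  let u : 𝒢.P.Total := @Classical.epsilon _ ⟨p⟩ fun u => 𝒢.P.proj u = (𝒢.y₁ r₁, 𝒢.y₂ p)
  𝒢.s p u r₁ * (𝒢.s r₂ u m)⁻¹

variable {𝒢} {r₂ r₁ m p u : 𝒢.P.Total}

theorem IsSquare.mem (h : 𝒢.IsSquare r₂ r₁ m p) : (𝒢.y₁ r₁, 𝒢.y₂ p) ∈ fibreProd 𝒢.π 𝒢.π := by
  change 𝒢.π (𝒢.y₁ r₁) = 𝒢.π (𝒢.y₂ p)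
  rw [𝒢.π_y₁, h.right', 𝒢.π_y₁]

theorem IsSquare.triangle (h : 𝒢.IsSquare r₂ r₁ m p) (hu : 𝒢.P.proj u = (𝒢.y₁ r₁, 𝒢.y₂ p)) :
    IsTriangle 𝒢.P.proj p u r₁ := by
  refine ⟨h.right', ?_, ?_⟩ <;> rw [hu] <;> rfl

theorem IsSquare.triangle' (h : 𝒢.IsSquare r₂ r₁ m p) (hu : 𝒢.P.proj u = (𝒢.y₁ r₁, 𝒢.y₂ p)) :
    IsTriangle 𝒢.P.proj r₂ u m := by
  refine ⟨h.left.symm, ?_, ?_⟩ <;> rw [hu]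
  · exact h.left'.symm
  · exact h.right

/-- Two choices of `u` differ by an element of the circle, which enters both values of `s` alike and
cancels in the quotient. -/
theorem IsSquare.square_eq (h : 𝒢.IsSquare r₂ r₁ m p) (hu : 𝒢.P.proj u = (𝒢.y₁ r₁, 𝒢.y₂ p)) :
    𝒢.square r₂ r₁ m p = 𝒢.s p u r₁ * (𝒢.s r₂ u m)⁻¹ := by
  have hu' := @Classical.epsilon_spec _ (fun u => 𝒢.P.proj u = (𝒢.y₁ r₁, 𝒢.y₂ p)) ⟨u, hu⟩
  obtain ⟨z, hz⟩ := 𝒢.P.exists_smul_eq (hu.trans hu'.symm)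
  have e1 := 𝒢.s_smul 1 z 1 _ _ _ (h.triangle hu)
  have e2 := 𝒢.s_smul 1 z 1 _ _ _ (h.triangle' hu)
  simp only [one_smul, inv_one, one_mul, mul_one] at e1 e2
  have e : 𝒢.square r₂ r₁ m p = 𝒢.s p (z • u) r₁ * (𝒢.s r₂ (z • u) m)⁻¹ := by
    rw [hz]
    rfl
  rw [e, e1, e2, mul_inv, mul_mul_mul_comm, mul_inv_cancel, one_mul]

theorem IsSquare.smul (h : 𝒢.IsSquare r₂ r₁ m p) (a b c d : Circle) :
    𝒢.IsSquare (a • r₂) (b • r₁) (c • m) (d • p) := by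
  have e₁ : ∀ (z : Circle) p, 𝒢.y₁ (z • p) = 𝒢.y₁ p := fun z p =>
    congrArg Prod.fst (𝒢.P.proj_smul z p)
  have e₂ : ∀ (z : Circle) p, 𝒢.y₂ (z • p) = 𝒢.y₂ p := fun z p =>
    congrArg Prod.snd (𝒢.P.proj_smul z p)
  constructor <;> simp only [e₁, e₂]
  exacts [h.left, h.right, h.left', h.right']

theorem IsSquare.square_smul (h : 𝒢.IsSquare r₂ r₁ m p) (a b c d : Circle) :
    𝒢.square (a • r₂) (b • r₁) (c • m) (d • p) = a * b⁻¹ * c * d⁻¹ * 𝒢.square r₂ r₁ m p := by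
  obtain ⟨u, hu⟩ := 𝒢.P.exists_proj_eq h.mem
  have hu' : 𝒢.P.proj u = (𝒢.y₁ (b • r₁), 𝒢.y₂ (d • p)) := by
    rw [BundleGerbe.y₁, BundleGerbe.y₂, 𝒢.P.proj_smul, 𝒢.P.proj_smul, hu]
    rfl
  rw [(h.smul a b c d).square_eq hu', h.square_eq hu]
  have e1 := 𝒢.s_smul d 1 b _ _ _ (h.triangle hu)
  have e2 := 𝒢.s_smul a 1 c _ _ _ (h.triangle' hu)
  rw [one_smul] at e1 e2
  rw [e1, e2]
  simp only [mul_one, mul_inv, inv_inv]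
  simp only [mul_comm, mul_left_comm, mul_assoc]

/-- The bookkeeping for `delta_square`, stated additively so that `abel` can treat the circle as an
`Additive` group. -/
theorem eq_of_alternating_sums {A : Type*} [AddCommGroup A] {a b c d e f g h i j k : A}
    (h₁ : a + -b + c + -d = 0) (h₂ : e + -b + f + -g = 0) (h₃ : h + -i + f + -j = 0) (hk : k = a) :
    e + -h + -(c + -i) + (d + -g) = -j + k := by
  subst hk
  have : e + -h + -(c + -i) + (d + -g) - (-j + k)
      = (e + -b + f + -g) - (k + -b + c + -d) - (h + -i + f + -j) := by abel
  rw [h₁, h₂, h₃, sub_zero, sub_zero] at this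
  exact sub_eq_zero.1 this

/-- The squares are the walls of a prism with bottom `x₁ x₂ x₃` and top `y₁ y₂ y₃`. Their diagonals
`u` cut it into the tetrahedra `x₁ y₁ y₂ y₃`, `x₁ x₂ y₂ y₃` and `x₁ x₂ x₃ y₃`. Each has `δs = 1`,
and the inner faces cancel. -/
theorem delta_square {r₁ r₂ r₃ m₁₂ m₁₃ m₂₃ p₁₂ p₁₃ p₂₃ : 𝒢.P.Total}
    (h₁₂ : 𝒢.IsSquare r₂ r₁ m₁₂ p₁₂) (h₁₃ : 𝒢.IsSquare r₃ r₁ m₁₃ p₁₃)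
    (h₂₃ : 𝒢.IsSquare r₃ r₂ m₂₃ p₂₃) :
    𝒢.square r₃ r₂ m₂₃ p₂₃ * (𝒢.square r₃ r₁ m₁₃ p₁₃)⁻¹ * 𝒢.square r₂ r₁ m₁₂ p₁₂
      = (𝒢.s m₂₃ m₁₃ m₁₂)⁻¹ * 𝒢.s p₂₃ p₁₃ p₁₂ := by
  obtain ⟨u₁₂, hu₁₂⟩ := 𝒢.P.exists_proj_eq h₁₂.mem
  obtain ⟨u₁₃, hu₁₃⟩ := 𝒢.P.exists_proj_eq h₁₃.mem
  obtain ⟨u₂₃, hu₂₃⟩ := 𝒢.P.exists_proj_eq h₂₃.mem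
  have t (p q r : 𝒢.P.Total) (e₁ : 𝒢.y₂ r = 𝒢.y₁ p) (e₂ : 𝒢.y₁ r = 𝒢.y₁ q)
    (e₃ : 𝒢.y₂ p = 𝒢.y₂ q) : IsTriangle 𝒢.P.proj p q r := ⟨e₁, e₂, e₃⟩
  have a₁₂ : 𝒢.y₁ u₁₂ = 𝒢.y₁ r₁ := (Prod.ext_iff.1 hu₁₂).1
  have b₁₂ : 𝒢.y₂ u₁₂ = 𝒢.y₂ p₁₂ := (Prod.ext_iff.1 hu₁₂).2
  have a₁₃ : 𝒢.y₁ u₁₃ = 𝒢.y₁ r₁ := (Prod.ext_iff.1 hu₁₃).1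
  have b₁₃ : 𝒢.y₂ u₁₃ = 𝒢.y₂ p₁₃ := (Prod.ext_iff.1 hu₁₃).2
  have a₂₃ : 𝒢.y₁ u₂₃ = 𝒢.y₁ r₂ := (Prod.ext_iff.1 hu₂₃).1
  have b₂₃ : 𝒢.y₂ u₂₃ = 𝒢.y₂ p₂₃ := (Prod.ext_iff.1 hu₂₃).2
  obtain ⟨l₁, l₂, l₃, l₄⟩ := h₁₂
  obtain ⟨l₅, l₆, l₇, l₈⟩ := h₁₃
  obtain ⟨l₉, l₁₀, l₁₁, l₁₂⟩ := h₂₃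
  have A := 𝒢.delta_s r₁ u₁₂ u₁₃ p₁₂ p₁₃ p₂₃ (t _ _ _ (by grind) (by grind) (by grind))
    (t _ _ _ (by grind) (by grind) (by grind)) (t _ _ _ (by grind) (by grind) (by grind))
    (t _ _ _ (by grind) (by grind) (by grind))
  have B := 𝒢.delta_s m₁₂ u₁₂ u₁₃ r₂ u₂₃ p₂₃ (t _ _ _ (by grind) (by grind) (by grind))
    (t _ _ _ (by grind) (by grind) (by grind)) (t _ _ _ (by grind) (by grind) (by grind))
    (t _ _ _ (by grind) (by grind) (by grind))
  have C := 𝒢.delta_s m₁₂ m₁₃ u₁₃ m₂₃ u₂₃ r₃ (t _ _ _ (by grind) (by grind) (by grind))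
    (t _ _ _ (by grind) (by grind) (by grind)) (t _ _ _ (by grind) (by grind) (by grind))
    (t _ _ _ (by grind) (by grind) (by grind))
  rw [IsSquare.square_eq ⟨l₁, l₂, l₃, l₄⟩ hu₁₂, IsSquare.square_eq ⟨l₅, l₆, l₇, l₈⟩ hu₁₃,
    IsSquare.square_eq ⟨l₉, l₁₀, l₁₁, l₁₂⟩ hu₂₃]
  exact eq_of_alternating_sums (A := Additive Circle) A B C rfl

/-- Local choice of elements over the diagonals of squares. -/
theorem exists_diagonal {S : Set L} {c₁ c₂ : L → 𝒢.P.Total} {l : L} (hl : l ∈ S)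
    (h₁ : SmoothAtW c₁ S l) (h₂ : SmoothAtW c₂ S l)
    (hmem : ∀ l ∈ S, (𝒢.y₁ (c₁ l), 𝒢.y₂ (c₂ l)) ∈ fibreProd 𝒢.π 𝒢.π) :
    ∃ u : L → 𝒢.P.Total, SmoothAtW u S l ∧
      ∀ᶠ l' in 𝓝 l, l' ∈ S → 𝒢.P.proj (u l') = (𝒢.y₁ (c₁ l'), 𝒢.y₂ (c₂ l')) := by
  obtain ⟨U, σ, τ, hU, hlU, hσ, -, hpσ, -⟩ := 𝒢.P.locally_trivial _ (hmem l hl)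
  let F : L → Y × Y := fun l => (𝒢.y₁ (c₁ l), 𝒢.y₂ (c₂ l))
  have hF : SmoothAtW F S l :=
    (𝒢.smoothMap_y₁.comp_smoothAtW h₁).prodMk (𝒢.smoothMap_y₂.comp_smoothAtW h₂)
  have hev : ∀ᶠ l' in 𝓝 l, l' ∈ S → F l' ∈ U ∩ fibreProd 𝒢.π 𝒢.π := by
    obtain ⟨F', hF', hFF'⟩ := hF.exists_smoothAt
    have hU' : U ∈ 𝓝 (F' l) := hU.mem_nhds (by rw [← hFF'.self_of_nhds hl]; exact hlU)
    filter_upwards [hFF', hF'.continuousAt.eventually hU'] with l' e hl' hS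
    exact ⟨by rw [e hS]; exact hl', hmem l' hS⟩
  exact ⟨fun l => σ (F l), SmoothAtW.comp (hσ (F l) ⟨hlU, hmem l hl⟩) hF hl hev,
    hev.mono fun l' h hS => hpσ _ (h hS)⟩

theorem smoothAtW_square {S : Set L} {r₂ r₁ m p : L → 𝒢.P.Total} {l : L} (hl : l ∈ S)
    (hr₂ : SmoothAtW r₂ S l) (hr₁ : SmoothAtW r₁ S l) (hm : SmoothAtW m S l) (hp : SmoothAtW p S l)
    (hsq : ∀ l ∈ S, 𝒢.IsSquare (r₂ l) (r₁ l) (m l) (p l)) :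
    SmoothAtW (fun l => (𝒢.square (r₂ l) (r₁ l) (m l) (p l) : ℂ)) S l := by
  obtain ⟨u, hu, hpu⟩ := exists_diagonal hl hr₁ hp fun l h => (hsq l h).mem
  have key : ∀ a b c : L → 𝒢.P.Total, SmoothAtW a S l → SmoothAtW b S l → SmoothAtW c S l →
      (∀ᶠ l' in 𝓝 l, l' ∈ S → IsTriangle 𝒢.P.proj (a l') (b l') (c l')) →
      SmoothAtW (fun l => (𝒢.s (a l) (b l) (c l) : ℂ)) S l := by
    intro a b c ha hb hc h
    let F : L → 𝒢.P.Total × 𝒢.P.Total × 𝒢.P.Total := fun l => (a l, b l, c l)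
    have hF : SmoothAtW F S l := ha.prodMk (hb.prodMk hc)
    exact SmoothAtW.comp (f := F) (𝒢.s_smooth (F l) (h.self_of_nhds hl)) hF hl h
  refine ((key p u r₁ hp hu hr₁ ?_).circle_mul (key r₂ u m hr₂ hu hm ?_).circle_inv).congr ?_
  · filter_upwards [hpu] with l' h hS using (hsq l' hS).triangle (h hS)
  · filter_upwards [hpu] with l' h hS using (hsq l' hS).triangle' (h hS)
  · filter_upwards [hpu] with l' h hS
    rw [(hsq l' hS).square_eq (h hS)]

/-- The two triangles of the square share the diagonal `u`, whose contribution cancels. -/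
theorem IsConnection.hasDerivAt_square {nab : ∀ p : 𝒢.P.Total, Tan p → ℝ} (h : 𝒢.IsConnection nab)
    {r₂ r₁ m p : ℝ → 𝒢.P.Total} {t : ℝ} (hr₂ : SmoothAt r₂ t) (hr₁ : SmoothAt r₁ t)
    (hm : SmoothAt m t) (hp : SmoothAt p t)
    (hsq : ∀ t, 𝒢.IsSquare (r₂ t) (r₁ t) (m t) (p t)) :
    HasDerivAt (fun t => (𝒢.square (r₂ t) (r₁ t) (m t) (p t) : ℂ))
      (-Complex.I * ((-pull1 r₂ nab t (1 : ℝ) + pull1 r₁ nab t (1 : ℝ) - pull1 m nab t (1 : ℝ)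
        + pull1 p nab t (1 : ℝ) : ℝ) : ℂ) * (𝒢.square (r₂ t) (r₁ t) (m t) (p t) : ℂ)) t := by
  obtain ⟨u, hu, hpu⟩ := exists_diagonal (mem_univ t) (hr₁.smoothAtW univ) (hp.smoothAtW univ)
    fun t _ => (hsq t).mem
  have hu := hu.smoothAt univ_mem
  have hpu : ∀ᶠ s in 𝓝 t, 𝒢.P.proj (u s) = (𝒢.y₁ (r₁ s), 𝒢.y₂ (p s)) :=
    hpu.mono fun s hs => hs (mem_univ s)
  have k1 := h.hasDerivAt hp hu hr₁ (hpu.mono fun s hs => (hsq s).triangle hs)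
  have k2 := h.hasDerivAt hr₂ hu hm (hpu.mono fun s hs => (hsq s).triangle' hs)
  have k := k1.circle_mul_inv k2
  have hev : ∀ᶠ s in 𝓝 t, 𝒢.square (r₂ s) (r₁ s) (m s) (p s)
      = 𝒢.s (p s) (u s) (r₁ s) * (𝒢.s (r₂ s) (u s) (m s))⁻¹ :=
    hpu.mono fun s hs => (hsq s).square_eq hs
  refine (k.congr_of_eventuallyEq (hev.mono fun s hs =>
    congrArg (fun z : Circle => (z : ℂ)) hs)).congr_deriv ?_
  refine congrArg₂ (· * ·) (congrArg (fun x : ℝ => -Complex.I * (x : ℂ)) ?_)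
    (congrArg (fun z : Circle => (z : ℂ)) hev.self_of_nhds.symm)
  ring

end BundleGerbe

theorem EquivariantGerbe.square_invariant {G : Type u} [Group G] [TopologicalSpace G]
    [SmoothManifold G] [IsLieGroup G] [MulAction G M] [MulAction G Y] (𝒢 : EquivariantGerbe G M Y)
    {r₂ r₁ m p : 𝒢.P.Total} (h : 𝒢.IsSquare r₂ r₁ m p) (g : G) :
    𝒢.square (g • r₂) (g • r₁) (g • m) (g • p) = 𝒢.square r₂ r₁ m p := by
  obtain ⟨u, hu⟩ := 𝒢.P.exists_proj_eq h.mem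
  have h' : 𝒢.IsSquare (g • r₂) (g • r₁) (g • m) (g • p) := by
    constructor <;> simp only [𝒢.y₁_smul, 𝒢.y₂_smul]
    exacts [congrArg _ h.left, congrArg _ h.right, congrArg _ h.left', congrArg _ h.right']
  have hu' : 𝒢.P.proj (g • u) = (𝒢.y₁ (g • r₁), 𝒢.y₂ (g • p)) := by
    rw [𝒢.proj_smul, hu, 𝒢.y₁_smul, 𝒢.y₂_smul]
  rw [h'.square_eq hu', h.square_eq hu, 𝒢.s_invariant g _ _ _ (h.triangle hu),
    𝒢.s_invariant g _ _ _ (h.triangle' hu)]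

end Squares

/-! ### The stable isomorphism -/

section Stable

/-- The circle bundle `P` over `S` viewed as a bundle over the diffeomorphic submanifold `S'`. -/
@[reducible]
def CircleBundle.reindex {B B' : Type u} [TopologicalSpace B] [SmoothManifold B]
    [TopologicalSpace B'] [SmoothManifold B'] {S : Set B} (P : CircleBundle B S) {S' : Set B'}
    (Φ : B → B') (Ψ : B' → B) (hΦ : SmoothMap Φ) (hΨ : SmoothMap Ψ) (hS : ∀ b ∈ S, Φ b ∈ S')
    (hS' : ∀ b ∈ S', Ψ b ∈ S) (hΨΦ : ∀ b ∈ S, Ψ (Φ b) = b) (hΦΨ : ∀ b ∈ S', Φ (Ψ b) = b) :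
    CircleBundle B' S' where
  Total := P.Total
  proj p := Φ (P.proj p)
  proj_mem p := hS _ (P.proj_mem p)
  smooth_proj := hΦ.comp P.smooth_proj
  smooth_act := P.smooth_act
  proj_smul z p := by rw [P.proj_smul]
  free := P.free
  locally_trivial b hb := by
    obtain ⟨U, σ, τ, hU, hbU, hσ, hτ, h1, h2⟩ := P.locally_trivial (Ψ b) (hS' b hb)
    have hpre : (fun p => Φ (P.proj p)) ⁻¹' (Ψ ⁻¹' U) = P.proj ⁻¹' U := by
      ext p
      simp only [mem_preimage, hΨΦ _ (P.proj_mem p)]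
    refine ⟨Ψ ⁻¹' U, fun b => σ (Ψ b), τ, hU.preimage hΨ.continuous, hbU, fun b' hb' => ?_, ?_,
      fun b' hb' => ?_, fun p hp => ?_⟩
    · exact SmoothAtW.comp (hσ (Ψ b') ⟨hb'.1, hS' b' hb'.2⟩) ((hΨ.smoothAt b').smoothAtW _) hb'
        (Eventually.of_forall fun x hx => ⟨hx.1, hS' x hx.2⟩)
    · rw [hpre]
      exact hτ
    · rw [h1 _ ⟨hb'.1, hS' b' hb'.2⟩, hΦΨ b' hb'.2]
    · rw [hpre] at hp
      change p = τ p • σ (Ψ (Φ (P.proj p)))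
      rw [hΨΦ _ (P.proj_mem p)]
      exact h2 p hp

variable {G : Type u} [Group G] [TopologicalSpace G] [SmoothManifold G] [IsLieGroup G]
variable {M : Type u} [TopologicalSpace M] [SmoothManifold M] [MulAction G M] [IsSmoothAction G M]
variable {Y : Type u} [TopologicalSpace Y] [SmoothManifold Y] [MulAction G Y]
variable {Y' : Type u} [TopologicalSpace Y'] [SmoothManifold Y'] [MulAction G Y']
variable {Mbar : Type u} [TopologicalSpace Mbar] [SmoothManifold Mbar]
variable {Ybar : Type u} [TopologicalSpace Ybar] [SmoothManifold Ybar]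

theorem IsCircleConnection.add_pull1 {B : Type u} [TopologicalSpace B] [SmoothManifold B] {S : Set B}
    {P : CircleBundle B S} {θ : ∀ p : P.Total, Tan p → ℝ} (h : IsCircleConnection P θ)
    {N : Type*} [TopologicalSpace N] [SmoothManifold N] {φ : P.Total → N} (hφ : SmoothMap φ)
    (hφz : ∀ (z : Circle) p, φ (z • p) = φ p) {κ : ∀ y : N, Tan y → ℝ} (hκ : IsForm1 κ) :
    IsCircleConnection P fun p v => θ p v + _root_.pull1 φ κ p v := by
  refine ⟨h.1.add (hκ.pull1 hφ), fun z p v => congrArg₂ (· + ·) (h.2.1 z p v) ?_, fun p => ?_⟩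
  · change _root_.pull1 (fun p : P.Total => z • p) (_root_.pull1 φ κ) p v = _
    rw [← pull1_comp ((P.smoothMap_smul z).smoothAt p) (hφ.smoothAt _)]
    simp only [hφz]
  · change θ p _ + _root_.pull1 φ κ p _ = 1
    rw [h.2.2 p, form1_apply_congr (_root_.pull1 φ κ) (c := fun t : ℝ => Circle.exp t • p) (by simp),
      ← pull1_comp (P.smoothAt_orbit p) (hφ.smoothAt _)]
    simp only [hφz]
    rw [pull1_const hκ.1, add_zero]

/-- The data of a stable isomorphism given by an isomorphism `J` of gerbes covering `ψ`, where the
connection is changed by a coboundary. -/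
theorem nonempty_stableIso {𝒢 : EquivariantGerbe G M Y} {𝒢' : EquivariantGerbe G M Y'}
    {nab : ∀ p : 𝒢.P.Total, Tan p → ℝ} {f : ∀ y : Y, Tan y → Tan y → ℝ}
    {nab' : ∀ p : 𝒢'.P.Total, Tan p → ℝ} {f' : ∀ y : Y', Tan y → Tan y → ℝ}
    {κ : ∀ y : Y, Tan y → ℝ} (h𝒢 : 𝒢.IsConnectionCurving nab f) (hκ : IsForm1 κ)
    (hκG : IsInvariant1 G κ) {ψ : Y' → Y} {φ : Y → Y'} {J : 𝒢'.P.Total → 𝒢.P.Total}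
    (hψ : SmoothMap ψ) (hφ : SmoothMap φ) (hJ : SmoothMap J) (hφψ : ∀ y, φ (ψ y) = y)
    (hψφ : ∀ y, ψ (φ y) = y) (hπ : ∀ y, 𝒢.π (ψ y) = 𝒢'.π y)
    (hφg : ∀ (g : G) y, φ (g • y) = g • φ y)
    (hJp : ∀ p, 𝒢.P.proj (J p) = (ψ (𝒢'.y₁ p), ψ (𝒢'.y₂ p)))
    (hJg : ∀ (g : G) p, J (g • p) = g • J p) (hJz : ∀ (z : Circle) p, J (z • p) = z • J p)
    (hs : ∀ p q r, IsTriangle 𝒢'.P.proj p q r → 𝒢.s (J p) (J q) (J r) = 𝒢'.s p q r)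
    (hnab : ∀ p v, nab' p v = pull1 J (fun p v => nab p v - 𝒢.delta1 κ p v) p v)
    (hf : ∀ y v w, pull2 φ f' y v w = f y v w - dForm κ y v w) :
    Nonempty (StableIso 𝒢' nab' f' 𝒢 nab f) := by
  have := 𝒢.smooth_smul_Y
  have := 𝒢.smooth_smul_P
  -- `R` is `P` with its first footpoint carried to `Y'` by `φ`: its fibre over `(y', y)` is that of
  -- `P` over `(ψ y', y)`.
  let R : CircleBundle (Y' × Y) (fibreProd 𝒢'.π 𝒢.π) :=
    𝒢.P.reindex (fun x => (φ x.1, x.2)) (fun x => (ψ x.1, x.2))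
      ((hφ.comp smoothMap_fst).prodMk smoothMap_snd) ((hψ.comp smoothMap_fst).prodMk smoothMap_snd)
      (fun b hb => by
        have hb : 𝒢.π b.1 = 𝒢.π b.2 := hb
        change 𝒢'.π (φ b.1) = 𝒢.π b.2
        rw [← hπ, hψφ, hb])
      (fun b hb => by
        have hb : 𝒢'.π b.1 = 𝒢.π b.2 := hb
        change 𝒢.π (ψ b.1) = 𝒢.π b.2
        rw [hπ, hb])
      (fun b _ => by simp only [hψφ]) (fun b _ => by simp only [hφψ])
  have hJ₁ : ∀ p, 𝒢.y₁ (J p) = ψ (𝒢'.y₁ p) := fun p => congrArg Prod.fst (hJp p)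
  have hJ₂ : ∀ p, 𝒢.y₂ (J p) = ψ (𝒢'.y₂ p) := fun p => congrArg Prod.snd (hJp p)
  have hsq : ∀ (r₂ r₁ : 𝒢.P.Total) (p' : 𝒢'.P.Total) (p : 𝒢.P.Total),
      LiesOverSquare 𝒢'.P.proj 𝒢.P.proj R.proj r₂ r₁ p' p → 𝒢.IsSquare r₂ r₁ (J p') p := by
    intro r₂ r₁ p' p h
    have e1 : φ (𝒢.y₁ r₂) = 𝒢'.y₂ p' := (Prod.ext_iff.1 h.1).1
    have e2 : 𝒢.y₂ r₂ = 𝒢.y₂ p := (Prod.ext_iff.1 h.1).2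
    have e3 : φ (𝒢.y₁ r₁) = 𝒢'.y₁ p' := (Prod.ext_iff.1 h.2).1
    have e4 : 𝒢.y₂ r₁ = 𝒢.y₁ p := (Prod.ext_iff.1 h.2).2
    exact ⟨by rw [hJ₂, ← e1, hψφ], e2, by rw [hJ₁, ← e3, hψφ], e4⟩
  refine ⟨{
    R := R
    actR := 𝒢.actP
    smooth_smul_R := 𝒢.smooth_smul_P
    proj_smul := fun g r => ?_
    smul_circle_smul := 𝒢.smul_circle_smul
    -- `J` moves `p'` into `P`, where the gerbe product compares the two ways around the square.
    v := fun r₂ r₁ p' p => 𝒢.square r₂ r₁ (J p') p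
    v_smooth := fun x hx => ?_
    v_smul := fun a b c d r₂ r₁ p' p h => ?_
    v_invariant := fun g r₂ r₁ p' p h => ?_
    delta_v := fun r₁ r₂ r₃ p₁₂ p₁₃ p₂₃ p₁₂' p₁₃' p₂₃' h₁₂ h₁₃ h₂₃ => ?_
    -- The term `y₁^*κ` compensates for `∇'` being the pull-back of `∇ - δκ` instead of `∇`; its
    -- differential turns `f` at the first footpoint into `f - dκ`.
    η := fun r v => nab r v + pull1 𝒢.y₁ κ r v
    η_connection := ?_
    η_invariant := h𝒢.connection_invariant.add (hκG.pull1 𝒢.smoothMap_y₁ 𝒢.y₁_smul)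
    v_flat := fun r₂ r₁ p' p hr₂ hr₁ hp' hp h t => ?_
    curvature := fun r x w => ?_ }⟩
  · change (φ (𝒢.y₁ (g • r)), 𝒢.y₂ (g • r)) = _
    rw [𝒢.y₁_smul, 𝒢.y₂_smul, hφg]
    rfl
  · exact BundleGerbe.smoothAtW_square hx
      (r₂ := fun x : 𝒢.P.Total × 𝒢.P.Total × 𝒢'.P.Total × 𝒢.P.Total => x.1)
      (r₁ := fun x => x.2.1) (m := fun x => J x.2.2.1) (p := fun x => x.2.2.2)
      ((smoothAt_id x).fst.smoothAtW _) ((smoothAt_id x).snd.fst.smoothAtW _)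
      ((hJ.comp_smoothAt (smoothAt_id x).snd.snd.fst).smoothAtW _)
      ((smoothAt_id x).snd.snd.snd.smoothAtW _) fun x hx => hsq _ _ _ _ hx
  · rw [hJz]
    exact (hsq _ _ _ _ h).square_smul a b c d
  · rw [hJg]
    exact 𝒢.square_invariant (hsq _ _ _ _ h) g
  · have tri : IsTriangle 𝒢'.P.proj p₂₃ p₁₃ p₁₂ := by
      refine ⟨?_, ?_, ?_⟩
      · exact (Prod.ext_iff.1 h₁₂.1).1.symm.trans (Prod.ext_iff.1 h₂₃.2).1
      · exact (Prod.ext_iff.1 h₁₂.2).1.symm.trans (Prod.ext_iff.1 h₁₃.2).1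
      · exact (Prod.ext_iff.1 h₂₃.1).1.symm.trans (Prod.ext_iff.1 h₁₃.1).1
    rw [← hs _ _ _ tri]
    exact BundleGerbe.delta_square (hsq _ _ _ _ h₁₂) (hsq _ _ _ _ h₁₃) (hsq _ _ _ _ h₂₃)
  · exact IsCircleConnection.add_pull1 (P := R) h𝒢.connection.1 𝒢.smoothMap_y₁
      (fun z p => congrArg Prod.fst (𝒢.P.proj_smul z p)) hκ
  · have hJp' := hJ.comp_smoothAt (hp'.smoothAt t)
    have hsqt := fun t => hsq _ _ _ _ (h t)
    have key := h𝒢.connection.hasDerivAt_square (hr₂.smoothAt t) (hr₁.smoothAt t) hJp'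
      (hp.smoothAt t) hsqt
    refine key.congr_deriv (congrArg (fun x : ℝ => -Complex.I * (x : ℂ) * _) ?_)
    have e1 : ∀ r : ℝ → 𝒢.P.Total, SmoothMap r → nab (r t) (velocity r t)
        + pull1 𝒢.y₁ κ (r t) (velocity r t)
        = pull1 r nab t (1 : ℝ) + pull1 (fun t => 𝒢.y₁ (r t)) κ t (1 : ℝ) := by
      intro r hr
      rw [pull1_comp (hr.smoothAt t) (𝒢.smoothMap_y₁.smoothAt _)]
      rfl
    have e2 : nab' (p' t) (velocity p' t) = pull1 (fun t => J (p' t)) nab t (1 : ℝ)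
        - (pull1 (fun t => 𝒢.y₂ (J (p' t))) κ t (1 : ℝ)
          - pull1 (fun t => 𝒢.y₁ (J (p' t))) κ t (1 : ℝ)) := by
      rw [hnab, pull1_comp hJp' (𝒢.smoothMap_y₁.smoothAt _),
        pull1_comp hJp' (𝒢.smoothMap_y₂.smoothAt _)]
      change pull1 p' (pull1 J (fun p v => nab p v - 𝒢.delta1 κ p v)) t (1 : ℝ) = _
      rw [← pull1_comp (hp'.smoothAt t) (hJ.smoothAt _)]
      rfl
    have e3 : (fun t => 𝒢.y₁ (r₂ t)) = fun t => 𝒢.y₂ (J (p' t)) := funext fun t => (hsqt t).left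
    have e4 : (fun t => 𝒢.y₁ (r₁ t)) = fun t => 𝒢.y₁ (J (p' t)) := funext fun t => (hsqt t).left'
    have e5 : nab (p t) (velocity p t) = pull1 p nab t (1 : ℝ) := rfl
    rw [e1 r₂ hr₂, e1 r₁ hr₁, e2, e3, e4, e5]
    ring
  · have h1 : dForm (fun r v => nab r v + pull1 𝒢.y₁ κ r v) r x w
        = pull2 𝒢.y₂ f r x w - pull2 𝒢.y₁ f r x w + pull2 𝒢.y₁ (dForm κ) r x w := by
      rw [h𝒢.connection.1.1.dForm_add (hκ.pull1 𝒢.smoothMap_y₁), ← h𝒢.curving.2,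
        hκ.dForm_pull1 𝒢.smoothMap_y₁, BundleGerbe.delta2]
    have h2 : pull2 (fun r => φ (𝒢.y₁ r)) f' r x w
        = pull2 𝒢.y₁ f r x w - pull2 𝒢.y₁ (dForm κ) r x w := by
      rw [pull2_comp (𝒢.smoothMap_y₁.smoothAt r) (hφ.smoothAt _), pull2, hf]
      rfl
    change dForm (fun r v => nab r v + pull1 𝒢.y₁ κ r v) r x w
      = pull2 𝒢.y₂ f r x w - pull2 (fun r => φ (𝒢.y₁ r)) f' r x w
    rw [h1, h2]
    ring

/-- A pull-back of the quotient gerbe is stably isomorphic to the original gerbe. -/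
theorem IsPullbackGerbe.nonempty_stableIso {q : M → Mbar} {qY : Y → Ybar}
    {𝒢bar : BundleGerbe Mbar Ybar} {𝒢 : EquivariantGerbe G M Y} {𝒢' : EquivariantGerbe G M Y'}
    {ρ : 𝒢.P.Total → 𝒢bar.P.Total} {prY : Y' → Ybar} {prP : 𝒢'.P.Total → 𝒢bar.P.Total}
    (hP : IsPullbackGerbe q 𝒢bar 𝒢' prY prP) (hq : IsPrincipalQuotient G q)
    (hqY : IsPrincipalQuotient G qY) (h : IsQuotientGerbe 𝒢 q qY 𝒢bar ρ)
    {nab : ∀ p : 𝒢.P.Total, Tan p → ℝ} {f : ∀ y : Y, Tan y → Tan y → ℝ}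
    {κ : ∀ y : Y, Tan y → ℝ} (h𝒢 : 𝒢.IsConnectionCurving nab f) (hκ : IsForm1 κ)
    (hκG : IsInvariant1 G κ) {nabbar : ∀ p : 𝒢bar.P.Total, Tan p → ℝ}
    {fbar : ∀ y : Ybar, Tan y → Tan y → ℝ}
    (hnab : ∀ p v, pull1 ρ nabbar p v = nab p v - 𝒢.delta1 κ p v)
    (hf : ∀ y v w, pull2 qY fbar y v w = f y v w - dForm κ y v w) :
    Nonempty (StableIso 𝒢' (pull1 prP nabbar) (pull2 prY fbar) 𝒢 nab f) := by
  obtain ⟨ψ, φ, J, hψ, hφ, hJ, hφψ, hψφ, hπ, hφY, hφg, hJρ, hJp, hJg, hJz⟩ :=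
    hP.exists_iso hq hqY h
  refine _root_.nonempty_stableIso h𝒢 hκ hκG hψ hφ hJ hφψ hψφ hπ hφg hJp hJg hJz
    (fun p p' p'' hp => ?_) (fun p v => ?_) fun y v w => ?_
  · rw [← hP.s_comm _ _ _ hp, ← hJρ, ← hJρ, ← hJρ, h.s_comm]
    obtain ⟨h1, h2, h3⟩ := hp
    refine ⟨?_, ?_, ?_⟩ <;> rw [hJp, hJp]
    exacts [congrArg ψ h1, congrArg ψ h2, congrArg ψ h3]
  · have e : prP = fun p => ρ (J p) := funext fun p => (hJρ p).symm
    rw [e, pull1_comp (hJ.smoothAt p) (h.submersion.1.smoothAt _), pull1, hnab]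
    rfl
  · rw [← pull2_comp (hφ.smoothAt y) (hP.smooth_prY.smoothAt _), ← hf]
    simp only [hφY]

end Stable

end

theorem mainTheorem2
    {G : Type u} [Group G] [TopologicalSpace G] [SmoothManifold G] [IsLieGroup G]
    {M : Type u} [TopologicalSpace M] [SmoothManifold M] [MulAction G M] [IsSmoothAction G M]
    {Y : Type u} [TopologicalSpace Y] [SmoothManifold Y] [MulAction G Y]
    {Mbar : Type u} [TopologicalSpace Mbar] [SmoothManifold Mbar]
    {Ybar : Type u} [TopologicalSpace Ybar] [SmoothManifold Ybar]
    (𝒢 : EquivariantGerbe G M Y)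
    (nab : ∀ p : 𝒢.P.Total, SmoothManifold.Tan p → ℝ)
    (f : ∀ y : Y, SmoothManifold.Tan y → SmoothManifold.Tan y → ℝ)
    (h𝒢 : 𝒢.IsConnectionCurving nab f)
    (q : M → Mbar) (hq : IsPrincipalQuotient G q)
    (qY : Y → Ybar) (hqY : IsPrincipalQuotient G qY)
    (lam : Y → SmoothManifold.Tan (1 : G) →L[ℝ] ℝ) (hlam : IsReductionMap 𝒢 nab f lam)
    (Ξ : ∀ x : M, SmoothManifold.Tan x → SmoothManifold.Tan (1 : G))
    (hΞ : IsPrincipalConnection Ξ) :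
    (∃ (𝒢bar : BundleGerbe Mbar Ybar) (ρ : 𝒢.P.Total → 𝒢bar.P.Total),
      IsQuotientGerbe 𝒢 q qY 𝒢bar ρ) ∧
    ∀ (𝒢bar : BundleGerbe Mbar Ybar) (ρ : 𝒢.P.Total → 𝒢bar.P.Total),
      IsQuotientGerbe 𝒢 q qY 𝒢bar ρ →
      ∃ (nabbar : ∀ p : 𝒢bar.P.Total, SmoothManifold.Tan p → ℝ)
        (fbar : ∀ y : Ybar, SmoothManifold.Tan y → SmoothManifold.Tan y → ℝ),
        𝒢bar.IsConnection nabbar ∧ 𝒢bar.IsCurving nabbar fbar ∧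
        (∀ p v, pull1 ρ nabbar p v = nab p v - 𝒢.delta1 (kappa 𝒢 Ξ lam) p v) ∧
        (∀ y v w, pull2 qY fbar y v w = f y v w - dForm (kappa 𝒢 Ξ lam) y v w) ∧
        (∀ nabbar' : ∀ p : 𝒢bar.P.Total, SmoothManifold.Tan p → ℝ,
          (∀ p v, pull1 ρ nabbar' p v = nab p v - 𝒢.delta1 (kappa 𝒢 Ξ lam) p v) →
          nabbar' = nabbar) ∧
        (∀ fbar' : ∀ y : Ybar, SmoothManifold.Tan y → SmoothManifold.Tan y → ℝ,
          (∀ y v w, pull2 qY fbar' y v w = f y v w - dForm (kappa 𝒢 Ξ lam) y v w) →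
          fbar' = fbar) ∧
        (∃ (Y' : Type u) (_ : TopologicalSpace Y') (_ : SmoothManifold Y') (_ : MulAction G Y')
          (𝒢' : EquivariantGerbe G M Y') (prY : Y' → Ybar)
          (prP : 𝒢'.P.Total → 𝒢bar.P.Total), IsPullbackGerbe q 𝒢bar 𝒢' prY prP) ∧
        ∀ (Y' : Type u) [TopologicalSpace Y'] [SmoothManifold Y'] [MulAction G Y']
          (𝒢' : EquivariantGerbe G M Y') (prY : Y' → Ybar)
          (prP : 𝒢'.P.Total → 𝒢bar.P.Total), IsPullbackGerbe q 𝒢bar 𝒢' prY prP →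
          𝒢'.IsConnectionCurving (pull1 prP nabbar) (pull2 prY fbar) ∧
          Nonempty (StableIso 𝒢' (pull1 prP nabbar) (pull2 prY fbar) 𝒢 nab f) := by
  refine ⟨𝒢.exists_quotient_gerbe hq hqY, fun 𝒢bar ρ h => ?_⟩
  have := 𝒢.smooth_smul_Y
  have := 𝒢.smooth_smul_P
  have hρ := h.isPrincipalQuotient hqY
  have hκ := EquivariantGerbe.isForm1_kappa hlam hΞ
  obtain ⟨nabbar, hnabbar, hnab⟩ :=
    hρ.exists_descend1 (EquivariantGerbe.isBasic1_sub_kappa h𝒢 hlam hΞ)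
  obtain ⟨fbar, hfbar, hf⟩ :=
    hqY.exists_descend2 (EquivariantGerbe.isBasic2_sub_kappa h𝒢 hlam hΞ)
  have hc := h.isConnection hq hqY hκ hnabbar hnab h𝒢.connection
  have hcurv := h.isCurving hq hqY hκ hnabbar hnab h𝒢.connection.1.1 h𝒢.curving hfbar hf
  exact ⟨nabbar, fbar, hc, hcurv, hnab, hf,
    fun nabbar' h' => hρ.pull1_injective fun p v => (h' p v).trans (hnab p v).symm,
    fun fbar' h' => hqY.pull2_injective fun y v w => (h' y v w).trans (hf y v w).symm,
    -- A pull-back need not be constructed: `𝒢` with its two quotient maps is one.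
    ⟨Y, _, _, _, 𝒢, qY, ρ, h.isPullbackGerbe hq hqY⟩,
    fun _ _ _ _ _ _ _ hP => ⟨hP.isConnectionCurving hc hcurv, hP.nonempty_stableIso hq hqY h h𝒢 hκ
      (EquivariantGerbe.isInvariant1_kappa hlam hΞ) hnab hf⟩⟩
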